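/- **Theorem 1.** For a graph $G=(V,E)$ with $n$ vertices and $m$ edges, a $(\beta,d)$ decomposition is a partition of $V$ into pieces such that any two vertices of a piece $S$ are at distance at most $d$ in the induced subgraph $G[S]$ (strong diameter at most $d$), and at most $\beta m$ edges have their endpoints in different pieces. Consider the randomized CRCW PRAM with words of $w$ bits: word arithmetic and drawing a uniformly random word from a range $\{0,\dots,t\}$ take unit time, concurrent writes to a cell are resolved arbitrarily, and a real parameter may be compared with ratios of words in unit time. Depth is the number of parallel time units and work is the total number of operations executed. There are a single program $\textsc{Partition}$ and constants $b, C$ such that the following holds for every simple undirected unweighted graph $G$ with $n\ge 2$ vertices and $m$ edges, given by any adjacency array, every real $0<\beta\le 1/2$, every word length $w$ with $2^w\ge n^b$, and every way of resolving concurrent writes: 1. whenever the program halts, its output is a $(\beta,\, C\,\frac{\log n}{\beta})$ decomposition of $G$; 2. its expected depth is at most $C\,\frac{\log^2 n}{\beta}$ (in particular it halts with probability one); 3. its expected work is at most $C\,(n+m)$, and at most $C\,m$ if $G$ has no isolated vertices. -/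

import Mathlib

open scoped ENNReal

noncomputable section

/-! ### Low-diameter decompositions -/

/-- `P` is a `(β, d)` decomposition of `G`: it partitions the vertex set, any two vertices of a
piece are joined, inside that piece, by a path of length at most `d` (strong diameter), and at most
a `β` fraction of the edges have their endpoints in different pieces. -/
structure IsLowDiameterDecomposition {V : Type*} (G : SimpleGraph V) (β d : ℝ)
    (P : Set (Set V)) : Prop where
  isPartition : Setoid.IsPartition P
  strongDiam : ∀ S ∈ P, ∀ u v : S,
    (G.induce S).Reachable u v ∧ ((G.induce S).dist u v : ℝ) ≤ d
  cut : (({e ∈ G.edgeSet | ¬ ∃ S ∈ P, ∀ v ∈ e, v ∈ S} : Set (Sym2 V)).ncard : ℝ)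
    ≤ β * (G.edgeSet.ncard : ℝ)

/-! ### A randomized CRCW PRAM on `w`-bit words

The shared memory consists of arrays of words. A program is a control flow over synchronous parallel
steps: in one step, processors `0, …, k - 1` each evaluate the same expressions on the memory
as it was before the step, and then write simultaneously. -/

namespace PRAM

/-- Arithmetic and comparisons on words. -/
inductive BinOp where
  | add | sub | mul | div | mod | lt | eq

/-- Addition and multiplication are modulo `2 ^ w`; subtraction is truncated at `0`. -/
def BinOp.eval (w : ℕ) : BinOp → ℕ → ℕ → ℕ
  | .add, x, y => (x + y) % 2 ^ w
  | .sub, x, y => x - y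
  | .mul, x, y => (x * y) % 2 ^ w
  | .div, x, y => x / y
  | .mod, x, y => x % y
  | .lt, x, y => if x < y then 1 else 0
  | .eq, x, y => if x = y then 1 else 0

/-- Expressions that a processor can evaluate: constants, its own index, the content of a cell of
the array with name `a`, word operations, and comparisons of words with multiples of the
real input parameter. -/
inductive Expr where
  | const (k : ℕ)
  | pid
  | read (a : ℕ) (i : Expr)
  | op (o : BinOp) (x y : Expr)
  | leParam (x y : Expr)

/-- The number of operations needed to evaluate an expression. -/
def Expr.size : Expr → ℕ
  | .const _ => 1
  | .pid => 1
  | .read _ i => i.size + 1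
  | .op _ x y => x.size + y.size + 1
  | .leParam x y => x.size + y.size + 1

/-- The shared memory: `mem a i` is the content of cell `i` of array `a`. -/
abbrev Memory := ℕ → ℕ → ℕ

open Classical in
/-- The value of an expression for processor `p`, with `w`-bit words and real parameter `β`. The
expression `leParam x y` tests whether `x ≤ β * y`. -/
def Expr.eval (w : ℕ) (β : ℝ) (mem : Memory) (p : ℕ) : Expr → ℕ
  | .const k => k % 2 ^ w
  | .pid => p
  | .read a i => mem a (i.eval w β mem p)
  | .op o x y => o.eval w (x.eval w β mem p) (y.eval w β mem p)
  | .leParam x y => if (x.eval w β mem p : ℝ) ≤ β * (y.eval w β mem p : ℝ) then 1 else 0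

/-- Programs.
* `par width guard a addr val`: each processor `p < width` whose `guard` is nonzero writes `val`
  to cell `addr` of array `a`.
* `draw width guard a addr top`: the same, where the written value is a fresh random word, uniform on
  `{0, …, top}`; the draws of distinct processors are independent.
* `seq`, `ite`, `loop` (a while loop): sequential control flow. -/
inductive Cmd where
  | par (width guard : Expr) (a : ℕ) (addr val : Expr)
  | draw (width guard : Expr) (a : ℕ) (addr top : Expr)
  | seq (c₁ c₂ : Cmd)
  | ite (test : Expr) (c₁ c₂ : Cmd)
  | loop (test : Expr) (body : Cmd)

/-- A configuration: the commands still to be executed (none when the machine has halted), the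
shared memory, and the depth (parallel time) and the work (total number of operations) spent so
far. -/
structure Config where
  todo : List Cmd
  mem : Memory
  depth : ℕ
  work : ℕ

/-- A rule resolving concurrent writes (Arbitrary CRCW): out of the set of the processors that try to
write to cell `x`, it picks the one that succeeds, possibly depending on the whole configuration. -/
structure Resolver where
  pick : Config → ℕ → Finset ℕ → ℕ
  pick_mem : ∀ (c : Config) (x : ℕ) (S : Finset ℕ), S.Nonempty → pick c x S ∈ S

/-- The processors among `0, …, k - 1` that try to write to cell `x`. -/
def writers (k : ℕ) (guard addr : ℕ → ℕ) (x : ℕ) : Finset ℕ :=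
  (Finset.range k).filter fun p => guard p ≠ 0 ∧ addr p = x

/-- The memory after the simultaneous writes of the processors `0, …, k - 1` to array `a`. -/
def write (ρ : Resolver) (c : Config) (a k : ℕ) (guard addr val : ℕ → ℕ) : Memory := fun b x =>
  if b = a ∧ (writers k guard addr x).Nonempty then
    val (ρ.pick c x (writers k guard addr x))
  else c.mem b x

/-- One step of the machine, as a distribution on configurations. Evaluating an expression costs its
size, for each of the processors that evaluate it, plus the cost of the control. -/
def step (w : ℕ) (β : ℝ) (ρ : Resolver) (c : Config) : PMF Config :=
  match c.todo with
  | [] => PMF.pure c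
  | .par width guard a addr val :: K =>
      let k := width.eval w β c.mem 0
      let s := width.size + guard.size + addr.size + val.size
      PMF.pure
        { todo := K
          mem := write ρ c a k (guard.eval w β c.mem ·) (addr.eval w β c.mem ·)
            (val.eval w β c.mem ·)
          depth := c.depth + s
          work := c.work + s * (k + 1) }
  | .draw width guard a addr top :: K =>
      let k := width.eval w β c.mem 0
      let s := width.size + guard.size + addr.size + top.size
      (PMF.uniformOfFintype ((p : Fin k) → Fin (top.eval w β c.mem p + 1))).map fun r =>
        { todo := K
          mem := write ρ c a k (guard.eval w β c.mem ·) (addr.eval w β c.mem ·)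
            (fun p => if h : p < k then (r ⟨p, h⟩ : ℕ) else 0)
          depth := c.depth + s
          work := c.work + s * (k + 1) }
  | .seq c₁ c₂ :: K =>
      PMF.pure { todo := c₁ :: c₂ :: K, mem := c.mem, depth := c.depth + 1, work := c.work + 1 }
  | .ite test c₁ c₂ :: K =>
      PMF.pure
        { todo := if test.eval w β c.mem 0 ≠ 0 then c₁ :: K else c₂ :: K
          mem := c.mem
          depth := c.depth + test.size
          work := c.work + test.size }
  | .loop test body :: K =>
      PMF.pure
        { todo := if test.eval w β c.mem 0 ≠ 0 then body :: .loop test body :: K else K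
          mem := c.mem
          depth := c.depth + test.size
          work := c.work + test.size }

/-- The distribution of the configuration after `t` steps, starting from `c`. -/
def runFor (w : ℕ) (β : ℝ) (ρ : Resolver) : ℕ → Config → PMF Config
  | 0, c => PMF.pure c
  | t + 1, c => (step w β ρ c).bind (runFor w β ρ t)

/-- The expected total depth. The depth spent within `t` steps increases with `t`, and each step
of a machine that has not halted adds at least `1`; so this is `∞` unless the machine halts
with probability one. -/
def expectedDepth (w : ℕ) (β : ℝ) (ρ : Resolver) (c : Config) : ℝ≥0∞ :=
  ⨆ t : ℕ, ∑' c' : Config, runFor w β ρ t c c' * (c'.depth : ℝ≥0∞)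

/-- The expected total work. -/
def expectedWork (w : ℕ) (β : ℝ) (ρ : Resolver) (c : Config) : ℝ≥0∞ :=
  ⨆ t : ℕ, ∑' c' : Config, runFor w β ρ t c c' * (c'.work : ℝ≥0∞)

/-! ### Graphs as input, partitions as output -/

/-- `off` and `tgt` are an adjacency array of `G`: the entries of `tgt` at the positions
`off v, …, off (v + 1) - 1` list the neighbours of `v`, each once, in any order. -/
structure IsAdjacencyArray {n : ℕ} (G : SimpleGraph (Fin n)) (off tgt : ℕ → ℕ) : Prop where
  off_zero : off 0 = 0
  off_le : ∀ v : Fin n, off v ≤ off (v + 1)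
  adj_of_slot : ∀ (v : Fin n) (j : ℕ), off v ≤ j → j < off (v + 1) →
    ∃ u : Fin n, tgt j = u ∧ G.Adj v u
  slot_of_adj : ∀ v u : Fin n, G.Adj v u → ∃! j : ℕ, off v ≤ j ∧ j < off (v + 1) ∧ tgt j = u

/-- The start of `prog` on a graph with `n` vertices and `m` edges: array `0` holds `n` and `m`,
arrays `1` and `2` hold the adjacency array, and all other cells are `0`. -/
def initial (w : ℕ) (prog : Cmd) (n m : ℕ) (off tgt : ℕ → ℕ) : Config where
  todo := [prog]
  mem := fun a i =>
    (if a = 0 ∧ i = 0 then n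
      else if a = 0 ∧ i = 1 then m
      else if a = 1 ∧ i ≤ n then off i
      else if a = 2 ∧ i < off n then tgt i
      else 0) % 2 ^ w
  depth := 0
  work := 0

/-- The output: array `3` holds a label for every vertex, and the pieces are the sets of vertices
with the same label. -/
def output (n : ℕ) (c : Config) : Set (Set (Fin n)) :=
  (Setoid.ker fun v : Fin n => c.mem 3 v).classes

end PRAM

end

/-! Give every vertex `v` a random integer start time `st v` and put `T v = min (st x + dist x v)`
over all `x`; let `v` join the piece of some `x` that attains the minimum. A breadth-first search in
which vertices not yet reached start on their own at their start times computes this. Tracing a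
label back to its origin never leaves the piece (`IsGraphClustering.exists_walk`), so the radius of
a piece is at most the largest start time, which is below `L * K`.

A start time is read off a uniformly random word below `2 ^ L * K`. There are `L` blocks of `K`
consecutive times, and apart from the first two, which are equally likely, each block is twice as
likely as the one before it. Hence, for a time `a` outside block `0`, at most a fraction `3 / K` of
the words with start time at most `a` give one of `a - 2`, `a - 1`, `a` outside block `0`
(`card_startTime_near_le`). An edge at `v` can be cut only if the second arrival at `v` comes at
most two units after the first (`IsGraphClustering.isNearTie`). If all start times but that of `x`
are fixed, such a narrow win has at most `3 / K` times the probability of a win of `x`; since the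
events "`x` wins" are disjoint, no factor `n` is lost in the sum over `x` (`card_nearTie_le`). So,
on the event that no start time lies in block `0`, the expected fraction of cut slots is at most `3
/ K`.

`setup` chooses `K` with `8 ≤ β * K ≤ 16`, or caps it once it exceeds the number of edges by a
constant factor, and chooses `2 ^ L` between `16 * n` and `32 * n`. Markov's inequality bounds the
failure probability by `3 / 8`, and a start time in block `0` adds at most `1 / 8` (`card_bad_le`).
The program counts the cut slots and starts again if there are too many. So its output is always
valid, and the expected cost of the loop is at most twice that of one round of drawing and searching
(`mean_le_of_attempts`, `valid_of_attempts`).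

As `L = O(log n)` and `K = O(1 / β)`, the search has `O(log n / β)` rounds, each of depth `O(log n)`
through prefix sums (`scan_spec`). Its work is linear because a round costs no more than the drop of
the potential `remaining` (`SearchState.remaining_next`), and the vertices are put in the order of
their starts by a two-digit radix sort (`sortByStart_spec`). The resolution of concurrent writes may
influence labels, but the bad event is expressed by the start times alone, so the bounds hold
against every resolver. -/

namespace PRAM

/-! ### Expectations of natural-valued costs -/

section Mean

variable {α γ : Type*}

/-- The expectation of `f` under `μ`. -/
noncomputable def mean (μ : PMF α) (f : α → ℝ≥0∞) : ℝ≥0∞ := ∑' a, μ a * f a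

theorem mean_pure (a : α) (f : α → ℝ≥0∞) : mean (PMF.pure a) f = f a := by
  classical
  unfold mean
  rw [tsum_eq_single a]
  · simp
  · intro b hb
    simp [PMF.pure_apply, hb]

theorem mean_bind (μ : PMF α) (ν : α → PMF γ) (f : γ → ℝ≥0∞) :
    mean (μ.bind ν) f = mean μ fun a => mean (ν a) f := by
  unfold mean
  simp_rw [PMF.bind_apply, ← ENNReal.tsum_mul_right, ← ENNReal.tsum_mul_left]
  rw [ENNReal.tsum_comm]
  simp_rw [mul_assoc]

theorem mean_map (μ : PMF α) (g : α → γ) (f : γ → ℝ≥0∞) :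
    mean (μ.map g) f = mean μ fun a => f (g a) := by
  rw [← PMF.bind_pure_comp, mean_bind]
  simp [mean_pure]

theorem mean_mono (μ : PMF α) {f g : α → ℝ≥0∞} (h : ∀ a ∈ μ.support, f a ≤ g a) :
    mean μ f ≤ mean μ g := by
  refine ENNReal.tsum_le_tsum fun a => ?_
  by_cases ha : μ a = 0
  · simp [ha]
  · gcongr
    exact h a ha

theorem mean_const (μ : PMF α) (x : ℝ≥0∞) : mean μ (fun _ => x) = x := by
  unfold mean
  rw [ENNReal.tsum_mul_right, μ.tsum_coe, one_mul]

theorem mean_uniform [Fintype α] [Nonempty α] (f : α → ℝ≥0∞) :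
    mean (PMF.uniformOfFintype α) f = (Fintype.card α : ℝ≥0∞)⁻¹ * ∑ a, f a := by
  unfold mean
  simp [tsum_fintype, Finset.mul_sum]

end Mean

/-! ### Runs of the machine -/

section Runs

variable {w : ℕ} {β : ℝ} {ρ : Resolver}

theorem runFor_add (s t : ℕ) (c : Config) :
    runFor w β ρ (s + t) c = (runFor w β ρ s c).bind (runFor w β ρ t) := by
  induction s generalizing c with
  | zero => simp [runFor]
  | succ s ih =>
    rw [show s + 1 + t = (s + t) + 1 by ring, runFor, runFor, PMF.bind_bind]
    congr 1
    funext c'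
    exact ih c'

theorem runFor_halted {c : Config} (h : c.todo = []) (t : ℕ) :
    runFor w β ρ t c = PMF.pure c := by
  induction t with
  | zero => rfl
  | succ t ih => simp [runFor, step, h, ih]

/-- The machine passes from `c` to `c'` without using randomness. -/
def Reaches (w : ℕ) (β : ℝ) (ρ : Resolver) (c c' : Config) : Prop :=
  ∃ t, runFor w β ρ t c = PMF.pure c'

theorem Reaches.trans {a b c : Config} (h : Reaches w β ρ a b) (h' : Reaches w β ρ b c) :
    Reaches w β ρ a c := by
  obtain ⟨s, hs⟩ := h
  obtain ⟨t, ht⟩ := h'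
  exact ⟨s + t, by rw [runFor_add, hs, PMF.pure_bind, ht]⟩

theorem Reaches.of_step {c c' : Config} (h : step w β ρ c = PMF.pure c') :
    Reaches w β ρ c c' := ⟨1, by simp [runFor, h]⟩

theorem depth_le_of_step {c c' : Config} (h : c' ∈ (step w β ρ c).support) :
    c.depth ≤ c'.depth := by
  unfold step at h
  split at h <;> simp at h
  · rw [h]
  · rw [h]; simp
  · obtain ⟨r, rfl⟩ := h; simp
  · rw [h]; simp
  · rw [h]; simp
  · rw [h]; simp

theorem work_le_of_step {c c' : Config} (h : c' ∈ (step w β ρ c).support) :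
    c.work ≤ c'.work := by
  unfold step at h
  split at h <;> simp at h
  · rw [h]
  · rw [h]; simp
  · obtain ⟨r, rfl⟩ := h; simp
  · rw [h]; simp
  · rw [h]; simp
  · rw [h]; simp

/-- A cost that never decreases along a run. -/
def IsCost (w : ℕ) (β : ℝ) (ρ : Resolver) (f : Config → ℕ) : Prop :=
  ∀ c, ∀ c' ∈ (step w β ρ c).support, f c ≤ f c'

theorem IsCost.le_run {f : Config → ℕ} (hf : IsCost w β ρ f) (t : ℕ) {c c' : Config}
    (h : c' ∈ (runFor w β ρ t c).support) : f c ≤ f c' := by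
  induction t generalizing c with
  | zero => simp [runFor] at h; rw [h]
  | succ t ih =>
    simp only [runFor, PMF.mem_support_bind_iff] at h
    obtain ⟨a, ha, h⟩ := h
    exact (hf c a ha).trans (ih h)

/-- Running longer can only raise the mean, so a bound at a convenient later time covers all earlier
times. -/
theorem IsCost.mean_mono_time {f : Config → ℕ} (hf : IsCost w β ρ f) {s t : ℕ} (hst : s ≤ t)
    (c : Config) :
    mean (runFor w β ρ s c) (fun c' => (f c' : ℝ≥0∞)) ≤
      mean (runFor w β ρ t c) (fun c' => (f c' : ℝ≥0∞)) := by
  obtain ⟨u, rfl⟩ := Nat.exists_eq_add_of_le hst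
  rw [runFor_add, mean_bind]
  refine mean_mono _ fun a _ => ?_
  calc (f a : ℝ≥0∞) = mean (runFor w β ρ u a) (fun _ => (f a : ℝ≥0∞)) := (mean_const _ _).symm
    _ ≤ _ := mean_mono _ fun b hb => by exact_mod_cast hf.le_run u hb

/-- A deterministic stretch of `s` steps can be skipped: extend the run from `t` to `t + s` steps
and spend the first `s` of them on reaching `c'`. -/
theorem IsCost.mean_le_of_reaches {f : Config → ℕ} (hf : IsCost w β ρ f) {c c' : Config}
    (h : Reaches w β ρ c c') (t : ℕ) :
    mean (runFor w β ρ t c) (fun c' => (f c' : ℝ≥0∞)) ≤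
      mean (runFor w β ρ t c') (fun c' => (f c' : ℝ≥0∞)) := by
  obtain ⟨s, hs⟩ := h
  refine (hf.mean_mono_time (Nat.le_add_left t s) c).trans ?_
  rw [runFor_add, hs, PMF.pure_bind]

/-- If `c` reaches `c'`, every halted configuration seen from `c` is also seen from `c'`. -/
theorem Reaches.mem_support {c c' d : Config} (h : Reaches w β ρ c c') {t : ℕ}
    (hd : d ∈ (runFor w β ρ t c).support) (hd' : d.todo = []) :
    d ∈ (runFor w β ρ t c').support := by
  obtain ⟨s, hs⟩ := h
  have h1 : d ∈ (runFor w β ρ (t + s) c).support := by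
    rw [runFor_add, PMF.mem_support_bind_iff]
    exact ⟨d, hd, by simp [runFor_halted hd']⟩
  rwa [add_comm, runFor_add, hs, PMF.pure_bind] at h1

/-- One attempt of a randomized loop: from `c`, a uniformly random outcome `r` is drawn and the
machine passes to `Y r`; this costs at most `D`, and with probability at least one half the
machine has then halted. -/
def IsAttempt (w : ℕ) (β : ℝ) (ρ : Resolver) (f : Config → ℕ) (Head Valid : Config → Prop)
    (D : ℕ) (c : Config) : Prop :=
  ∃ (Ω : Type) (_ : Fintype Ω) (_ : Nonempty Ω) (s : ℕ) (X Y : Ω → Config) (bad : Finset Ω),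
    runFor w β ρ (s + 1) c = (PMF.uniformOfFintype Ω).map X ∧
    (∀ r, Reaches w β ρ (X r) (Y r)) ∧ (∀ r, f (Y r) ≤ f c + D) ∧
    (∀ r, r ∈ bad ∧ Head (Y r) ∨ (Y r).todo = [] ∧ Valid (Y r)) ∧
    2 * bad.card ≤ Fintype.card Ω

/-- The recursion `E ≤ D + E / 2` has the solution `2 * D`. The induction is on the time horizon: `t
+ 1` is enlarged to `(s + 1) + t`, so that after the draw the horizon `t` remains and the induction
hypothesis applies to the failed outcomes. -/
theorem mean_le_of_attempts {f : Config → ℕ} (hf : IsCost w β ρ f) {Head Valid : Config → Prop}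
    {D : ℕ} (h : ∀ c, Head c → IsAttempt w β ρ f Head Valid D c) (t : ℕ) {c : Config}
    (hc : Head c) :
    mean (runFor w β ρ t c) (fun c' => (f c' : ℝ≥0∞)) ≤ ((f c + 2 * D : ℕ) : ℝ≥0∞) := by
  classical
  induction t generalizing c with
  | zero => simp only [runFor, mean_pure]; exact_mod_cast Nat.le_add_right _ _
  | succ t ih =>
    obtain ⟨Ω, _, _, s, X, Y, bad, hX, hXY, hYD, hY, hbad⟩ := h c hc
    have h1 : mean (runFor w β ρ (t + 1) c) (fun c' => (f c' : ℝ≥0∞)) ≤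
        mean (runFor w β ρ ((s + 1) + t) c) (fun c' => (f c' : ℝ≥0∞)) :=
      hf.mean_mono_time (by omega) c
    refine h1.trans ?_
    rw [runFor_add, hX, mean_bind, mean_map, mean_uniform]
    have h2 : ∀ r, mean (runFor w β ρ t (X r)) (fun c' => (f c' : ℝ≥0∞)) ≤
        ((f c + D + if r ∈ bad then 2 * D else 0 : ℕ) : ℝ≥0∞) := by
      intro r
      refine (hf.mean_le_of_reaches (hXY r) t).trans ?_
      rcases hY r with ⟨hr, hh⟩ | ⟨hh, -⟩
      · refine (ih hh).trans ?_
        rw [if_pos hr]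
        have := hYD r
        exact_mod_cast (by omega : f (Y r) + 2 * D ≤ f c + D + 2 * D)
      · rw [runFor_halted hh, mean_pure]
        have := hYD r
        exact_mod_cast (by omega : f (Y r) ≤ f c + D + if r ∈ bad then 2 * D else 0)
    have h3 : ∑ r, mean (runFor w β ρ t (X r)) (fun c' => (f c' : ℝ≥0∞)) ≤
        (Fintype.card Ω : ℝ≥0∞) * ((f c + 2 * D : ℕ) : ℝ≥0∞) := by
      refine (Finset.sum_le_sum fun r _ => h2 r).trans ?_
      rw [← Nat.cast_sum, ← Nat.cast_mul]
      have : ∑ r, (f c + D + if r ∈ bad then 2 * D else 0) ≤ Fintype.card Ω * (f c + 2 * D) := by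
        rw [Finset.sum_add_distrib, Finset.sum_ite_mem]
        simp only [Finset.sum_const, Finset.univ_inter, smul_eq_mul, Finset.card_univ]
        nlinarith [Nat.mul_le_mul_right D hbad]
      exact_mod_cast this
    calc _ ≤ (Fintype.card Ω : ℝ≥0∞)⁻¹ *
        ((Fintype.card Ω : ℝ≥0∞) * ((f c + 2 * D : ℕ) : ℝ≥0∞)) := by gcongr
      _ = _ := by
        rw [← mul_assoc, ENNReal.inv_mul_cancel (by simp) (by simp), one_mul]

/-- A halted configuration does not change, so the horizon can be padded to `(s + 1) + (t - 1)`.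
Each failure then consumes at least one unit of `t`, and a strong induction reaches the successful
outcome. -/
theorem valid_of_attempts {f : Config → ℕ} {Head Valid : Config → Prop}
    {D : ℕ} (h : ∀ c, Head c → IsAttempt w β ρ f Head Valid D c)
    (hHead : ∀ c, Head c → c.todo ≠ []) (t : ℕ) {c : Config}
    (hc : Head c) {d : Config} (hd : d ∈ (runFor w β ρ t c).support) (hd' : d.todo = []) :
    Valid d := by
  induction t using Nat.strong_induction_on generalizing c with
  | _ t ih =>
    obtain ⟨Ω, _, _, s, X, Y, bad, hX, hXY, hYD, hY, hbad⟩ := h c hc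
    have h0 : 0 < t := by
      rcases Nat.eq_zero_or_pos t with rfl | ht
      · simp [runFor] at hd
        exact absurd (hd ▸ hd') (hHead c hc)
      · exact ht
    have h1 : d ∈ (runFor w β ρ ((s + 1) + (t - 1)) c).support := by
      rw [show (s + 1) + (t - 1) = t + s by omega, runFor_add, PMF.mem_support_bind_iff]
      exact ⟨d, hd, by simp [runFor_halted hd']⟩
    rw [runFor_add, hX, PMF.mem_support_bind_iff] at h1
    obtain ⟨a, ha, h1⟩ := h1
    simp only [PMF.support_map, Set.mem_image] at ha
    obtain ⟨r, -, rfl⟩ := ha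
    have h2 := (hXY r).mem_support h1 hd'
    rcases hY r with ⟨-, hh⟩ | ⟨hh, hv⟩
    · exact ih (t - 1) (by omega) hh h2
    · rw [runFor_halted hh] at h2
      simp at h2
      rwa [h2]

end Runs

/-! ### A program logic for deterministic commands -/

section Logic

variable {w : ℕ} {β : ℝ} {ρ : Resolver}

/-- `cmd`, started on the memory `M`, terminates without drawing, and its final memory, its depth and
its work satisfy `Q`. -/
def Ensures (w : ℕ) (β : ℝ) (ρ : Resolver) (cmd : Cmd) (M : Memory)
    (Q : Memory → ℕ → ℕ → Prop) : Prop :=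
  ∀ (c : Config) (K : List Cmd), c.todo = cmd :: K → c.mem = M →
    ∃ c' d k, Reaches w β ρ c c' ∧ c'.todo = K ∧ c'.depth = c.depth + d ∧
      c'.work = c.work + k ∧ Q c'.mem d k

theorem Ensures.mono {cmd : Cmd} {M : Memory} {Q Q' : Memory → ℕ → ℕ → Prop}
    (h : Ensures w β ρ cmd M Q) (hQ : ∀ M' d k, Q M' d k → Q' M' d k) :
    Ensures w β ρ cmd M Q' := by
  intro c K hc hM
  obtain ⟨c', d, k, h1, h2, h3, h4, h5⟩ := h c K hc hM
  exact ⟨c', d, k, h1, h2, h3, h4, hQ _ _ _ h5⟩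

theorem Ensures.seq {c₁ c₂ : Cmd} {M : Memory} {Q : Memory → ℕ → ℕ → Prop}
    (h : Ensures w β ρ c₁ M fun M₁ d₁ k₁ => Ensures w β ρ c₂ M₁ fun M₂ d₂ k₂ =>
      Q M₂ (d₁ + d₂ + 1) (k₁ + k₂ + 1)) :
    Ensures w β ρ (.seq c₁ c₂) M Q := by
  intro c K hc hM
  have h0 : Reaches w β ρ c
      { todo := c₁ :: c₂ :: K, mem := c.mem, depth := c.depth + 1, work := c.work + 1 } :=
    Reaches.of_step (by simp [step, hc])
  obtain ⟨c', d, k, h1, h2, h3, h4, h5⟩ := h (.mk _ _ _ _) (c₂ :: K) rfl hM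
  obtain ⟨c'', d', k', h1', h2', h3', h4', h5'⟩ := h5 c' K h2 rfl
  refine ⟨c'', _, _, h0.trans (h1.trans h1'), h2', ?_, ?_, h5'⟩
  · rw [h3', h3]; simp only; ring
  · rw [h4', h4]; simp only; ring

theorem Ensures.ite {test : Expr} {c₁ c₂ : Cmd} {M : Memory} {Q : Memory → ℕ → ℕ → Prop}
    (h₁ : test.eval w β M 0 ≠ 0 → Ensures w β ρ c₁ M fun M' d k =>
      Q M' (d + test.size) (k + test.size))
    (h₂ : test.eval w β M 0 = 0 → Ensures w β ρ c₂ M fun M' d k =>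
      Q M' (d + test.size) (k + test.size)) :
    Ensures w β ρ (.ite test c₁ c₂) M Q := by
  intro c K hc hM
  by_cases ht : test.eval w β M 0 = 0
  · have h0 : Reaches w β ρ c
        { todo := c₂ :: K, mem := c.mem, depth := c.depth + test.size,
          work := c.work + test.size } :=
      Reaches.of_step (by simp [step, hc, hM, ht])
    obtain ⟨c', d, k, h1, h2, h3, h4, h5⟩ := h₂ ht (.mk _ _ _ _) K rfl hM
    exact ⟨c', _, _, h0.trans h1, h2, by rw [h3]; simp only; ring, by rw [h4]; simp only; ring, h5⟩
  · have h0 : Reaches w β ρ c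
        { todo := c₁ :: K, mem := c.mem, depth := c.depth + test.size,
          work := c.work + test.size } :=
      Reaches.of_step (by simp [step, hc, hM, ht])
    obtain ⟨c', d, k, h1, h2, h3, h4, h5⟩ := h₁ ht (.mk _ _ _ _) K rfl hM
    exact ⟨c', _, _, h0.trans h1, h2, by rw [h3]; simp only; ring, by rw [h4]; simp only; ring, h5⟩

/-- The rule for loops: `I` is an invariant with a ghost parameter, and the potentials `Φd` and `Φw`
pay for the depth and the work. -/
theorem Ensures.loop {σ : Type*} {test : Expr} {body : Cmd} (I : σ → Memory → Prop)
    (Φd Φw : σ → ℕ)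
    (hbody : ∀ a M, I a M → test.eval w β M 0 ≠ 0 → Ensures w β ρ body M fun M' d k =>
      ∃ a', I a' M' ∧ d + test.size + Φd a' ≤ Φd a ∧ k + test.size + Φw a' ≤ Φw a)
    {a : σ} {M : Memory} (hI : I a M) :
    Ensures w β ρ (.loop test body) M fun M' d k =>
      ∃ a', I a' M' ∧ test.eval w β M' 0 = 0 ∧ d ≤ Φd a + test.size ∧ k ≤ Φw a + test.size := by
  -- Every test costs at least one unit, so `hbody` makes `Φd` strictly decrease; this is what
  -- proves termination.
  have hsize : 0 < test.size := by cases test <;> simp [Expr.size]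
  intro c K hc hM
  induction hn : Φd a using Nat.strong_induction_on generalizing a M c with
  | _ n ih =>
    by_cases ht : test.eval w β M 0 = 0
    · have h0 : Reaches w β ρ c
          { todo := K, mem := c.mem, depth := c.depth + test.size,
            work := c.work + test.size } :=
        Reaches.of_step (by simp [step, hc, hM, ht])
      exact ⟨_, _, _, h0, rfl, rfl, rfl, a, by simpa [hM] using hI, by simpa [hM] using ht,
        by omega, by omega⟩
    · have h0 : Reaches w β ρ c
          { todo := body :: .loop test body :: K, mem := c.mem, depth := c.depth + test.size,
            work := c.work + test.size } :=
        Reaches.of_step (by simp [step, hc, hM, ht])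
      obtain ⟨c', d, k, h1, h2, h3, h4, a', h5, h6, h7⟩ :=
        hbody a M hI ht (.mk _ _ _ _) (.loop test body :: K) rfl hM
      obtain ⟨c'', d', k', h1', h2', h3', h4', a'', h5', h6', h7', h8'⟩ :=
        ih (Φd a') (by omega) h5 c' h2 rfl rfl
      refine ⟨c'', d + d' + test.size, k + k' + test.size, h0.trans (h1.trans h1'), h2', ?_, ?_,
        a'', h5', h6', ?_, ?_⟩
      · rw [h3', h3]; simp only; ring
      · rw [h4', h4]; simp only; ring
      · omega
      · omega

/-- The rule for a parallel write, in full generality. -/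
theorem Ensures.par {width guard addr val : Expr} {a : ℕ} {M : Memory}
    {Q : Memory → ℕ → ℕ → Prop} (k : ℕ) (hk : width.eval w β M 0 = k)
    (act : ℕ → Prop) (hact : ∀ p < k, guard.eval w β M p ≠ 0 ↔ act p)
    (A V : ℕ → ℕ) (hA : ∀ p < k, act p → addr.eval w β M p = A p)
    (hV : ∀ p < k, act p → val.eval w β M p = V p)
    (h : ∀ g : ℕ → ℕ,
      (∀ x, (∀ p < k, act p → A p ≠ x) → g x = M a x) →
      (∀ p < k, act p → ∃ q < k, act q ∧ A q = A p ∧ g (A p) = V q) →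
      Q (Function.update M a g) (width.size + guard.size + addr.size + val.size)
        ((width.size + guard.size + addr.size + val.size) * (k + 1))) :
    Ensures w β ρ (.par width guard a addr val) M Q := by
  intro c K hc hM
  subst hM
  set g : ℕ → ℕ := write ρ c a k (guard.eval w β c.mem ·) (addr.eval w β c.mem ·)
    (val.eval w β c.mem ·) a with hg
  have hmem : write ρ c a k (guard.eval w β c.mem ·) (addr.eval w β c.mem ·)
      (val.eval w β c.mem ·) = Function.update c.mem a g := by
    funext b
    by_cases hb : b = a
    · subst hb; simp [hg]
    · funext x; simp [write, hb]
  have h0 : Reaches w β ρ c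
      { todo := K, mem := Function.update c.mem a g,
        depth := c.depth + (width.size + guard.size + addr.size + val.size),
        work := c.work + (width.size + guard.size + addr.size + val.size) * (k + 1) } :=
    Reaches.of_step (by simp only [step, hc, hk, hmem])
  refine ⟨_, _, _, h0, rfl, rfl, rfl, h g ?_ ?_⟩
  · intro x hx
    have : writers k (guard.eval w β c.mem ·) (addr.eval w β c.mem ·) x = ∅ := by
      refine Finset.filter_eq_empty_iff.2 fun p hp h => ?_
      have hp := Finset.mem_range.1 hp
      have ha := (hact p hp).1 h.1
      exact hx p hp ha ((hA p hp ha).symm.trans h.2)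
    simp [hg, write, this]
  · intro p hp ha
    have hne : (writers k (guard.eval w β c.mem ·) (addr.eval w β c.mem ·) (A p)).Nonempty :=
      ⟨p, Finset.mem_filter.2 ⟨Finset.mem_range.2 hp, (hact p hp).2 ha, hA p hp ha⟩⟩
    -- The only property of the resolver that is used: its choice is one of the writers.
    have hq := ρ.pick_mem c (A p) _ hne
    set q := ρ.pick c (A p) (writers k (guard.eval w β c.mem ·) (addr.eval w β c.mem ·) (A p))
      with hqdef
    obtain ⟨hq1, hq2, hq3⟩ := Finset.mem_filter.1 hq
    have hq1 := Finset.mem_range.1 hq1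
    have hqa := (hact q hq1).1 hq2
    refine ⟨q, hq1, hqa, (hA q hq1 hqa).symm.trans hq3, ?_⟩
    have : g (A p) = val.eval w β c.mem q := by
      simp only [hg, write, hne, and_self, if_true, hqdef]
    rw [this, hV q hq1 hqa]

/-- Parallel writes to distinct cells. -/
theorem Ensures.par_inj {width guard addr val : Expr} {a : ℕ} {M : Memory}
    {Q : Memory → ℕ → ℕ → Prop} (k : ℕ) (hk : width.eval w β M 0 = k)
    (act : ℕ → Prop) (hact : ∀ p < k, guard.eval w β M p ≠ 0 ↔ act p)
    (A V : ℕ → ℕ) (hA : ∀ p < k, act p → addr.eval w β M p = A p)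
    (hV : ∀ p < k, act p → val.eval w β M p = V p)
    (hinj : ∀ p < k, act p → ∀ q < k, act q → A p = A q → p = q)
    (h : ∀ g : ℕ → ℕ,
      (∀ x, (∀ p < k, act p → A p ≠ x) → g x = M a x) →
      (∀ p < k, act p → g (A p) = V p) →
      Q (Function.update M a g) (width.size + guard.size + addr.size + val.size)
        ((width.size + guard.size + addr.size + val.size) * (k + 1))) :
    Ensures w β ρ (.par width guard a addr val) M Q := by
  refine Ensures.par k hk act hact A V hA hV fun g h1 h2 => h g h1 fun p hp ha => ?_
  obtain ⟨q, hq, hqa, he, hg⟩ := h2 p hp ha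
  rw [hg, hinj q hq hqa p hp ha he]

/-- Constants are truncated to `w` bits; the threshold `2 ^ 20` is far above every constant that
occurs in the program. -/
theorem Expr.eval_const {M : Memory} {p : ℕ} (hw : 20 ≤ w) {k : ℕ} (hk : k < 2 ^ 20) :
    (Expr.const k).eval w β M p = k :=
  Nat.mod_eq_of_lt (hk.trans_le (Nat.pow_le_pow_right (by norm_num) hw))

/-- Processor `p < k` writes to cell `p`. -/
theorem Ensures.par_pid (hw : 20 ≤ w) {width val : Expr} {a : ℕ} {M : Memory}
    {Q : Memory → ℕ → ℕ → Prop} (k : ℕ) (hk : width.eval w β M 0 = k)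
    (V : ℕ → ℕ) (hV : ∀ p < k, val.eval w β M p = V p)
    (h : Q (Function.update M a fun x => if x < k then V x else M a x)
        (width.size + val.size + 2) ((width.size + val.size + 2) * (k + 1))) :
    Ensures w β ρ (.par width (.const 1) a .pid val) M Q := by
  refine Ensures.par_inj k hk (fun _ => True) (fun p _ => ?_) id V (fun _ _ _ => rfl)
    (fun p hp _ => hV p hp) (fun _ _ _ _ _ _ h => h) fun g h1 h2 => ?_
  · simp [Expr.eval_const hw]
  · have : g = fun x => if x < k then V x else M a x := by
      funext x
      split_ifs with hx
      · exact h2 x hx trivial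
      · exact h1 x fun p hp _ he => hx (by simpa [← he] using hp)
    subst this
    convert h using 1
    · simp only [Expr.size]; ring
    · simp only [Expr.size]; ring

/-- A single processor writes to one cell. -/
theorem Ensures.par_one (hw : 20 ≤ w) {addr val : Expr} {a : ℕ} {M : Memory}
    {Q : Memory → ℕ → ℕ → Prop} (i v : ℕ) (hi : addr.eval w β M 0 = i)
    (hv : val.eval w β M 0 = v)
    (h : Q (Function.update M a (Function.update (M a) i v))
        (addr.size + val.size + 2) (2 * (addr.size + val.size + 2))) :
    Ensures w β ρ (.par (.const 1) (.const 1) a addr val) M Q := by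
  refine Ensures.par_inj 1 (Expr.eval_const hw (by norm_num)) (fun _ => True) (fun p _ => ?_)
    (fun _ => i) (fun _ => v) (fun p hp _ => ?_) (fun p hp _ => ?_) (fun p hp _ q hq _ _ => ?_)
    fun g h1 h2 => ?_
  · simp [Expr.eval_const hw]
  · rwa [Nat.lt_one_iff.1 hp]
  · rwa [Nat.lt_one_iff.1 hp]
  · omega
  · have : g = Function.update (M a) i v := by
      funext x
      by_cases hx : x = i
      · subst hx; simpa using h2 0 one_pos trivial
      · rw [Function.update_of_ne hx]
        exact h1 x fun _ _ _ he => hx he.symm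
    subst this
    convert h using 1
    · simp only [Expr.size]; ring
    · simp only [Expr.size]; ring

end Logic

/-! ### Notation for programs -/

instance : Add Expr := ⟨.op .add⟩
instance : Sub Expr := ⟨.op .sub⟩
instance : Mul Expr := ⟨.op .mul⟩
instance : Div Expr := ⟨.op .div⟩
instance : Mod Expr := ⟨.op .mod⟩

namespace Expr

/-- The scalar variable stored in cell `0` of array `a`. -/
def var (a : ℕ) : Expr := .read a (.const 0)

/-- The comparison `x < y`. -/
def lt (x y : Expr) : Expr := .op .lt x y

/-- The comparison `x = y`. -/
def eq (x y : Expr) : Expr := .op .eq x y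

section

variable {w : ℕ} {β : ℝ} {M : Memory} {p : ℕ} {x y : Expr}

@[simp] theorem eval_pid : pid.eval w β M p = p := rfl

@[simp] theorem eval_read {a : ℕ} : (read a x).eval w β M p = M a (x.eval w β M p) := rfl

@[simp] theorem eval_var {a : ℕ} : (var a).eval w β M p = M a 0 := by
  simp [var, Expr.eval]

@[simp] theorem eval_add : (x + y).eval w β M p = (x.eval w β M p + y.eval w β M p) % 2 ^ w := rfl

@[simp] theorem eval_mul : (x * y).eval w β M p = (x.eval w β M p * y.eval w β M p) % 2 ^ w := rfl

@[simp] theorem eval_sub : (x - y).eval w β M p = x.eval w β M p - y.eval w β M p := rfl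

@[simp] theorem eval_div : (x / y).eval w β M p = x.eval w β M p / y.eval w β M p := rfl

@[simp] theorem eval_mod : (x % y).eval w β M p = x.eval w β M p % y.eval w β M p := rfl

@[simp] theorem eval_lt : (lt x y).eval w β M p =
    if x.eval w β M p < y.eval w β M p then 1 else 0 := rfl

@[simp] theorem eval_eq : (eq x y).eval w β M p =
    if x.eval w β M p = y.eval w β M p then 1 else 0 := rfl

end

section

variable {x y : Expr}

@[simp] theorem size_var {a : ℕ} : (var a).size = 2 := rfl

@[simp] theorem size_const {k : ℕ} : (const k).size = 1 := rfl

@[simp] theorem size_pid : pid.size = 1 := rfl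

@[simp] theorem size_read {a : ℕ} : (read a x).size = x.size + 1 := rfl

@[simp] theorem size_add : (x + y).size = x.size + y.size + 1 := rfl

@[simp] theorem size_sub : (x - y).size = x.size + y.size + 1 := rfl

@[simp] theorem size_mul : (x * y).size = x.size + y.size + 1 := rfl

@[simp] theorem size_div : (x / y).size = x.size + y.size + 1 := rfl

@[simp] theorem size_mod : (x % y).size = x.size + y.size + 1 := rfl

@[simp] theorem size_lt : (lt x y).size = x.size + y.size + 1 := rfl

@[simp] theorem size_eq : (eq x y).size = x.size + y.size + 1 := rfl

@[simp] theorem size_leParam : (leParam x y).size = x.size + y.size + 1 := rfl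

end

end Expr

end PRAM

/-! ### Parallel prefix sums -/

namespace PRAM

notation:60 a:61 ";;" b:60 => Cmd.seq a b
notation "arrIn" => (10 : ℕ)
notation "arrLen" => (11 : ℕ)
notation "arrTree" => (12 : ℕ)
notation "arrDown" => (13 : ℕ)
notation "arrPow" => (14 : ℕ)
notation "arrTot" => (15 : ℕ)
notation "arrPre" => (16 : ℕ)

/-- Assignment to the scalar variable `a`. -/
def Cmd.assign (a : ℕ) (v : Expr) : Cmd := .par (.const 1) (.const 1) a (.const 0) v

/-- Processors `0, …, k - 1` write the values `v` to the corresponding cells of `a`. -/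
def Cmd.fill (k : Expr) (a : ℕ) (v : Expr) : Cmd := .par k (.const 1) a .pid v

section

variable {w : ℕ} {β : ℝ} {ρ : Resolver}

theorem Ensures.assign_exact (hw : 20 ≤ w) {val : Expr} {a : ℕ} {M : Memory}
    {Q : Memory → ℕ → ℕ → Prop} (v : ℕ) (hv : val.eval w β M 0 = v)
    (h : Q (Function.update M a (Function.update (M a) 0 v))
        (val.size + 3) (2 * (val.size + 3))) :
    Ensures w β ρ (.assign a val) M Q := by
  refine Ensures.par_one hw 0 v (Expr.eval_const hw (by norm_num)) hv ?_
  convert h using 1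
  · simp; ring
  · simp; ring

theorem Ensures.fill_exact (hw : 20 ≤ w) {width val : Expr} {a : ℕ} {M : Memory}
    {Q : Memory → ℕ → ℕ → Prop} (k : ℕ) (hk : width.eval w β M 0 = k)
    (V : ℕ → ℕ) (hV : ∀ p < k, val.eval w β M p = V p)
    (h : Q (Function.update M a fun x => if x < k then V x else M a x)
        (width.size + val.size + 2) ((width.size + val.size + 2) * (k + 1))) :
    Ensures w β ρ (.fill width a val) M Q :=
  Ensures.par_pid hw k hk V hV h

theorem Ensures.assign (hw : 20 ≤ w) {val : Expr} {a : ℕ} {M : Memory}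
    {Q : Memory → ℕ → ℕ → Prop} (v : ℕ) (hv : val.eval w β M 0 = v)
    (h : ∀ g : ℕ → ℕ, g 0 = v → Q (Function.update M a g) (val.size + 3) (2 * (val.size + 3))) :
    Ensures w β ρ (.assign a val) M Q :=
  .assign_exact hw v hv (h _ (by simp))

theorem Ensures.fill (hw : 20 ≤ w) {width val : Expr} {a : ℕ} {M : Memory}
    {Q : Memory → ℕ → ℕ → Prop} (k : ℕ) (hk : width.eval w β M 0 = k)
    (V : ℕ → ℕ) (hV : ∀ p < k, val.eval w β M p = V p)
    (h : ∀ g : ℕ → ℕ, (∀ p < k, g p = V p) → Q (Function.update M a g)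
      (width.size + val.size + 2) ((width.size + val.size + 2) * (k + 1))) :
    Ensures w β ρ (.fill width a val) M Q :=
  .fill_exact hw k hk V hV (h _ fun p hp => by simp [hp])

open PRAM.Expr in
/-- Exclusive prefix sums of the first `arrLen` cells of `arrIn`: they are written to `arrPre`, and
the total to `arrTot`. -/
def scan : Cmd :=
  .assign arrPow (const 1) ;;
  .loop (lt (var arrPow) (var arrLen)) (.assign arrPow (var arrPow + var arrPow)) ;;
  .par (var arrPow) (const 1) arrTree (var arrPow + pid)
    (read arrIn pid * lt pid (var arrLen)) ;;
  .loop (lt (const 1) (var arrPow))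
    (.assign arrPow (var arrPow / const 2) ;;
     .par (var arrPow) (const 1) arrTree (var arrPow + pid)
      (read arrTree ((var arrPow + pid) + (var arrPow + pid)) +
        read arrTree (((var arrPow + pid) + (var arrPow + pid)) + const 1))) ;;
  .assign arrTot (read arrTree (const 1)) ;;
  .par (const 1) (const 1) arrDown (const 1) (const 0) ;;
  .loop (lt (var arrPow) (var arrLen))
    (.assign arrPow (var arrPow + var arrPow) ;;
     .par (var arrPow) (const 1) arrDown (var arrPow + pid)
      (read arrDown ((var arrPow + pid) / const 2) +
        (pid % const 2) * read arrTree ((var arrPow + pid) - const 1))) ;;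
  .fill (var arrLen) arrPre (read arrDown (var arrPow + pid))

/-- A complete binary tree whose number of leaves is the least power of two not below `len`, with
node `x` of level `i` in cell `2 ^ i + x`. The upward sweep stores the sums over subtrees, the
downward sweep the sums of everything to the left of a node. Level sizes are geometric, which gives
logarithmic depth and linear work. -/
theorem scan_spec (hw : 20 ≤ w) {M : Memory} {len : ℕ} (hlen : M arrLen 0 = len)
    (hlen' : 8 * len + 8 ≤ 2 ^ w) (hsum : ∑ x ∈ Finset.range len, M arrIn x < 2 ^ w)
    {H : ℕ} (hH : len ≤ 2 ^ H) :
    Ensures w β ρ scan M fun M' d k =>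
      (∀ b, b ∉ [arrTree, arrDown, arrPow, arrTot, arrPre] → M' b = M b) ∧
      (∀ x < len, M' arrPre x = ∑ y ∈ Finset.range x, M arrIn y) ∧
      M' arrTot 0 = ∑ y ∈ Finset.range len, M arrIn y ∧
      d ≤ 200 * (H + 1) ∧ k ≤ 1000 * (len + 1) := by
  -- Padding with zeros beyond `len` gives a meaning to the prefix sums at all block ends of the
  -- tree.
  set pre : ℕ → ℕ := fun x => ∑ y ∈ Finset.range x, if y < len then M arrIn y else 0 with hpre
  have pre_mono : Monotone pre := fun a b hab =>
    Finset.sum_le_sum_of_subset (Finset.range_mono hab)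
  have pre_eq : ∀ x ≤ len, pre x = ∑ y ∈ Finset.range x, M arrIn y := fun x hx =>
    Finset.sum_congr rfl fun y hy => if_pos ((Finset.mem_range.1 hy).trans_le hx)
  have pre_le : ∀ x, pre x ≤ pre len := by
    intro x
    rcases le_total x len with hx | hx
    · exact pre_mono hx
    · refine le_of_eq ?_
      obtain ⟨y, rfl⟩ := Nat.exists_eq_add_of_le hx
      simp only [hpre, Finset.sum_range_add]
      simp
  have hpw : pre len < 2 ^ w := by rwa [pre_eq len le_rfl]
  unfold scan
  -- the least power of two that is at least `len`
  refine .seq (.assign_exact hw 1 (Expr.eval_const hw (by norm_num)) (.seq (.mono (.loop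
    (fun (j : ℕ) M' => M' = Function.update M arrPow (Function.update (M arrPow) 0 (2 ^ j)) ∧
      (j = 0 ∨ 2 ^ (j - 1) < len))
    (fun j => 20 * (H - j)) (fun j => 40 * (2 * len - 2 ^ j)) ?_ (a := 0) ?_) ?_)))
  · rintro j M' ⟨rfl, hj⟩ ht
    simp [hlen] at ht
    have hjH : j < H := (Nat.pow_lt_pow_iff_right (by norm_num : 1 < 2)).1 (ht.trans_le hH)
    have hp : 2 ^ (j + 1) = 2 * 2 ^ j := by ring
    have hp1 : 1 ≤ 2 ^ j := Nat.one_le_two_pow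
    refine .assign_exact hw (2 ^ (j + 1)) ?_ ⟨j + 1, ⟨?_, Or.inr (by simpa using ht)⟩, ?_, ?_⟩
    · simp
      rw [Nat.mod_eq_of_lt (by omega)]; omega
    · simp
    · simp; omega
    · simp; omega
  · simp
  rintro M1 d1 k1 ⟨h, ⟨rfl, hh⟩, ht, hd1, hk1⟩
  simp [hlen] at ht
  have hhH : h ≤ H := by
    rcases hh with rfl | hh
    · simp
    · have := (Nat.pow_lt_pow_iff_right (by norm_num : 1 < 2)).1 (hh.trans_le hH)
      omega
  -- Minimality of the power keeps the tree linear in `len`; the summand `1` covers `len = 0`.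
  have hP : 2 ^ h ≤ 2 * len + 1 := by
    rcases hh with rfl | hh
    · simp
    · rcases Nat.eq_zero_or_pos h with rfl | h0
      · simp
      · obtain ⟨i, rfl⟩ := Nat.exists_eq_succ_of_ne_zero h0.ne'
        simp at hh
        rw [pow_succ]; omega
  have hh' : ∀ j < h, 2 ^ j < len := by
    intro j hj
    rcases hh with rfl | hh
    · omega
    · exact (Nat.pow_le_pow_right (by norm_num) (by omega)).trans_lt hh
  -- the leaves
  refine .seq (.par_inj (2 ^ h) (by simp) (fun _ => True) (by simp [Expr.eval_const hw])
    (fun p => 2 ^ h + p) (fun p => if p < len then M arrIn p else 0) ?_ ?_ ?_ ?_)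
  · intro p hp _
    simp
    exact Nat.mod_eq_of_lt (by omega)
  · intro p hp _
    simp [hlen]
    split_ifs with hpl
    · refine Nat.mod_eq_of_lt (lt_of_le_of_lt ?_ hsum)
      exact Finset.single_le_sum (f := fun x => M arrIn x) (fun _ _ => Nat.zero_le _)
        (Finset.mem_range.2 hpl)
    · simp
  · intro p _ _ q _ _ hpq; simpa using hpq
  intro T0 _ hT0
  simp at hT0
  -- the sums over the subtrees, from the leaves to the root
  refine .seq (.mono (.loop
    (fun (j : ℕ) M' => j ≤ h ∧ ∃ T, M' = Function.update (Function.update M arrPow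
        (Function.update (M arrPow) 0 (2 ^ j))) arrTree T ∧
      -- Node `x` of level `i` covers the leaves from `x * 2 ^ (h - i)` up to, but excluding, `(x +
      -- 1) * 2 ^ (h - i)`. In this subtraction-free form the sums of two siblings telescope.
      ∀ i, j ≤ i → i ≤ h → ∀ x < 2 ^ i,
        pre (x * 2 ^ (h - i)) + T (2 ^ i + x) = pre ((x + 1) * 2 ^ (h - i)))
    (fun j => 60 * j) (fun j => 120 * 2 ^ j) ?_ (a := h) ?_) ?_)
  · rintro j M' ⟨hj, T, rfl, hT⟩ htj
    have hj0 : 0 < j := by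
      rcases Nat.eq_zero_or_pos j with rfl | h0
      · simp [Expr.eval_const hw] at htj
      · exact h0
    obtain ⟨j, rfl⟩ := Nat.exists_eq_succ_of_ne_zero hj0.ne'
    simp only [Nat.succ_eq_add_one] at *
    have hp : 2 ^ (j + 1) = 2 * 2 ^ j := by ring
    have hp1 : 1 ≤ 2 ^ j := Nat.one_le_two_pow
    have hjh : 2 ^ (j + 1) ≤ 2 ^ h := Nat.pow_le_pow_right (by norm_num) hj
    refine .seq (.assign_exact hw (2 ^ j) (by simp [Expr.eval_const hw]; omega) ?_)
    have key : ∀ p < 2 ^ j, pre (p * 2 ^ (h - j)) +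
        (T (2 ^ (j + 1) + 2 * p) + T (2 ^ (j + 1) + (2 * p + 1))) =
        pre ((p + 1) * 2 ^ (h - j)) := by
      intro p hp'
      have e1 := hT (j + 1) le_rfl hj (2 * p) (by omega)
      have e2 := hT (j + 1) le_rfl hj (2 * p + 1) (by omega)
      have e3 : 2 ^ (h - j) = 2 * 2 ^ (h - (j + 1)) := by
        rw [← pow_succ']; congr 1; omega
      rw [e3, show p * (2 * 2 ^ (h - (j + 1))) = 2 * p * 2 ^ (h - (j + 1)) by ring,
        show (p + 1) * (2 * 2 ^ (h - (j + 1))) = (2 * p + 1 + 1) * 2 ^ (h - (j + 1)) by ring]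
      omega
    have hpre_lt : ∀ x, pre x < 2 ^ w := fun x => (pre_le x).trans_lt hpw
    refine .par_inj (2 ^ j) (by simp) (fun _ => True) (by simp [Expr.eval_const hw])
      (fun p => 2 ^ j + p) (fun p => T (2 ^ (j + 1) + 2 * p) + T (2 ^ (j + 1) + (2 * p + 1)))
      ?_ ?_ (by intro p _ _ q _ _ hpq; simpa using hpq) ?_
    · intro p hp' _
      simp
      exact Nat.mod_eq_of_lt (by omega)
    · intro p hp' _
      have k1 := key p hp'
      have k2 := hpre_lt ((p + 1) * 2 ^ (h - j))
      have a1 : (2 ^ j + p) % 2 ^ w = 2 ^ j + p := Nat.mod_eq_of_lt (by omega)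
      have a2 : (2 ^ j + p + (2 ^ j + p)) % 2 ^ w = 2 ^ (j + 1) + 2 * p := by
        rw [Nat.mod_eq_of_lt (by omega)]; omega
      have a3 : (2 ^ (j + 1) + 2 * p + 1) % 2 ^ w = 2 ^ (j + 1) + (2 * p + 1) := by
        rw [Nat.mod_eq_of_lt (by omega)]; omega
      simp [Expr.eval_const hw, a1, a2, a3]
      exact Nat.mod_eq_of_lt (by omega)
    · intro T' hT' hT''
      simp at hT' hT''
      refine ⟨j, ⟨by omega, T', ?_, ?_⟩, ?_, ?_⟩
      · funext b
        by_cases hb : b = arrTree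
        · subst hb; simp
        · by_cases hb' : b = arrPow
          · subst hb'; simp
          · simp [hb, hb']
      · intro i hi hih x hx
        rcases eq_or_lt_of_le hi with rfl | hi
        · rw [hT'' x hx, key x hx]
        · have hji : 2 ^ (j + 1) ≤ 2 ^ i := Nat.pow_le_pow_right (by norm_num) hi
          rw [hT' (2 ^ i + x) (fun p hp' => by omega)]
          exact hT i hi hih x hx
      · simp; omega
      · simp; omega
  · refine ⟨le_rfl, T0, rfl, ?_⟩
    intro i hi hih x hx
    obtain rfl : i = h := le_antisymm hih hi
    rw [hT0 x hx]
    simp [hpre, Finset.sum_range_succ]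
  rintro M2 d2 k2 ⟨j, ⟨hj, T, rfl, hT⟩, htj, hd2, hk2⟩
  have hj0 : j = 0 := by
    by_contra h0
    simp [Expr.eval_const hw] at htj
    exact h0 htj
  subst hj0
  refine .seq (.assign_exact hw (pre len) ?_ ?_)
  · have := hT 0 le_rfl (by omega) 0 (by simp)
    simp [hpre] at this
    simp [Expr.eval_const hw, this]
    refine le_antisymm (pre_le _) (pre_mono ?_)
    simpa using ht
  refine .seq (.par_one hw 1 0 (Expr.eval_const hw (by norm_num))
    (Expr.eval_const hw (by norm_num)) ?_)
  -- the prefix sums, from the root to the leaves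
  refine .seq (.mono (.loop
    (fun (j : ℕ) M' => j ≤ h ∧ M' arrPow 0 = 2 ^ j ∧ M' arrTree = T ∧
      (∀ b, b ∉ [arrTree, arrDown, arrPow, arrTot, arrPre] → M' b = M b) ∧
      M' arrTot 0 = pre len ∧
      ∀ x < 2 ^ j, M' arrDown (2 ^ j + x) = pre (x * 2 ^ (h - j)))
    (fun j => 50 * (h - j)) (fun j => 100 * (2 * 2 ^ h - 2 * 2 ^ j)) ?_ (a := 0) ?_) ?_)
  · rintro j M' ⟨hj, hMp, hMt, hfr, htot, hD⟩ htj
    have hlen2 : M' arrLen 0 = len := by rw [hfr _ (by decide), hlen]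
    simp [hMp, hlen2] at htj
    have hjh : j < h :=
      (Nat.pow_lt_pow_iff_right (by norm_num : 1 < 2)).1 (htj.trans_le ht)
    have hp : 2 ^ (j + 1) = 2 * 2 ^ j := by ring
    have hp1 : 1 ≤ 2 ^ j := Nat.one_le_two_pow
    have hjh' : 2 ^ (j + 1) ≤ 2 ^ h := Nat.pow_le_pow_right (by norm_num) hjh
    have hpre_lt : ∀ x, pre x < 2 ^ w := fun x => (pre_le x).trans_lt hpw
    have e3 : 2 ^ (h - j) = 2 * 2 ^ (h - (j + 1)) := by
      rw [← pow_succ']; congr 1; omega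
    refine .seq (.assign_exact hw (2 ^ (j + 1)) ?_ ?_)
    · simp [hMp]
      rw [Nat.mod_eq_of_lt (by omega)]; omega
    refine .par_inj (2 ^ (j + 1)) (by simp) (fun _ => True) (by simp [Expr.eval_const hw])
      (fun p => 2 ^ (j + 1) + p) (fun p => pre (p * 2 ^ (h - (j + 1))))
      ?_ ?_ (by intro p _ _ q _ _ hpq; simpa using hpq) ?_
    · intro p hp' _
      simp
      exact Nat.mod_eq_of_lt (by omega)
    · intro p hp' _
      have a1 : (2 ^ (j + 1) + p) % 2 ^ w = 2 ^ (j + 1) + p := Nat.mod_eq_of_lt (by omega)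
      have a2 : (2 ^ (j + 1) + p) / 2 = 2 ^ j + p / 2 := by omega
      have a3 := hD (p / 2) (by omega)
      have a4 := hT (j + 1) (by omega) hjh
      simp [Expr.eval_const hw, a1, a2, a3, hMt]
      -- A left child begins where its parent begins. A right child begins after its left sibling,
      -- whose sum is in the preceding cell of the tree.
      rcases Nat.mod_two_eq_zero_or_one p with hp2 | hp2
      · obtain ⟨q, rfl⟩ : ∃ q, p = 2 * q := ⟨p / 2, by omega⟩
        rw [hp2, zero_mul, add_zero, Nat.mod_eq_of_lt (hpre_lt _), e3]
        congr 1
        rw [Nat.mul_div_cancel_left _ (by norm_num)]; ring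
      · obtain ⟨q, rfl⟩ : ∃ q, p = 2 * q + 1 := ⟨p / 2, by omega⟩
        have a5 := a4 (2 * q) (by omega)
        have a6 := hpre_lt ((2 * q + 1) * 2 ^ (h - (j + 1)))
        rw [hp2, one_mul, show 2 ^ (j + 1) + (2 * q + 1) - 1 = 2 ^ (j + 1) + 2 * q by omega,
          show (2 * q + 1) / 2 = q by omega, e3,
          show q * (2 * 2 ^ (h - (j + 1))) = 2 * q * 2 ^ (h - (j + 1)) by ring,
          a5, Nat.mod_eq_of_lt a6]
    · intro D hD' hD''
      simp at hD''
      refine ⟨j + 1, ⟨hjh, by simp, by simp [hMt], ?_, by simp [htot], ?_⟩, ?_, ?_⟩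
      · intro b hb
        rw [← hfr b hb]
        simp at hb
        simp [hb]
      · intro x hx
        simp [hD'' x hx]
      · simp; omega
      · simp; omega
  · refine ⟨by omega, by simp, by simp, ?_, by simp, ?_⟩
    · intro b hb
      simp at hb
      simp [hb]
    · intro x hx
      obtain rfl : x = 0 := by simpa using hx
      simp [hpre]
  rintro M3 d3 k3 ⟨j, ⟨hj, hMp, hMt, hfr, htot, hD⟩, htj, hd3, hk3⟩
  have hlen2 : M3 arrLen 0 = len := by rw [hfr _ (by decide), hlen]
  simp [hMp, hlen2] at htj
  obtain rfl : j = h := by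
    by_contra hne
    exact absurd (hh' j (by omega)) (by omega)
  refine .fill_exact hw len (by simp [hlen2]) (fun x => pre x) ?_ ?_
  · intro p hp
    have a1 : (2 ^ j + p) % 2 ^ w = 2 ^ j + p := Nat.mod_eq_of_lt (by omega)
    simp [hMp, a1, hD p (by omega)]
  · refine ⟨?_, ?_, ?_, ?_, ?_⟩
    · intro b hb
      rw [← hfr b hb]
      simp at hb
      simp [hb]
    · intro x hx
      simp [hx, pre_eq x hx.le]
    · simp [htot, pre_eq len le_rfl]
    · simp at hd1 hd2 hd3 ⊢
      omega
    · simp at hk1 hk2 hk3 ⊢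
      omega

end

end PRAM

/-! ### Stable counting sort -/

namespace PRAM

notation "arrKey" => (18 : ℕ)
notation "arrVal" => (19 : ℕ)
notation "arrList" => (20 : ℕ)
notation "arrBuckets" => (21 : ℕ)
notation "arrGroups" => (22 : ℕ)
notation "arrIter" => (23 : ℕ)
notation "arrRank" => (24 : ℕ)

/-- The position of item `x` when the items `0, …, N - 1` are sorted stably by `key`. -/
def sortPos (N : ℕ) (key : ℕ → ℕ) (x : ℕ) : ℕ :=
  ((Finset.range N).filter fun y => key y < key x ∨ key y = key x ∧ y < x).card

theorem sortPos_lt {N : ℕ} {key : ℕ → ℕ} {x : ℕ} (hx : x < N) : sortPos N key x < N := by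
  have : ((Finset.range N).filter fun y => key y < key x ∨ key y = key x ∧ y < x) ⊂
      Finset.range N := by
    refine Finset.filter_ssubset.2 ⟨x, Finset.mem_range.2 hx, by simp⟩
  simpa [sortPos] using Finset.card_lt_card this

theorem sortPos_lt_sortPos {N : ℕ} {key : ℕ → ℕ} {x y : ℕ} (hx : x < N)
    (h : key x < key y ∨ key x = key y ∧ x < y) : sortPos N key x < sortPos N key y := by
  refine Finset.card_lt_card (Finset.ssubset_iff_of_subset ?_ |>.2 ⟨x, ?_, ?_⟩)
  · intro z hz
    simp only [Finset.mem_filter] at hz ⊢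
    exact ⟨hz.1, by omega⟩
  · simpa [hx] using h
  · simp

theorem sortPos_injOn {N : ℕ} {key : ℕ → ℕ} {x y : ℕ} (hx : x < N) (hy : y < N)
    (h : sortPos N key x = sortPos N key y) : x = y := by
  by_contra hne
  rcases Nat.lt_trichotomy (key x) (key y) with hk | hk | hk
  · exact absurd h (sortPos_lt_sortPos hx (.inl hk)).ne
  · rcases Nat.lt_or_gt_of_ne hne with hl | hl
    · exact absurd h (sortPos_lt_sortPos hx (.inr ⟨hk, hl⟩)).ne
    · exact absurd h (sortPos_lt_sortPos hy (.inr ⟨hk.symm, hl⟩)).ne'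
  · exact absurd h (sortPos_lt_sortPos hy (.inl hk)).ne'

/-- An injection of `{0, …, N - 1}` into itself is surjective. -/
theorem exists_eq_of_injOn_lt {N : ℕ} {π : ℕ → ℕ} (h : ∀ x < N, π x < N)
    (hinj : ∀ x < N, ∀ y < N, π x = π y → x = y) {i : ℕ} (hi : i < N) : ∃ x < N, π x = i := by
  have := Finset.surjOn_of_injOn_of_card_le (s := Finset.range N) (t := Finset.range N) π
    (fun x hx => by simpa using h x (by simpa using hx))
    (fun x hx y hy => hinj x (by simpa using hx) y (by simpa using hy)) le_rfl
  obtain ⟨x, hx, rfl⟩ := this (show i ∈ (Finset.range N : Set ℕ) by simpa using hi)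
  exact ⟨x, by simpa using hx, rfl⟩

/-- Two-digit numbers in base `G` compare lexicographically. This serves for counters (key, group),
for items (group, index in the group) and for start times (block, offset). -/
theorem mul_add_lt_mul_add_iff {G a b c d : ℕ} (hb : b < G) (hd : d < G) :
    a * G + b < c * G + d ↔ a < c ∨ a = c ∧ b < d := by
  constructor
  · intro h
    rcases Nat.lt_trichotomy a c with h1 | h1 | h1
    · exact .inl h1
    · subst h1; exact .inr ⟨rfl, by omega⟩
    · have := Nat.mul_le_mul_right G h1
      rw [Nat.succ_mul] at this; omega
  · rintro (h | ⟨rfl, h⟩)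
    · have := Nat.mul_le_mul_right G h
      rw [Nat.succ_mul] at this; omega
    · omega

theorem mul_add_eq_mul_add_iff {G a b c d : ℕ} (hb : b < G) (hd : d < G) :
    a * G + b = c * G + d ↔ a = c ∧ b = d := by
  have h1 := mul_add_lt_mul_add_iff (a := a) (c := c) hb hd
  have h2 := mul_add_lt_mul_add_iff (a := c) (c := a) hd hb
  constructor
  · intro h; omega
  · rintro ⟨rfl, rfl⟩; rfl

section

variable {w : ℕ} {β : ℝ} {ρ : Resolver}

open PRAM.Expr in
/-- Stable counting sort of the items `0, …, n - 1` by their keys in `arrKey`, with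
`arrBuckets` many buckets: `arrList` receives the entries of `arrVal` in sorted order. Each of
`arrGroups` many processors counts a group of `arrBuckets` consecutive items. -/
def countingSort : Cmd :=
  .assign arrGroups (var 0 / var arrBuckets + const 1) ;;
  .fill (var arrGroups * var arrBuckets) arrIn (const 0) ;;
  .assign arrIter (const 0) ;;
  .loop (lt (var arrIter) (var arrBuckets))
    (.par (var arrGroups) (lt (pid * var arrBuckets + var arrIter) (var 0)) arrRank
      (pid * var arrBuckets + var arrIter)
      (read arrIn (read arrKey (pid * var arrBuckets + var arrIter) * var arrGroups + pid)) ;;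
     .par (var arrGroups) (lt (pid * var arrBuckets + var arrIter) (var 0)) arrIn
      (read arrKey (pid * var arrBuckets + var arrIter) * var arrGroups + pid)
      (read arrIn (read arrKey (pid * var arrBuckets + var arrIter) * var arrGroups + pid) +
        const 1) ;;
     .assign arrIter (var arrIter + const 1)) ;;
  .assign arrLen (var arrGroups * var arrBuckets) ;;
  scan ;;
  .par (var 0) (const 1) arrList
    (read arrPre (read arrKey pid * var arrGroups + pid / var arrBuckets) + read arrRank pid)
    (read arrVal pid)

/-- One processor per group of `B` consecutive items handles its items one after the other, with a
counter of its own for each key; about `N / B` processors for `B` rounds keep the work linear. The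
counters are laid out by key and then by group, so a stable position is the prefix sum up to the
item's counter plus the value of that counter when the item was met. -/
theorem countingSort_spec (hw : 20 ≤ w) {M : Memory} {N B : ℕ} (hN : M 0 0 = N)
    (hB : M arrBuckets 0 = B) (hB0 : 0 < B) (hkey : ∀ x < N, M arrKey x < B)
    (hbound : 16 * (N + B) + 16 ≤ 2 ^ w) {H : ℕ} (hH : N + B ≤ 2 ^ H) :
    Ensures w β ρ countingSort M fun M' d k =>
      (∀ b, b ∉ [arrIn, arrLen, arrTree, arrDown, arrPow, arrTot, arrPre, arrList, arrGroups,
        arrIter, arrRank] → M' b = M b) ∧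
      (∀ x < N, M' arrList (sortPos N (M arrKey) x) = M arrVal x) ∧
      d ≤ 100 * B + 200 * (H + 1) + 200 ∧ k ≤ 2000 * (N + B + 1) := by
  set G := N / B + 1 with hG
  set key := M arrKey with hkeydef
  set cell : ℕ → ℕ := fun y => key y * G + y / B with hcell
  have hGB : G * B ≤ N + B := by
    rw [hG, add_mul, one_mul]
    have := Nat.div_mul_le_self N B
    omega
  have hNGB : N < G * B := by
    rw [hG]; exact Nat.lt_mul_of_div_lt (Nat.lt_succ_self _) hB0
  have hGle : G ≤ N + 1 := by
    have := Nat.div_le_self N B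
    omega
  have hdiv : ∀ y < N, y / B < G := fun y hy => Nat.div_lt_of_lt_mul (by rw [mul_comm]; omega)
  have hcell_lt : ∀ y < N, cell y < G * B := by
    intro y hy
    have h1 := hdiv y hy
    have h2 := Nat.mul_le_mul_right G (Nat.succ_le_of_lt (hkey y hy))
    rw [Nat.succ_mul] at h2
    rw [mul_comm G B]
    simp only [hcell]
    omega
  have hsplit : ∀ p i, i < B → (p * B + i) / B = p ∧ (p * B + i) % B = i := by
    intro p i hi
    constructor
    · rw [mul_comm, Nat.mul_add_div hB0, Nat.div_eq_of_lt hi, add_zero]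
    · rw [mul_comm, Nat.mul_add_mod, Nat.mod_eq_of_lt hi]
  unfold countingSort
  refine .seq (.assign_exact hw G ?_ (.seq (.fill_exact hw (G * B) ?_ (fun _ => 0) ?_ (.seq
    (.assign_exact hw 0 (Expr.eval_const hw (by norm_num)) (.seq (.mono (.loop
    -- After `i` rounds exactly the items with residue below `i` modulo `B` have been counted.
    (fun (i : ℕ) M' => i ≤ B ∧ M' arrIter 0 = i ∧ M' arrGroups 0 = G ∧
      (∀ b, b ∉ [arrIn, arrIter, arrGroups, arrRank] → M' b = M b) ∧
      (∀ z < G * B, M' arrIn z =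
        ((Finset.range N).filter fun y => cell y = z ∧ y % B < i).card) ∧
      (∀ x < N, x % B < i → M' arrRank x =
        ((Finset.range N).filter fun y => cell y = cell x ∧ y % B < x % B).card))
    (fun i => 90 * (B - i)) (fun i => 90 * (B - i) * (G + 1)) ?_ (a := 0) ?_) ?_)))))))
  · simp [hN, hB, Expr.eval_const hw]
    exact Nat.mod_eq_of_lt (by omega)
  · simp [hB]
    exact Nat.mod_eq_of_lt (by omega)
  · simp [Expr.eval_const hw]
  · rintro i M' ⟨hi, hMi, hMG, hfr, hIn, hRank⟩ ht
    have hM0 : M' 0 0 = N := by rw [hfr _ (by decide), hN]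
    have hMB : M' arrBuckets 0 = B := by rw [hfr _ (by decide), hB]
    have hMk : M' arrKey = key := hfr _ (by decide)
    simp [hMi, hMB] at ht
    have hiB : i < B := by
      by_contra h
      exact absurd ht (by simp [h])
    have hx : ∀ p < G, (p * B + i) % 2 ^ w = p * B + i := by
      intro p hp
      have := Nat.mul_le_mul_right B (Nat.succ_le_of_lt hp)
      rw [Nat.succ_mul] at this
      exact Nat.mod_eq_of_lt (by omega)
    have hc : ∀ p < G, p * B + i < N →
        (key (p * B + i) * G + p) % 2 ^ w = cell (p * B + i) := by
      intro p hp hl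
      have h1 := hcell_lt _ hl
      simp only [hcell, (hsplit p i hiB).1] at h1 ⊢
      exact Nat.mod_eq_of_lt (by omega)
    have hInle : ∀ z < G * B, M' arrIn z ≤ N := by
      intro z hz
      rw [hIn z hz]
      exact (Finset.card_filter_le _ _).trans (by simp)
    refine .seq (.par_inj G (by simp [hMG]) (fun p => p * B + i < N) ?_ (fun p => p * B + i)
      (fun p => M' arrIn (cell (p * B + i))) ?_ ?_ ?_ ?_)
    · intro p hp
      simp [hMi, hMB, hM0, hx p hp]
    · intro p hp hl
      simp [hMi, hMB, hx p hp]
    · intro p hp hl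
      simp [hMi, hMB, hMG, hMk, hx p hp, hc p hp hl]
    · intro p _ _ q _ _ hpq
      simp only [Nat.add_right_cancel_iff] at hpq
      exact Nat.eq_of_mul_eq_mul_right hB0 hpq
    intro R hR1 hR2
    refine .seq (.par_inj G (by simp [hMG]) (fun p => p * B + i < N) ?_
      (fun p => cell (p * B + i)) (fun p => M' arrIn (cell (p * B + i)) + 1) ?_ ?_ ?_ ?_)
    · intro p hp
      simp [hMi, hMB, hM0, hx p hp]
    · intro p hp hl
      simp [hMi, hMB, hMG, hMk, hx p hp, hc p hp hl]
    · intro p hp hl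
      simp [hMi, hMB, hMG, hMk, hx p hp, hc p hp hl, Expr.eval_const hw]
      have := hInle _ (hcell_lt _ hl)
      exact Nat.mod_eq_of_lt (by omega)
    -- A counter determines its group and hence its processor, so no two increments collide.
    · intro p hp _ q hq _ hpq
      simp only [hcell, (hsplit p i hiB).1, (hsplit q i hiB).1] at hpq
      exact ((mul_add_eq_mul_add_iff hp hq).1 hpq).2
    intro I hI1 hI2
    refine .assign_exact hw (i + 1) ?_ ?_
    · simp [hMi, Expr.eval_const hw]
      exact Nat.mod_eq_of_lt (by omega)
    refine ⟨i + 1, ⟨hiB, by simp, by simp [hMG], ?_, ?_, ?_⟩, ?_, ?_⟩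
    · intro b hb
      rw [← hfr b hb]
      simp at hb
      simp [hb]
    · intro z hz
      change I z = _
      by_cases hp : ∃ p < G, p * B + i < N ∧ cell (p * B + i) = z
      · obtain ⟨p, hp, hl, rfl⟩ := hp
        rw [hI2 p hp hl, hIn _ hz]
        have : ((Finset.range N).filter fun y => cell y = cell (p * B + i) ∧ y % B < i + 1) =
            insert (p * B + i)
              ((Finset.range N).filter fun y => cell y = cell (p * B + i) ∧ y % B < i) := by
          ext y
          simp only [Finset.mem_filter, Finset.mem_range, Finset.mem_insert]
          constructor
          · rintro ⟨hy, he, hm⟩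
            rcases Nat.lt_succ_iff_lt_or_eq.1 hm with h | h
            · exact .inr ⟨hy, he, h⟩
            · left
              simp only [hcell, (hsplit p i hiB).1] at he
              have h2 := ((mul_add_eq_mul_add_iff (hdiv y hy) hp).1 he).2
              rw [← Nat.div_add_mod y B, h2, h, mul_comm]
          · rintro (rfl | ⟨hy, he, hm⟩)
            · exact ⟨hl, rfl, by rw [(hsplit p i hiB).2]; omega⟩
            · exact ⟨hy, he, by omega⟩
        rw [this, Finset.card_insert_of_notMem]
        simp [(hsplit p i hiB).2]
      · push Not at hp
        rw [hI1 z hp]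
        change M' arrIn z = _
        rw [hIn z hz]
        congr 1
        ext y
        simp only [Finset.mem_filter, Finset.mem_range]
        constructor
        · rintro ⟨hy, he, hm⟩; exact ⟨hy, he, by omega⟩
        · rintro ⟨hy, he, hm⟩
          refine ⟨hy, he, ?_⟩
          by_contra hm'
          have hm2 : y % B = i := by omega
          have hy2 : y / B * B + i = y := by
            conv_rhs => rw [← Nat.div_add_mod y B, hm2, mul_comm]
          exact hp (y / B) (hdiv y hy) (by rwa [hy2]) (by rw [hy2, he])
    · intro x hx' hxi
      simp
      by_cases hxi' : x % B = i
      · have hx2 : x / B * B + i = x := by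
          conv_rhs => rw [← Nat.div_add_mod x B, hxi', mul_comm]
        have := hR2 (x / B) (hdiv x hx') (by rwa [hx2])
        rw [hx2] at this
        rw [this, hIn _ (hcell_lt x hx'), hxi']
      · rw [hR1 x ?_]
        · exact hRank x hx' (by omega)
        · rintro p hp hl rfl
          exact hxi' (hsplit p i hiB).2
    · simp; omega
    · obtain ⟨j, rfl⟩ := Nat.exists_eq_add_of_lt hiB
      rw [show i + j + 1 - i = j + 1 by omega, show i + j + 1 - (i + 1) = j by omega]
      have hG1 : 1 ≤ G := Nat.le_add_left 1 _
      simp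
      nlinarith
  · refine ⟨by omega, by simp, by simp, ?_, ?_, by simp⟩
    · intro b hb
      simp at hb
      simp [hb]
    · intro z hz
      simp [hz]
  rintro M1 d1 k1 ⟨i, ⟨hi, hMi, hMG, hfr, hIn, hRank⟩, ht, hd1, hk1⟩
  have hM0 : M1 0 0 = N := by rw [hfr _ (by decide), hN]
  have hMB : M1 arrBuckets 0 = B := by rw [hfr _ (by decide), hB]
  have hMk : M1 arrKey = key := hfr _ (by decide)
  simp [hMi, hMB] at ht
  obtain rfl : i = B := le_antisymm hi ht
  have hsum : ∀ z ≤ G * i, ∑ x ∈ Finset.range z, M1 arrIn x =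
      ((Finset.range N).filter fun y => cell y < z).card := by
    intro z hz
    rw [Finset.card_eq_sum_card_fiberwise (f := cell) (t := Finset.range z)
      (fun y hy => by simpa using (Finset.mem_filter.1 hy).2)]
    refine Finset.sum_congr rfl fun x hx => ?_
    have hx := Finset.mem_range.1 hx
    rw [hIn x (by omega), Finset.filter_filter]
    congr 1
    ext y
    simp only [Finset.mem_filter]
    constructor
    · rintro ⟨h1, h2, h3⟩; exact ⟨h1, by omega, h2⟩
    · rintro ⟨h1, h2, h3⟩; exact ⟨h1, h3, Nat.mod_lt _ hB0⟩
  have hsumle : ∀ z ≤ G * i, ∑ x ∈ Finset.range z, M1 arrIn x ≤ N := fun z hz => by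
    rw [hsum z hz]
    exact (Finset.card_filter_le _ _).trans (by simp)
  refine .seq (.assign_exact hw (G * i) ?_ (.seq (.mono (scan_spec hw (len := G * i) (H := H)
    (by simp) (by omega) ?_ (by omega)) ?_)))
  · simp [hMG, hMB]
    exact Nat.mod_eq_of_lt (by omega)
  · simp
    exact (hsumle _ le_rfl).trans_lt (by omega)
  rintro M2 d2 k2 ⟨hfr2, hPre, -, hd2, hk2⟩
  simp at hPre
  have e0 : M2 0 = M 0 := by rw [hfr2 _ (by decide), ← hfr 0 (by decide)]; simp
  have eB : M2 arrBuckets = M arrBuckets := by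
    rw [hfr2 _ (by decide), ← hfr arrBuckets (by decide)]; simp
  have eG : M2 arrGroups 0 = G := by rw [hfr2 _ (by decide)]; simp [hMG]
  have eK : M2 arrKey = key := by rw [hfr2 _ (by decide), ← hMk]; simp
  have eV : M2 arrVal = M arrVal := by
    rw [hfr2 _ (by decide), ← hfr arrVal (by decide)]; simp
  have eR : M2 arrRank = M1 arrRank := by rw [hfr2 _ (by decide)]; simp
  -- Stable order is the lexicographic order of key, group and residue: the items before `x` lie in
  -- an earlier counter, or in the same counter with a smaller residue.
  have hpos : ∀ x < N, M2 arrPre (cell x) + M2 arrRank x = sortPos N key x := by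
    intro x hx
    rw [hPre _ (hcell_lt x hx), hsum _ (hcell_lt x hx).le, eR, hRank x hx (Nat.mod_lt _ hB0),
      sortPos, ← Finset.card_union_of_disjoint]
    · congr 1
      ext y
      simp only [Finset.mem_union, Finset.mem_filter, Finset.mem_range, ← and_or_left]
      refine and_congr_right fun hy => ?_
      simp only [hcell]
      rw [mul_add_lt_mul_add_iff (hdiv y hy) (hdiv x hx),
        mul_add_eq_mul_add_iff (hdiv y hy) (hdiv x hx)]
      have : y < x ↔ y / i < x / i ∨ y / i = x / i ∧ y % i < x % i := by
        rw [← mul_add_lt_mul_add_iff (Nat.mod_lt y hB0) (Nat.mod_lt x hB0), mul_comm (y / i),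
          mul_comm (x / i), Nat.div_add_mod, Nat.div_add_mod]
      rw [this]
      tauto
    · rw [Finset.disjoint_filter]
      intro y _ h1 h2
      omega
  refine .par_inj N (by simp [e0, hN]) (fun _ => True) (by simp [Expr.eval_const hw])
    (fun x => sortPos N key x) (fun x => M arrVal x) ?_ ?_ ?_ ?_
  · intro x hx _
    have h1 := hcell_lt x hx
    have h2 : (key x * G + x / i) % 2 ^ w = cell x :=
      Nat.mod_eq_of_lt (h1.trans_le (by omega))
    have h3 := sortPos_lt (key := key) hx
    simp [eG, eB, hB, eK, h2, hpos x hx]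
    exact Nat.mod_eq_of_lt (by omega)
  · intro x hx _
    simp [eV]
  · intro x hx _ y hy _ h
    exact sortPos_injOn hx hy h
  intro L _ hL
  refine ⟨?_, ?_, ?_, ?_⟩
  · intro b hb
    simp at hb
    have h1 := hfr2 b (by simp [hb])
    rw [show Function.update M2 arrList L b = M2 b by simp [hb], h1, ← hfr b (by simp [hb])]
    simp [hb]
  · intro x hx
    simpa using hL x hx trivial
  · simp at hd1 hd2 ⊢
    omega
  · simp at hk1 hk2 ⊢
    nlinarith

end

end PRAM

/-! ### Sorting the vertices by their start times -/

namespace PRAM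

notation "arrQ" => (4 : ℕ)
notation "arrL" => (5 : ℕ)
notation "arrK" => (6 : ℕ)
notation "arrDone" => (7 : ℕ)
notation "arrLog" => (8 : ℕ)
notation "arrU" => (9 : ℕ)
notation "arrStart" => (17 : ℕ)
notation "arrStartAt" => (25 : ℕ)
notation "arrEnd" => (26 : ℕ)
notation "arrBlock" => (42 : ℕ)

/-- The start time encoded by the random word `u`: the block number is the binary logarithm of
`u / K`, so that each block of `K` consecutive times is twice as likely as the one before it. -/
def startTime (K u : ℕ) : ℕ := Nat.log 2 (u / K) * K + u % K

theorem startTime_lt {L K u : ℕ} (hK : 0 < K) (hL : 0 < L) (hu : u < 2 ^ L * K) :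
    startTime K u < L * K := by
  have h1 : u / K < 2 ^ L := Nat.div_lt_of_lt_mul (by rwa [mul_comm])
  have h2 : Nat.log 2 (u / K) < L := Nat.log_lt_of_lt_pow' hL.ne' h1
  have h3 := Nat.mod_lt u hK
  have h4 := Nat.mul_le_mul_right K h2
  rw [Nat.succ_mul] at h4
  unfold startTime
  omega

/-- `list` enumerates `0, …, n - 1` in the order of `s`. -/
structure IsSortedList (n : ℕ) (s list : ℕ → ℕ) : Prop where
  lt : ∀ i < n, list i < n
  inj : ∀ i < n, ∀ j < n, list i = list j → i = j
  surj : ∀ v < n, ∃ i < n, list i = v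
  mono : ∀ i j, i ≤ j → j < n → s (list i) ≤ s (list j)

/-- The cell `s (list i)` of `runEnd` holds the end of the run of equal values of `s` around `i`. -/
def IsRunEnd (n : ℕ) (s list runEnd : ℕ → ℕ) : Prop :=
  ∀ i < n, (i + 1 = n ∨ s (list (i + 1)) ≠ s (list i)) → runEnd (s (list i)) = i + 1

/-- Induction on the distance of `i` from the end of the list: either the next entry continues the
run and has the same end, or the run ends right here and monotonicity separates it from all later
entries. -/
theorem IsRunEnd.spec {n : ℕ} {s list runEnd : ℕ → ℕ} (hs : IsSortedList n s list)
    (h : IsRunEnd n s list runEnd) {i : ℕ} (hi : i < n) :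
    i < runEnd (s (list i)) ∧ runEnd (s (list i)) ≤ n ∧
    (∀ j, i ≤ j → j < runEnd (s (list i)) → s (list j) = s (list i)) ∧
    (∀ j, runEnd (s (list i)) ≤ j → j < n → s (list i) < s (list j)) := by
  obtain ⟨d, hd⟩ : ∃ d, n = i + d + 1 := ⟨n - i - 1, by omega⟩
  induction d generalizing i with
  | zero =>
    rw [h i hi (.inl (by omega))]
    refine ⟨by omega, by omega, fun j h1 h2 => ?_, fun j h1 h2 => by omega⟩
    obtain rfl : j = i := by omega
    rfl
  | succ d ih =>
    by_cases he : s (list (i + 1)) = s (list i)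
    · obtain ⟨h1, h2, h3, h4⟩ := ih (i := i + 1) (by omega) (by omega)
      rw [he] at h1 h2 h3 h4
      refine ⟨by omega, h2, fun j h5 h6 => ?_, h4⟩
      rcases Nat.eq_or_lt_of_le h5 with rfl | h5
      · rfl
      · exact h3 j h5 h6
    · rw [h i hi (.inr he)]
      refine ⟨by omega, by omega, fun j h1 h2 => ?_, fun j h1 h2 => ?_⟩
      · obtain rfl : j = i := by omega
        rfl
      · have h3 := hs.mono i (i + 1) (by omega) (by omega)
        have h4 := hs.mono (i + 1) j h1 h2
        omega

theorem sortPos_congr {N : ℕ} {key key' : ℕ → ℕ} (h : ∀ x < N, key x = key' x) {x : ℕ}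
    (hx : x < N) : sortPos N key x = sortPos N key' x := by
  unfold sortPos
  congr 1
  refine Finset.filter_congr fun y hy => ?_
  rw [h x hx, h y (Finset.mem_range.1 hy)]

/-- Sorting stably by the low digits and then by the high digits sorts. -/
theorem isSortedList_of_two_passes {n K : ℕ} {hi lo list₁ list : ℕ → ℕ} (hlo : ∀ v < n, lo v < K)
    (h1 : ∀ v < n, list₁ (sortPos n lo v) = v)
    (h2 : ∀ i < n, list (sortPos n (fun i => hi (list₁ i)) i) = list₁ i) :
    IsSortedList n (fun v => hi v * K + lo v) list := by
  set π : ℕ → ℕ := fun v => sortPos n (fun i => hi (list₁ i)) (sortPos n lo v) with hπ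
  have hπlt : ∀ v < n, π v < n := fun v hv => sortPos_lt (sortPos_lt hv)
  have hπinj : ∀ u < n, ∀ v < n, π u = π v → u = v := fun u hu v hv h =>
    sortPos_injOn hu hv (sortPos_injOn (sortPos_lt hu) (sortPos_lt hv) h)
  have hlist : ∀ v < n, list (π v) = v := fun v hv => by
    rw [hπ, h2 _ (sortPos_lt hv), h1 v hv]
  have hsurj : ∀ i < n, ∃ v < n, π v = i := fun i hi =>
    exists_eq_of_injOn_lt hπlt hπinj hi
  have hmono : ∀ u < n, ∀ v < n, hi u * K + lo u < hi v * K + lo v → π u < π v := by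
    intro u hu v hv h
    refine sortPos_lt_sortPos (sortPos_lt hu) ?_
    simp only [h1 u hu, h1 v hv]
    rcases (mul_add_lt_mul_add_iff (hlo u hu) (hlo v hv)).1 h with h | ⟨h, h'⟩
    · exact .inl h
    · exact .inr ⟨h, sortPos_lt_sortPos hu (.inl h')⟩
  refine ⟨fun i hi => ?_, fun i hi j hj h => ?_, fun v hv => ⟨π v, hπlt v hv, hlist v hv⟩,
    fun i j hij hj => ?_⟩
  · obtain ⟨v, hv, rfl⟩ := hsurj i hi
    rwa [hlist v hv]
  · obtain ⟨u, hu, rfl⟩ := hsurj i hi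
    obtain ⟨v, hv, rfl⟩ := hsurj j hj
    rw [hlist u hu, hlist v hv] at h
    rw [h]
  · obtain ⟨u, hu, rfl⟩ := hsurj i (by omega)
    obtain ⟨v, hv, rfl⟩ := hsurj j hj
    rw [hlist u hu, hlist v hv]
    by_contra h
    have := hmono v hv u hu (by simpa using h)
    omega

section

variable {w : ℕ} {β : ℝ} {ρ : Resolver}

open PRAM.Expr in
/-- Computes the start times, and the list of the vertices sorted by start times, with the ends
of its runs. -/
def sortByStart : Cmd :=
  .fill (var 0) arrBlock (read arrLog (read arrU pid / var arrK)) ;;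
  .fill (var 0) arrKey (read arrU pid % var arrK) ;;
  .fill (var 0) arrStart (read arrBlock pid * var arrK + read arrKey pid) ;;
  .fill (var 0) arrVal pid ;;
  .assign arrBuckets (var arrK) ;;
  countingSort ;;
  .fill (var 0) arrVal (read arrList pid) ;;
  .fill (var 0) arrKey (read arrBlock (read arrVal pid)) ;;
  .assign arrBuckets (var arrL) ;;
  countingSort ;;
  .fill (var 0) arrStartAt (read arrStart (read arrList pid)) ;;
  .par (var 0)
    (const 1 - lt (pid + const 1) (var 0) *
      eq (read arrStartAt (pid + const 1)) (read arrStartAt pid))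
    arrEnd (read arrStartAt pid) (pid + const 1)

/-- A start time is a two-digit number in base `K`. Radix sort needs `K` and then `L` buckets, where
a single pass would need `L * K` of them and could cost more than linear work. -/
theorem sortByStart_spec (hw : 20 ≤ w) {M : Memory} {n K L : ℕ} (hn : M 0 0 = n)
    (hK : M arrK 0 = K) (hL : M arrL 0 = L) (hK0 : 0 < K) (hL0 : 0 < L)
    (hlog : ∀ x < 2 ^ L, M arrLog x = Nat.log 2 x) (hU : ∀ v < n, M arrU v < 2 ^ L * K)
    (hb1 : 16 * (n + K) + 16 ≤ 2 ^ w) (hb2 : 16 * (n + L) + 16 ≤ 2 ^ w) (hb3 : L * K ≤ 2 ^ w)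
    {H : ℕ} (hH1 : n + K ≤ 2 ^ H) (hH2 : n + L ≤ 2 ^ H) :
    Ensures w β ρ sortByStart M fun M' d k =>
      (∀ b, b ∉ [arrIn, arrLen, arrTree, arrDown, arrPow, arrTot, arrPre, arrList, arrGroups,
        arrIter, arrRank, arrBlock, arrKey, arrStart, arrVal, arrBuckets, arrStartAt, arrEnd] →
        M' b = M b) ∧
      IsSortedList n (fun v => startTime K (M arrU v)) (M' arrList) ∧
      IsRunEnd n (fun v => startTime K (M arrU v)) (M' arrList) (M' arrEnd) ∧
      (∀ i < n, M' arrStartAt i = startTime K (M arrU (M' arrList i))) ∧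
      d ≤ 100 * K + 100 * L + 400 * (H + 1) + 1000 ∧ k ≤ 10000 * (n + K + L + 1) := by
  set hi : ℕ → ℕ := fun v => Nat.log 2 (M arrU v / K) with hhi
  set lo : ℕ → ℕ := fun v => M arrU v % K with hlo
  have hdiv : ∀ v < n, M arrU v / K < 2 ^ L := fun v hv =>
    Nat.div_lt_of_lt_mul (by rw [mul_comm]; exact hU v hv)
  have hhi_lt : ∀ v < n, hi v < L := fun v hv => Nat.log_lt_of_lt_pow' hL0.ne' (hdiv v hv)
  have hlo_lt : ∀ v, lo v < K := fun v => Nat.mod_lt _ hK0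
  have hst : ∀ v < n, hi v * K + lo v < 2 ^ w := fun v hv =>
    (startTime_lt hK0 hL0 (hU v hv)).trans_le hb3
  unfold sortByStart
  refine .seq (.fill hw n (by simp [hn]) hi (fun v hv => ?_) fun g1 hg1 => ?_)
  · simp [hK, hlog _ (hdiv v hv), hhi]
  refine .seq (.fill hw n (by simp [hn]) lo (fun v hv => by simp [hK, hlo]) fun g2 hg2 => ?_)
  refine .seq (.fill hw n (by simp [hn]) (fun v => hi v * K + lo v) (fun v hv => ?_)
    fun g3 hg3 => ?_)
  · simp [hK, hg1 v hv, hg2 v hv]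
    exact Nat.mod_eq_of_lt (hst v hv)
  refine .seq (.fill hw n (by simp [hn]) id (fun v hv => by simp) fun g4 hg4 => ?_)
  refine .seq (.assign hw K (by simp [hK]) fun g5 hg5 => ?_)
  refine .seq (.mono (countingSort_spec hw (N := n) (B := K) (H := H) (by simp [hn])
    (by simp [hg5]) hK0 (fun x hx => by simp [hg2 x hx, hlo_lt]) hb1 hH1) ?_)
  rintro M1 d1 k1 ⟨hfr1, hl1, hd1, hk1⟩
  have hl1' : ∀ v < n, M1 arrList (sortPos n lo v) = v := by
    intro v hv
    have := hl1 v hv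
    simp [hg4 v hv] at this
    rwa [sortPos_congr hg2 hv] at this
  have f0 : M1 0 = M 0 := by rw [hfr1 _ (by decide)]; simp
  have fL : M1 arrL = M arrL := by rw [hfr1 _ (by decide)]; simp
  have fB : M1 arrBlock = g1 := by rw [hfr1 _ (by decide)]; simp
  have fS : M1 arrStart = g3 := by rw [hfr1 _ (by decide)]; simp
  have hl1lt : ∀ i < n, M1 arrList i < n := by
    intro i hi
    obtain ⟨v, hv, rfl⟩ := exists_eq_of_injOn_lt (π := sortPos n lo)
      (fun x hx => sortPos_lt hx) (fun x hx y hy => sortPos_injOn hx hy) hi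
    rwa [hl1' v hv]
  refine .seq (.fill hw n (by simp [f0, hn]) (M1 arrList) (fun v hv => by simp) fun g6 hg6 => ?_)
  refine .seq (.fill hw n (by simp [f0, hn]) (fun i => hi (M1 arrList i)) (fun i hin => ?_)
    fun g7 hg7 => ?_)
  · simp [hg6 i hin, fB, hg1 _ (hl1lt i hin)]
  refine .seq (.assign hw L (by simp [fL, hL]) fun g8 hg8 => ?_)
  refine .seq (.mono (countingSort_spec hw (N := n) (B := L) (H := H) (by simp [f0, hn])
    (by simp [hg8])
    hL0 (fun x hx => by simp [hg7 x hx, hhi_lt _ (hl1lt x hx)]) hb2 hH2) ?_)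
  rintro M2 d2 k2 ⟨hfr2, hl2, hd2, hk2⟩
  have hl2' : ∀ i < n, M2 arrList (sortPos n (fun i => hi (M1 arrList i)) i) = M1 arrList i := by
    intro i hin
    have := hl2 i hin
    simp [hg6 i hin] at this
    rwa [sortPos_congr hg7 hin] at this
  have hsorted := isSortedList_of_two_passes (fun v _ => hlo_lt v) hl1' hl2'
  have g0 : M2 0 = M 0 := by rw [hfr2 _ (by decide), ← f0]; simp
  have gS : M2 arrStart = g3 := by rw [hfr2 _ (by decide), ← fS]; simp
  refine .seq (.fill hw n (by simp [g0, hn])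
    (fun i => hi (M2 arrList i) * K + lo (M2 arrList i)) (fun i hin => ?_) fun g9 hg9 => ?_)
  · simp [gS, hg3 _ (hsorted.lt i hin)]
  have hsucc : ∀ i < n, (i + 1) % 2 ^ w = i + 1 := fun i hi => Nat.mod_eq_of_lt (by omega)
  have hone : 1 % 2 ^ w = 1 := Nat.mod_eq_of_lt (by omega)
  refine .par_inj n (by simp [g0, hn])
    (fun i => i + 1 = n ∨ hi (M2 arrList (i + 1)) * K + lo (M2 arrList (i + 1)) ≠
      hi (M2 arrList i) * K + lo (M2 arrList i)) (fun i hin => ?_)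
    (fun i => hi (M2 arrList i) * K + lo (M2 arrList i)) (fun i => i + 1)
    (fun i hin _ => by simp [hg9 i hin]) (fun i hin _ => by simp [Expr.eval_const hw, hsucc i hin])
    ?_ ?_
  · by_cases h : i + 1 < n
    · simp [Expr.eval_const hw, hsucc i hin, g0, hn, h, h.ne, hg9 _ hin, hg9 _ h]
      split_ifs with h2 <;> simp [h2, hone]
    · simp [Expr.eval_const hw, hsucc i hin, g0, hn, h]
      omega
  -- Only the last position of a run writes, and by monotonicity distinct runs have distinct values;
  -- so the writes are exclusive.
  · intro i hi1 hi2 j hj1 hj2 h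
    rcases Nat.lt_trichotomy i j with hij | hij | hij
    · rcases hi2 with h2 | h2
      · omega
      · have h3 := hsorted.mono i (i + 1) (by omega) (by omega)
        have h4 := hsorted.mono (i + 1) j (by omega) hj1
        omega
    · exact hij
    · rcases hj2 with h2 | h2
      · omega
      · have h3 := hsorted.mono j (j + 1) (by omega) (by omega)
        have h4 := hsorted.mono (j + 1) i (by omega) hi1
        omega
  intro E _ hE
  refine ⟨?_, ?_, ?_, ?_, ?_, ?_⟩
  · intro b hb
    simp at hb
    rw [show M b = M1 b by rw [hfr1 b (by simp [hb])]; simp [hb]]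
    simp [hb]
    rw [hfr2 b (by simp [hb])]
    simp [hb]
  · exact hsorted
  · intro i hin h
    exact hE i hin h
  · intro i hin
    simp [hg9 i hin, startTime, hhi, hlo]
  · simp at hd1 hd2 ⊢
    omega
  · simp at hk1 hk2 ⊢
    omega

end

end PRAM

/-! ### One round of the breadth-first search -/

namespace PRAM

notation "arrTime" => (27 : ℕ)
notation "arrFront" => (28 : ℕ)
notation "arrFrontLen" => (29 : ℕ)
notation "arrPtr" => (30 : ℕ)
notation "arrClock" => (31 : ℕ)
notation "arrCount" => (32 : ℕ)
notation "arrOffset" => (33 : ℕ)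
notation "arrEdges" => (34 : ℕ)
notation "arrIndex" => (35 : ℕ)
notation "arrSlot" => (36 : ℕ)
notation "arrCandLabel" => (37 : ℕ)
notation "arrCand" => (38 : ℕ)
notation "arrSlotLabel" => (39 : ℕ)
notation "arrCands" => (40 : ℕ)
notation "arrClaim" => (41 : ℕ)

/-- `off` and `tgt` describe lists of total length `s` of numbers below `n`, one for each
`v < n`. -/
structure IsListArray (n s : ℕ) (off tgt : ℕ → ℕ) : Prop where
  zero : off 0 = 0
  le_succ : ∀ v < n, off v ≤ off (v + 1)
  last : off n = s
  tgt_lt : ∀ j < s, tgt j < n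

namespace IsListArray

variable {n s : ℕ} {off tgt : ℕ → ℕ}

theorem mono (h : IsListArray n s off tgt) {a b : ℕ} (hab : a ≤ b) (hb : b ≤ n) :
    off a ≤ off b := by
  induction b, hab using Nat.le_induction with
  | base => exact le_rfl
  | succ b hab ih => exact (ih (by omega)).trans (h.le_succ b (by omega))

theorem le_last (h : IsListArray n s off tgt) {a : ℕ} (ha : a ≤ n) : off a ≤ s :=
  h.last ▸ h.mono ha le_rfl

theorem eq_of_slot (h : IsListArray n s off tgt) {u v j : ℕ} (hu : u < n) (hv : v < n)
    (hu1 : off u ≤ j) (hu2 : j < off (u + 1)) (hv1 : off v ≤ j) (hv2 : j < off (v + 1)) :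
    u = v := by
  rcases Nat.lt_trichotomy u v with h1 | h1 | h1
  · have := h.mono (a := u + 1) (b := v) (by omega) (by omega); omega
  · exact h1
  · have := h.mono (a := v + 1) (b := u) (by omega) (by omega); omega

theorem sum_range (h : IsListArray n s off tgt) {b : ℕ} (hb : b ≤ n) (φ : ℕ → ℕ) :
    ∑ v ∈ Finset.range b, ∑ j ∈ Finset.Ico (off v) (off (v + 1)), φ j =
      ∑ j ∈ Finset.range (off b), φ j := by
  induction b with
  | zero => simp [h.zero]
  | succ b ih =>
    rw [Finset.sum_range_succ, ih (by omega),
      Finset.sum_range_add_sum_Ico _ (h.le_succ b (by omega))]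

theorem sum_length (h : IsListArray n s off tgt) :
    ∑ v ∈ Finset.range n, (off (v + 1) - off v) = s := by
  have := h.sum_range le_rfl fun _ => 1
  simpa [h.last] using this

theorem sum_length_le (h : IsListArray n s off tgt) {f : ℕ} {F : ℕ → ℕ} (hF : ∀ i < f, F i < n)
    (hinj : ∀ i < f, ∀ j < f, F i = F j → i = j) :
    ∑ i ∈ Finset.range f, (off (F i + 1) - off (F i)) ≤ s := by
  rw [← h.sum_length, ← Finset.sum_image (s := Finset.range f) (g := F)
    (f := fun v => off (v + 1) - off v)]
  · refine Finset.sum_le_sum_of_subset fun v hv => ?_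
    obtain ⟨i, hi, rfl⟩ := Finset.mem_image.1 hv
    simpa using hF i (by simpa using hi)
  · intro i hi j hj
    exact hinj i (by simpa using hi) j (by simpa using hj)

end IsListArray

/-- Let the half-open intervals from `o i` to `o (i + 1)`, for `i < f`, be nonempty. Counting their
left ends up to `z` gives the index of the interval that contains `z`. -/
theorem sum_leftEnds {f : ℕ} {o flag : ℕ → ℕ} (ho : ∀ i < f, o i < o (i + 1))
    (hflag : ∀ z < o f, flag z = if ∃ i < f, o i = z then 1 else 0) {i z : ℕ} (hi : i < f)
    (h1 : o i ≤ z) (h2 : z < o (i + 1)) :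
    ∑ y ∈ Finset.range (z + 1), flag y = i + 1 := by
  have hmono : ∀ a b, a < b → b ≤ f → o a < o b := by
    intro a b hab
    induction b, hab using Nat.le_induction with
    | base => intro hb; exact ho a (by omega)
    | succ b hab ih => intro hb; exact (ih (by omega)).trans (ho b (by omega))
  have hmono' : ∀ a b, a ≤ b → b ≤ f → o a ≤ o b := fun a b hab hb => by
    rcases Nat.eq_or_lt_of_le hab with rfl | hab
    · exact le_rfl
    · exact (hmono a b hab hb).le
  have hz : z < o f := h2.trans_le (hmono' _ _ hi le_rfl)
  have : ∑ y ∈ Finset.range (z + 1), flag y =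
      ((Finset.range (z + 1)).filter fun y => ∃ i < f, o i = y).card := by
    rw [Finset.card_filter]
    exact Finset.sum_congr rfl fun y hy => hflag y (by have := Finset.mem_range.1 hy; omega)
  rw [this, show (Finset.range (z + 1)).filter (fun y => ∃ i < f, o i = y) =
    (Finset.range (i + 1)).image o from ?_, Finset.card_image_of_injOn, Finset.card_range]
  · intro a ha b hb hab
    simp at ha hb
    rcases Nat.lt_trichotomy a b with h | h | h
    · exact absurd hab (hmono a b h (by omega)).ne
    · exact h
    · exact absurd hab (hmono b a h (by omega)).ne'
  · ext y
    simp only [Finset.mem_filter, Finset.mem_range, Finset.mem_image]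
    constructor
    · rintro ⟨hy, k, hk, rfl⟩
      refine ⟨k, ?_, rfl⟩
      by_contra hki
      have := hmono' (i + 1) k (by omega) hk.le
      omega
    · rintro ⟨k, hk, rfl⟩
      have := hmono' k i (by omega) hi.le
      exact ⟨by omega, k, by omega, rfl⟩

theorem exists_interval {f : ℕ} {o : ℕ → ℕ} (h0 : o 0 = 0) {z : ℕ} (hz : z < o f) :
    ∃ i < f, o i ≤ z ∧ z < o (i + 1) := by
  induction f with
  | zero => omega
  | succ f ih =>
    rcases Nat.lt_or_ge z (o f) with h | h
    · obtain ⟨i, hi, hi'⟩ := ih h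
      exact ⟨i, by omega, hi'⟩
    · exact ⟨f, by omega, h, hz⟩

section

variable {w : ℕ} {β : ℝ} {ρ : Resolver}

open PRAM.Expr in
/-- Lists the neighbours of the vertices of the frontier, with the labels they would get, and
stores in every slot of a vertex of the frontier the label of that vertex. -/
def expand : Cmd :=
  .fill (var arrFrontLen) arrIn
    (read 1 (read arrFront pid + const 1) - read 1 (read arrFront pid)) ;;
  .assign arrLen (var arrFrontLen) ;;
  scan ;;
  .fill (var arrFrontLen) arrOffset (read arrPre pid) ;;
  .assign arrEdges (var arrTot) ;;
  .fill (var arrEdges) arrIn (const 0) ;;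
  .par (var arrFrontLen) (const 1) arrIn (read arrOffset pid) (const 1) ;;
  .assign arrLen (var arrEdges) ;;
  scan ;;
  .fill (var arrEdges) arrIndex ((read arrPre pid + read arrIn pid) - const 1) ;;
  .fill (var arrEdges) arrSlot (read 1 (read arrFront (read arrIndex pid)) +
    (pid - read arrOffset (read arrIndex pid))) ;;
  .fill (var arrEdges) arrCandLabel (read 3 (read arrFront (read arrIndex pid))) ;;
  .fill (var arrEdges) arrCand (read 2 (read arrSlot pid)) ;;
  .par (var arrEdges) (const 1) arrSlotLabel (read arrSlot pid) (read arrCandLabel pid)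

/-- To spend work proportional to the number `e` of slots, the lists of the frontier are laid end to
end: one scan yields their offsets, and a second scan over marks at the left ends tells each
processor which list it is in. The lists must be nonempty (`hdeg`), as otherwise left ends would
coincide. The label stored in each slot allows the cut to be counted later without searching for the
owner of a slot. -/
theorem expand_spec (hw : 20 ≤ w) {M : Memory} {n s f : ℕ} (hadj : IsListArray n s (M 1) (M 2))
    (hf : M arrFrontLen 0 = f) (hF : ∀ i < f, M arrFront i < n)
    (hinj : ∀ i < f, ∀ j < f, M arrFront i = M arrFront j → i = j)
    (hdeg : ∀ i < f, M 1 (M arrFront i) < M 1 (M arrFront i + 1))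
    (hb : 16 * (n + s) + 16 ≤ 2 ^ w) {H : ℕ} (hH : n + s ≤ 2 ^ H) :
    Ensures w β ρ expand M fun M' d k =>
      (∀ b, b ∉ [arrIn, arrLen, arrTree, arrDown, arrPow, arrTot, arrPre, arrOffset, arrEdges,
        arrIndex, arrSlot, arrCandLabel, arrCand, arrSlotLabel] → M' b = M b) ∧
      ∃ e, M' arrEdges 0 = e ∧
      e = ∑ i ∈ Finset.range f, (M 1 (M arrFront i + 1) - M 1 (M arrFront i)) ∧
      (∀ z < e, ∃ i < f, ∃ j, M 1 (M arrFront i) ≤ j ∧ j < M 1 (M arrFront i + 1) ∧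
        M' arrCand z = M 2 j ∧ M' arrCandLabel z = M 3 (M arrFront i)) ∧
      (∀ i < f, ∀ j, M 1 (M arrFront i) ≤ j → j < M 1 (M arrFront i + 1) →
        ∃ z < e, M' arrCand z = M 2 j) ∧
      (∀ i < f, ∀ j, M 1 (M arrFront i) ≤ j → j < M 1 (M arrFront i + 1) →
        M' arrSlotLabel j = M 3 (M arrFront i)) ∧
      (∀ j, (∀ i < f, M 1 (M arrFront i) ≤ j → ¬ j < M 1 (M arrFront i + 1)) →
        M' arrSlotLabel j = M arrSlotLabel j) ∧
      d ≤ 400 * (H + 1) + 200 ∧ k ≤ 2500 * (f + e + 1) := by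
  set F := M arrFront with hFdef
  set off := M 1 with hoff
  set dg : ℕ → ℕ := fun i => off (F i + 1) - off (F i) with hdg
  set o : ℕ → ℕ := fun i => ∑ i' ∈ Finset.range i, dg i' with ho
  have hfn : f ≤ n := by
    have := Finset.card_le_card_of_injOn (s := Finset.range f) (t := Finset.range n) F
      (fun i hi => by simpa using hF i (by simpa using hi))
      (fun i hi j hj => hinj i (by simpa using hi) j (by simpa using hj))
    simpa using this
  have hes : o f ≤ s := hadj.sum_length_le hF hinj
  have o_succ : ∀ i, o (i + 1) = o i + dg i := fun i => Finset.sum_range_succ _ _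
  have o_lt : ∀ i < f, o i < o (i + 1) := fun i hi => by
    rw [o_succ]
    have := hdeg i hi
    simp only [hdg]
    omega
  have o_mono : Monotone o := monotone_nat_of_le_succ fun i => by rw [o_succ]; omega
  have o_le : ∀ i ≤ f, o i ≤ o f := fun i hi => o_mono hi
  have o_inj : ∀ i < f, ∀ j < f, o i = o j → i = j := by
    intro i hi j hj h
    rcases Nat.lt_trichotomy i j with h1 | h1 | h1
    · have := o_lt i hi; have := o_mono (show i + 1 ≤ j from h1); omega
    · exact h1
    · have := o_lt j hj; have := o_mono (show j + 1 ≤ i from h1); omega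
  have hFs : ∀ i < f, (F i + 1) % 2 ^ w = F i + 1 := fun i hi => by
    have := hF i hi
    exact Nat.mod_eq_of_lt (by omega)
  unfold expand
  refine .seq (.fill hw f (by simp [hf]) dg (fun i hi => ?_) fun g1 hg1 => ?_)
  · simp [Expr.eval_const hw, ← hFdef, ← hoff, hFs i hi, hdg]
  refine .seq (.assign hw f (by simp [hf]) fun g2 hg2 => ?_)
  have hsum1 : ∀ i ≤ f, ∑ x ∈ Finset.range i, g1 x = o i := fun i hi =>
    Finset.sum_congr rfl fun x hx => hg1 x (by have := Finset.mem_range.1 hx; omega)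
  refine .seq (.mono (scan_spec hw (len := f) (H := H) (by simp [hg2]) (by omega) ?_ (by omega)) ?_)
  · simp [hsum1 f le_rfl]; omega
  rintro M1 d1 k1 ⟨hfr1, hpre1, htot1, hd1, hk1⟩
  simp at hpre1 htot1
  rw [hsum1 f le_rfl] at htot1
  have f1 : M1 1 = off := by rw [hfr1 _ (by decide)]; simp [hoff]
  have f2 : M1 2 = M 2 := by rw [hfr1 _ (by decide)]; simp
  have f3 : M1 3 = M 3 := by rw [hfr1 _ (by decide)]; simp
  have fF : M1 arrFront = F := by rw [hfr1 _ (by decide)]; simp [hFdef]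
  have ff : M1 arrFrontLen 0 = f := by rw [hfr1 _ (by decide)]; simp [hf]
  refine .seq (.fill hw f (by simp [ff]) o (fun i hi => ?_) fun g3 hg3 => ?_)
  · simp [hpre1 i hi, hsum1 i hi.le]
  refine .seq (.assign hw (o f) (by simp [htot1]) fun g4 hg4 => ?_)
  refine .seq (.fill hw (o f) (by simp [hg4]) (fun _ => 0) (fun _ _ => by
    simp [Expr.eval_const hw]) fun g5 hg5 => ?_)
  refine .seq (.par_inj f (by simp [ff]) (fun _ => True) (by simp [Expr.eval_const hw]) o
    (fun _ => 1) (fun i hi _ => by simp [hg3 i hi]) (fun i hi _ => by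
    simp [Expr.eval_const hw]) (fun i hi _ j hj _ => o_inj i hi j hj) fun g6 hg6 hg6' => ?_)
  have hflag : ∀ z < o f, g6 z = if ∃ i < f, o i = z then 1 else 0 := by
    intro z hz
    split_ifs with h
    · obtain ⟨i, hi, rfl⟩ := h
      exact hg6' i hi trivial
    · push Not at h
      rw [hg6 z fun p hp _ => h p hp]
      simp [hg5 z hz]
  have hflagsum : ∑ z ∈ Finset.range (o f), g6 z ≤ o f := by
    refine (Finset.sum_le_card_nsmul _ _ 1 fun z hz => ?_).trans (by simp)
    rw [hflag z (by simpa using hz)]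
    split_ifs <;> simp
  refine .seq (.assign hw (o f) (by simp [hg4]) fun g7 hg7 => ?_)
  refine .seq (.mono (scan_spec hw (len := o f) (H := H) (by simp [hg7]) (by omega) ?_
    (by omega)) ?_)
  · simp; omega
  rintro M2 d2 k2 ⟨hfr2, hpre2, -, hd2, hk2⟩
  simp at hpre2
  have e1 : M2 1 = off := by rw [hfr2 _ (by decide)]; simp [f1]
  have e2 : M2 2 = M 2 := by rw [hfr2 _ (by decide)]; simp [f2]
  have e3 : M2 3 = M 3 := by rw [hfr2 _ (by decide)]; simp [f3]
  have eF : M2 arrFront = F := by rw [hfr2 _ (by decide)]; simp [fF]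
  have eI : M2 arrIn = g6 := by rw [hfr2 _ (by decide)]; simp
  have eO : M2 arrOffset = g3 := by rw [hfr2 _ (by decide)]; simp
  have eE : M2 arrEdges = g4 := by rw [hfr2 _ (by decide)]; simp
  have eS : M2 arrSlotLabel = M arrSlotLabel := by
    rw [hfr2 _ (by decide)]; simp; rw [hfr1 _ (by decide)]; simp
  have hidx : ∀ z < o f, ∃ i < f, o i ≤ z ∧ z < o (i + 1) := fun z hz =>
    exists_interval (by simp [ho]) hz
  choose! ix hix1 hix2 hix3 using hidx
  refine .seq (.fill hw (o f) (by simp [eE, hg4]) ix (fun z hz => ?_) fun g8 hg8 => ?_)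
  -- The inclusive count of left ends is the index plus one. The scan is exclusive, so the program
  -- adds the processor's own mark and subtracts one.
  · have h1 := sum_leftEnds o_lt hflag (hix1 z hz) (hix2 z hz) (hix3 z hz)
    rw [Finset.sum_range_succ] at h1
    have h2 := hix1 z hz
    simp [Expr.eval_const hw, hpre2 z hz, eI, h1]
    rw [Nat.mod_eq_of_lt (by omega)]
    omega
  have hslot : ∀ z < o f, off (F (ix z)) ≤ off (F (ix z)) + (z - o (ix z)) ∧
      off (F (ix z)) + (z - o (ix z)) < off (F (ix z) + 1) := by
    intro z hz
    have h1 := hix3 z hz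
    have h2 := hix2 z hz
    rw [o_succ] at h1
    simp only [hdg] at h1
    omega
  refine .seq (.fill hw (o f) (by simp [eE, hg4]) (fun z => off (F (ix z)) + (z - o (ix z)))
    (fun z hz => ?_) fun g9 hg9 => ?_)
  · simp [hg8 z hz, e1, eF, eO, hg3 _ (hix1 z hz)]
    have h1 := (hslot z hz).2
    have h2 := hadj.le_last (show F (ix z) + 1 ≤ n from hF _ (hix1 z hz))
    exact Nat.mod_eq_of_lt (by omega)
  refine .seq (.fill hw (o f) (by simp [eE, hg4]) (fun z => M 3 (F (ix z)))
    (fun z hz => by simp [hg8 z hz, eF, e3]) fun g10 hg10 => ?_)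
  refine .seq (.fill hw (o f) (by simp [eE, hg4])
    (fun z => M 2 (off (F (ix z)) + (z - o (ix z))))
    (fun z hz => by simp [hg9 z hz, e2]) fun g11 hg11 => ?_)
  refine .par (o f) (by simp [eE, hg4]) (fun _ => True) (by simp [Expr.eval_const hw])
    (fun z => off (F (ix z)) + (z - o (ix z))) (fun z => M 3 (F (ix z)))
    (fun z hz _ => by simp [hg9 z hz]) (fun z hz _ => by simp [hg10 z hz]) fun g12 hg12 hg12' => ?_
  have hcover : ∀ i < f, ∀ j, off (F i) ≤ j → j < off (F i + 1) →
      ∃ z < o f, ix z = i ∧ off (F (ix z)) + (z - o (ix z)) = j := by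
    intro i hi j h1 h2
    have h3 : o i + (j - off (F i)) < o (i + 1) := by
      rw [o_succ]; simp only [hdg]; omega
    have h4 : o (i + 1) ≤ o f := o_mono hi
    have h5 : o i + (j - off (F i)) < o f := by omega
    have h6 : ix (o i + (j - off (F i))) = i := by
      have a1 := hix2 _ h5
      have a2 := hix3 _ h5
      rcases Nat.lt_trichotomy (ix (o i + (j - off (F i)))) i with h | h | h
      · have := o_mono (show _ + 1 ≤ i from h); omega
      · exact h
      · have := o_mono (show i + 1 ≤ _ from h); omega
    exact ⟨_, h5, h6, by rw [h6]; omega⟩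
  refine ⟨?_, o f, by simp [eE, hg4], rfl, ?_, ?_, ?_, ?_, ?_, ?_⟩
  · intro b hb
    simp at hb
    simp [hb]
    rw [hfr2 b (by simp [hb])]
    simp [hb]
    rw [hfr1 b (by simp [hb])]
    simp [hb]
  · intro z hz
    exact ⟨ix z, hix1 z hz, _, (hslot z hz).1, (hslot z hz).2, by simp [hg11 z hz],
      by simp [hg10 z hz]⟩
  · intro i hi j h1 h2
    obtain ⟨z, hz, -, rfl⟩ := hcover i hi j h1 h2
    exact ⟨z, hz, by simp [hg11 z hz]⟩
  · intro i hi j h1 h2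
    obtain ⟨z, hz, h3, rfl⟩ := hcover i hi j h1 h2
    -- The winning writer `q` may be unknown: a slot has a single owner, so every writer to it
    -- writes the same label.
    obtain ⟨q, hq, -, h4, h5⟩ := hg12' z hz trivial
    have h6 := hslot q hq
    rw [h4] at h6
    have h7 := hadj.eq_of_slot (hF _ (hix1 q hq)) (hF _ (hix1 z hz)) h6.1 h6.2 (hslot z hz).1
      (hslot z hz).2
    simp only [Function.update_self]
    rw [h5, h7, h3]
  · intro j hj
    simp only [Function.update_self]
    rw [hg12 j]
    · simp [eS]
    · rintro z hz - rfl
      exact hj _ (hix1 z hz) (hslot z hz).1 (hslot z hz).2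
  · simp at hd1 hd2 ⊢
    omega
  · simp at hk1 hk2 ⊢
    omega

end

end PRAM

/-! ### The invariant of the breadth-first search -/

namespace PRAM

/-- The result of a breadth-first search in which vertex `v` may start on its own at time `st v`:
`T v` is the time at which `v` is reached, and `lab v - 1` the vertex from which it is reached. -/
structure IsClustering (n : ℕ) (off tgt st lab T : ℕ → ℕ) : Prop where
  time_le : ∀ v < n, T v ≤ st v
  time_step : ∀ v < n, ∀ j, off v ≤ j → j < off (v + 1) → T (tgt j) ≤ T v + 1
  origin : ∀ v < n, (lab v = v + 1 ∧ T v = st v) ∨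
    ∃ u < n, ∃ j, off u ≤ j ∧ j < off (u + 1) ∧ tgt j = v ∧ lab u = lab v ∧ T v = T u + 1

/-- The state of the search before time `t`: the vertices with nonzero labels have been reached, those
reached last that have neighbours are listed in `F`, and `ptr` many entries of `list` have been
started. `SL` holds, for every slot of the other reached vertices, the label of its owner. -/
structure SearchState (n : ℕ) (off tgt st list lab T F SL : ℕ → ℕ) (f ptr t : ℕ) : Prop where
  ptr_le : ptr ≤ n
  front_lt : ∀ i < f, F i < n
  front_inj : ∀ i < f, ∀ j < f, F i = F j → i = j
  front_spec : ∀ i < f, lab (F i) ≠ 0 ∧ T (F i) + 1 = t ∧ off (F i) < off (F i + 1)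
  front_surj : ∀ v < n, lab v ≠ 0 → T v + 1 = t → off v < off (v + 1) → ∃ i < f, F i = v
  time_lt : ∀ v < n, lab v ≠ 0 → T v < t
  time_le : ∀ v < n, lab v ≠ 0 → T v ≤ st v
  started : ∀ i < ptr, lab (list i) ≠ 0
  pending : ∀ i, ptr ≤ i → i < n → t ≤ st (list i)
  origin : ∀ v < n, lab v ≠ 0 → (lab v = v + 1 ∧ T v = st v) ∨
    ∃ u < n, ∃ j, off u ≤ j ∧ j < off (u + 1) ∧ tgt j = v ∧ lab u = lab v ∧ T v = T u + 1
  closed : ∀ v < n, lab v ≠ 0 → T v + 1 < t → ∀ j, off v ≤ j → j < off (v + 1) →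
    lab (tgt j) ≠ 0 ∧ T (tgt j) ≤ T v + 1 ∧ SL j = lab v

/-- The work that a search still has to do. -/
def remaining (n : ℕ) (off lab T : ℕ → ℕ) (ptr t : ℕ) : ℕ :=
  ∑ v ∈ Finset.range n, (if lab v = 0 ∨ T v + 1 = t then 1 + (off (v + 1) - off v) else 0) +
    (n - ptr)

/-- The vertices that could be reached next. -/
def IsCandidate (off tgt list F : ℕ → ℕ) (f ptr cnt v : ℕ) : Prop :=
  (∃ i < f, ∃ j, off (F i) ≤ j ∧ j < off (F i + 1) ∧ tgt j = v) ∨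
    ∃ i, ptr ≤ i ∧ i < ptr + cnt ∧ list i = v

/-! ### Preservation of the search invariant and decrease of the potential. -/

namespace SearchState

variable {n s : ℕ} {off tgt st list lab T F SL : ℕ → ℕ} {f ptr t : ℕ}

theorem at_start (hlab : ∀ v < n, lab v = 0) :
    SearchState n off tgt st list lab T F SL 0 0 0 where
  ptr_le := Nat.zero_le _
  front_lt := by simp
  front_inj := by simp
  front_spec := by simp
  front_surj := fun v hv h => absurd (hlab v hv) h
  time_lt := fun v hv h => absurd (hlab v hv) h
  time_le := fun v hv h => absurd (hlab v hv) h
  started := by simp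
  pending := by simp
  origin := fun v hv h => absurd (hlab v hv) h
  closed := fun v hv h => absurd (hlab v hv) h

theorem remaining_at_start (h : IsListArray n s off tgt) : remaining n off lab T ptr t ≤ 2 * n + s := by
  unfold remaining
  have : ∑ v ∈ Finset.range n,
      (if lab v = 0 ∨ T v + 1 = t then 1 + (off (v + 1) - off v) else 0) ≤
      ∑ v ∈ Finset.range n, (1 + (off (v + 1) - off v)) :=
    Finset.sum_le_sum fun v _ => by split_ifs <;> omega
  rw [Finset.sum_add_distrib, h.sum_length] at this
  simp at this
  omega

/-- With an empty frontier nothing happens before the next start. The field `closed` survives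
because a vertex with neighbours that was reached at time `t - 1` would be in the frontier. -/
theorem jump (h : SearchState n off tgt st list lab T F SL 0 ptr t) (hs : IsSortedList n st list)
    (hptr : ptr < n) : SearchState n off tgt st list lab T F SL 0 ptr (st (list ptr)) := by
  have ht := h.pending ptr le_rfl hptr
  refine { h with
    front_spec := by simp
    front_surj := fun v hv h1 h2 h3 => h.front_surj v hv h1 ?_ h3
    time_lt := fun v hv h1 => (h.time_lt v hv h1).trans_le ht
    pending := fun i h1 h2 => hs.mono ptr i h1 h2
    closed := fun v hv h1 h2 j h3 h4 => ?_ }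
  · have := h.time_lt v hv h1; omega
  · have h5 := h.time_lt v hv h1
    rcases Nat.lt_or_ge (T v + 1) t with h6 | h6
    · exact h.closed v hv h1 h6 j h3 h4
    · obtain ⟨i, hi, -⟩ := h.front_surj v hv h1 (by omega) (by omega)
      omega

theorem remaining_jump (h : SearchState n off tgt st list lab T F SL 0 ptr t) (hptr : ptr < n) :
    remaining n off lab T ptr (st (list ptr)) ≤ remaining n off lab T ptr t := by
  have ht := h.pending ptr le_rfl hptr
  unfold remaining
  gcongr ?_ + _
  refine Finset.sum_le_sum fun v hv => ?_
  by_cases h0 : lab v = 0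
  · simp [h0]
  · have := h.time_lt v (by simpa using hv) h0
    by_cases h1 : T v + 1 = st (list ptr)
    · rw [if_pos (.inr h1), if_pos (.inr (by omega))]
    · simp [h0, h1]

/-- A vertex of the frontier was reached at time `t - 1`, no later than its own start. This bounds
the clock, and with it the number of rounds. -/
theorem le_of_front (h : SearchState n off tgt st list lab T F SL f ptr t) (hf : 0 < f) {B : ℕ}
    (hB : ∀ v < n, st v < B) : t ≤ B := by
  obtain ⟨h1, h2, -⟩ := h.front_spec 0 hf
  have h3 := h.front_lt 0 hf
  have h4 := h.time_le _ h3 h1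
  have h5 := hB _ h3
  omega

section

variable {lab' T' F' SL' : ℕ → ℕ} {f' cnt : ℕ}

/-- Every vertex that is new in this round gets the time `t`, whether a wave arrives or it starts by
itself, and whichever of its possible labels wins. The hypotheses on `lab'` leave that choice open,
so the invariant does not depend on the resolution of concurrent writes. -/
theorem next (h : SearchState n off tgt st list lab T F SL f ptr t)
    (hadj : IsListArray n s off tgt) (hs : IsSortedList n st list) (hcnt : ptr + cnt ≤ n)
    (hlate : ∀ i, ptr + cnt ≤ i → i < n → t < st (list i))
    (hlab : ∀ v, (lab v = 0 ∧ T' v = t ∧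
        ((∃ i < f, ∃ j, off (F i) ≤ j ∧ j < off (F i + 1) ∧ tgt j = v ∧ lab' v = lab (F i)) ∨
          (st v = t ∧ lab' v = v + 1))) ∨
      ((lab v ≠ 0 ∨ ¬ IsCandidate off tgt list F f ptr cnt v) ∧ lab' v = lab v ∧ T' v = T v))
    (hF' : ∀ i < f', lab (F' i) = 0 ∧ IsCandidate off tgt list F f ptr cnt (F' i) ∧
      off (F' i) < off (F' i + 1))
    (hinj : ∀ i < f', ∀ j < f', F' i = F' j → i = j)
    (hsurj : ∀ v, lab v = 0 → IsCandidate off tgt list F f ptr cnt v → off v < off (v + 1) →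
      ∃ i < f', F' i = v)
    (hSL : ∀ i < f, ∀ j, off (F i) ≤ j → j < off (F i + 1) → SL' j = lab (F i))
    (hSL' : ∀ j, (∀ i < f, off (F i) ≤ j → ¬ j < off (F i + 1)) → SL' j = SL j) :
    SearchState n off tgt st list lab' T' F' SL' f' (ptr + cnt) (t + 1) := by
  have hcand : ∀ v, IsCandidate off tgt list F f ptr cnt v → v < n := by
    rintro v (⟨i, hi, j, h1, h2, rfl⟩ | ⟨i, h1, h2, rfl⟩)
    · exact hadj.tgt_lt j (h2.trans_le (hadj.le_last (h.front_lt i hi)))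
    · exact hs.lt i (by omega)
  -- reached vertices keep their labels and times, candidates are reached
  have hold : ∀ v, lab v ≠ 0 → lab' v = lab v ∧ T' v = T v := fun v hv => by
    rcases hlab v with ⟨h1, -⟩ | ⟨-, h1⟩
    · exact absurd h1 hv
    · exact h1
  have hnew : ∀ v, lab' v ≠ 0 → lab v = 0 → T' v = t ∧
      ((∃ i < f, ∃ j, off (F i) ≤ j ∧ j < off (F i + 1) ∧ tgt j = v ∧ lab' v = lab (F i)) ∨
          (st v = t ∧ lab' v = v + 1)) := fun v h1 h2 => by
    rcases hlab v with ⟨-, h3⟩ | ⟨-, h3, -⟩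
    · exact h3
    · rw [h3] at h1; exact absurd h2 h1
  have hreach : ∀ v, lab v = 0 → IsCandidate off tgt list F f ptr cnt v →
      lab' v ≠ 0 ∧ T' v = t := fun v h1 h2 => by
    rcases hlab v with ⟨-, h3, ⟨i, hi, j, -, -, -, h4⟩ | ⟨-, h4⟩⟩ | ⟨h3 | h3, -⟩
    · exact ⟨by rw [h4]; exact (h.front_spec i hi).1, h3⟩
    · exact ⟨by rw [h4]; omega, h3⟩
    · exact absurd h1 h3
    · exact absurd h2 h3
  have hlab0 : ∀ v, lab v ≠ 0 → lab' v ≠ 0 := fun v hv => by rw [(hold v hv).1]; exact hv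
  constructor
  · exact hcnt
  · exact fun i hi => hcand _ (hF' i hi).2.1
  · exact hinj
  · intro i hi
    obtain ⟨h1, h2, h3⟩ := hF' i hi
    obtain ⟨h4, h5⟩ := hreach _ h1 h2
    exact ⟨h4, by omega, h3⟩
  · intro v hv h1 h2 h3
    by_cases h0 : lab v = 0
    · refine hsurj v h0 ?_ h3
      by_contra hc
      rcases hlab v with ⟨-, -, ⟨i, hi, j, h4, h5, h6, -⟩ | ⟨h4, -⟩⟩ | ⟨-, h4, -⟩
      · exact hc (.inl ⟨i, hi, j, h4, h5, h6⟩)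
      · obtain ⟨i, hi, rfl⟩ := hs.surj v hv
        rcases Nat.lt_or_ge i ptr with h5 | h5
        · exact h.started i h5 h0
        · rcases Nat.lt_or_ge i (ptr + cnt) with h6 | h6
          · exact hc (.inr ⟨i, h5, h6, rfl⟩)
          · have := hlate i h6 hi; omega
      · exact h1 (h4.trans h0)
    · have h4 := h.time_lt v hv h0
      rw [(hold v h0).2] at h2
      omega
  · intro v hv h1
    by_cases h0 : lab v = 0
    · rw [(hnew v h1 h0).1]; omega
    · rw [(hold v h0).2]
      have := h.time_lt v hv h0
      omega
  · intro v hv h1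
    by_cases h0 : lab v = 0
    · rw [(hnew v h1 h0).1]
      obtain ⟨i, hi, rfl⟩ := hs.surj v hv
      exact h.pending i (not_lt.1 fun h5 => h.started i h5 h0) hi
    · rw [(hold v h0).2]
      exact h.time_le v hv h0
  · intro i hi
    rcases Nat.lt_or_ge i ptr with h5 | h5
    · exact hlab0 _ (h.started i h5)
    · by_cases h0 : lab (list i) = 0
      · exact (hreach _ h0 (.inr ⟨i, h5, hi, rfl⟩)).1
      · exact hlab0 _ h0
  · exact hlate
  · intro v hv h1
    by_cases h0 : lab v = 0
    · obtain ⟨h2, ⟨i, hi, j, h3, h4, h5, h6⟩ | ⟨h3, h4⟩⟩ := hnew v h1 h0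
      · obtain ⟨h7, h8, -⟩ := h.front_spec i hi
        obtain ⟨h9, h10⟩ := hold _ h7
        exact .inr ⟨F i, h.front_lt i hi, j, h3, h4, h5, by rw [h9, h6], by omega⟩
      · exact .inl ⟨h4, by omega⟩
    · rw [(hold v h0).1, (hold v h0).2]
      rcases h.origin v hv h0 with h2 | ⟨u, hu, j, h3, h4, h5, h6, h7⟩
      · exact .inl h2
      · have h8 : lab u ≠ 0 := by rw [h6]; exact h0
        exact .inr ⟨u, hu, j, h3, h4, h5, by rw [(hold u h8).1, h6], by rw [(hold u h8).2, h7]⟩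
  · intro v hv h1 h2 j h3 h4
    have h0 : lab v ≠ 0 := fun h0 => by
      have := (hnew v h1 h0).1
      omega
    rw [(hold v h0).1, (hold v h0).2]
    rw [(hold v h0).2] at h2
    -- Either `v` was expanded earlier, and its slots, having only one owner, are not overwritten;
    -- or `v` is in the current frontier, and all its neighbours are candidates.
    rcases Nat.lt_or_ge (T v + 1) t with h5 | h5
    · obtain ⟨h6, h7, h8⟩ := h.closed v hv h0 h5 j h3 h4
      refine ⟨hlab0 _ h6, by rwa [(hold _ h6).2], ?_⟩
      rw [hSL' j ?_, h8]
      intro i hi h9 h10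
      have := hadj.eq_of_slot hv (h.front_lt i hi) h3 h4 h9 h10
      subst this
      have := (h.front_spec i hi).2.1
      omega
    · obtain ⟨i, hi, rfl⟩ := h.front_surj v hv h0 (by omega) (by omega)
      have hc : IsCandidate off tgt list F f ptr cnt (tgt j) := .inl ⟨i, hi, j, h3, h4, rfl⟩
      by_cases h6 : lab (tgt j) = 0
      · obtain ⟨h7, h8⟩ := hreach _ h6 hc
        exact ⟨h7, by omega, hSL i hi j h3 h4⟩
      · have h7 := h.time_lt _ (hcand _ hc) h6
        refine ⟨hlab0 _ h6, ?_, hSL i hi j h3 h4⟩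
        rw [(hold _ h6).2]
        omega

/-- A vertex carries the charge `1 + degree` while it is unlabelled or in the frontier. The present
frontier loses its charge for good, newly reached vertices at most keep theirs, and `n - ptr` pays
for the starts. -/
theorem remaining_next (h : SearchState n off tgt st list lab T F SL f ptr t)
    (hcnt : ptr + cnt ≤ n)
    (hlab : ∀ v, (lab v = 0 ∧ T' v = t ∧
        ((∃ i < f, ∃ j, off (F i) ≤ j ∧ j < off (F i + 1) ∧ tgt j = v ∧ lab' v = lab (F i)) ∨
          (st v = t ∧ lab' v = v + 1))) ∨
      ((lab v ≠ 0 ∨ ¬ IsCandidate off tgt list F f ptr cnt v) ∧ lab' v = lab v ∧ T' v = T v)) :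
    remaining n off lab' T' (ptr + cnt) (t + 1) +
      (f + ∑ i ∈ Finset.range f, (off (F i + 1) - off (F i)) + cnt) ≤
    remaining n off lab T ptr t := by
  classical
  have h1 : f + ∑ i ∈ Finset.range f, (off (F i + 1) - off (F i)) =
      ∑ v ∈ Finset.range n,
        (if v ∈ (Finset.range f).image F then 1 + (off (v + 1) - off v) else 0) := by
    rw [Finset.sum_ite_mem, Finset.inter_eq_right.2, Finset.sum_image, Finset.sum_add_distrib]
    · simp
    · intro i hi j hj
      exact h.front_inj i (by simpa using hi) j (by simpa using hj)
    · intro v hv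
      obtain ⟨i, hi, rfl⟩ := Finset.mem_image.1 hv
      simpa using h.front_lt i (by simpa using hi)
  have h2 : ∀ v ∈ Finset.range n,
      (if lab' v = 0 ∨ T' v + 1 = t + 1 then 1 + (off (v + 1) - off v) else 0) +
      (if v ∈ (Finset.range f).image F then 1 + (off (v + 1) - off v) else 0) ≤
      if lab v = 0 ∨ T v + 1 = t then 1 + (off (v + 1) - off v) else 0 := by
    intro v hv
    have hv := Finset.mem_range.1 hv
    by_cases h0 : lab v = 0
    · rw [if_neg (c := v ∈ (Finset.range f).image F)]
      · simp only [h0, true_or, if_true]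
        split_ifs <;> omega
      · intro hm
        obtain ⟨i, hi, rfl⟩ := Finset.mem_image.1 hm
        exact (h.front_spec i (by simpa using hi)).1 h0
    · have h3 := h.time_lt v hv h0
      have h4 : lab' v = lab v ∧ T' v = T v := by
        rcases hlab v with ⟨h1, -⟩ | ⟨-, h1⟩
        · exact absurd h1 h0
        · exact h1
      rw [h4.1, h4.2, if_neg (by omega)]
      by_cases hm : v ∈ (Finset.range f).image F
      · obtain ⟨i, hi, rfl⟩ := Finset.mem_image.1 hm
        have := (h.front_spec i (by simpa using hi)).2.1
        rw [if_pos hm, if_pos (.inr this), zero_add]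
      · rw [if_neg hm]
        omega
  have h3 := Finset.sum_le_sum h2
  rw [Finset.sum_add_distrib, ← h1] at h3
  unfold remaining
  omega

end

/-- All entries of `list` have been started, hence all vertices are labelled. A vertex with a slot
cannot have been reached in the last round, since the frontier is empty; so `closed` applies to it.
-/
theorem isClustering (h : SearchState n off tgt st list lab T F SL 0 n t)
    (hs : IsSortedList n st list) :
    IsClustering n off tgt st lab T ∧
      (∀ v < n, ∀ j, off v ≤ j → j < off (v + 1) → SL j = lab v) := by
  have h0 : ∀ v < n, lab v ≠ 0 := fun v hv => by
    obtain ⟨i, hi, rfl⟩ := hs.surj v hv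
    exact h.started i hi
  have h1 : ∀ v < n, ∀ j, off v ≤ j → j < off (v + 1) → T v + 1 < t := by
    intro v hv j hj hj'
    have h2 := h.time_lt v hv (h0 v hv)
    by_contra h3
    obtain ⟨i, hi, -⟩ := h.front_surj v hv (h0 v hv) (by omega) (by omega)
    omega
  exact ⟨⟨fun v hv => h.time_le v hv (h0 v hv),
    fun v hv j hj hj' => (h.closed v hv (h0 v hv) (h1 v hv j hj hj') j hj hj').2.1,
    fun v hv => h.origin v hv (h0 v hv)⟩,
    fun v hv j hj hj' => (h.closed v hv (h0 v hv) (h1 v hv j hj hj') j hj hj').2.2⟩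

end SearchState

end PRAM

/-! ### The breadth-first search -/

namespace PRAM

theorem exists_count_eq {P : ℕ → Prop} [DecidablePred P] {W i : ℕ} (hi : i < Nat.count P W) :
    ∃ q < W, P q ∧ Nat.count P q = i := by
  induction W with
  | zero => simp at hi
  | succ W ih =>
    rw [Nat.count_succ] at hi
    rcases Nat.lt_or_ge i (Nat.count P W) with h | h
    · obtain ⟨q, hq, hq'⟩ := ih h
      exact ⟨q, by omega, hq'⟩
    · split_ifs at hi with hP
      · exact ⟨W, by omega, hP, by omega⟩
      · omega

section

variable {w : ℕ} {β : ℝ} {ρ : Resolver}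

open PRAM.Expr in
/-- Every vertex without a label that is among the candidates gets the label that comes with one of its
occurrences. Those of these vertices that have neighbours form the new frontier. -/
def claim : Cmd :=
  .par (var arrCands) (eq (read 3 (read arrCand pid)) (const 0)) arrClaim (read arrCand pid) pid ;;
  .fill (var arrCands) arrIn (eq (read 3 (read arrCand pid)) (const 0) *
    eq (read arrClaim (read arrCand pid)) pid) ;;
  .par (var arrCands) (read arrIn pid) 3 (read arrCand pid) (read arrCandLabel pid) ;;
  .par (var arrCands) (read arrIn pid) arrTime (read arrCand pid) (var arrClock) ;;
  .fill (var arrCands) arrIn (read arrIn pid *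
    lt (read 1 (read arrCand pid)) (read 1 (read arrCand pid + const 1))) ;;
  .assign arrLen (var arrCands) ;;
  scan ;;
  .par (var arrCands) (read arrIn pid) arrFront (read arrPre pid) (read arrCand pid) ;;
  .assign arrFrontLen (var arrTot)

/-- A vertex may occur many times among the candidates. Each occurrence writes its own index into
the cell of the vertex, and the one that finds its index there wins. So every unlabelled candidate
has exactly one winner under any resolver, all later writes are exclusive, and a scan over the
winners compacts them into a frontier without repetitions. -/
theorem claim_spec (hw : 20 ≤ w) {M : Memory} {n W t : ℕ} (hW : M arrCands 0 = W)
    (ht : M arrClock 0 = t) (hc : ∀ q < W, M arrCand q < n)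
    (hb : 16 * (n + W) + 16 ≤ 2 ^ w) {H : ℕ} (hH : W ≤ 2 ^ H) :
    Ensures w β ρ claim M fun M' d k =>
      (∀ b, b ∉ [3, arrIn, arrLen, arrTree, arrDown, arrPow, arrTot, arrPre, arrClaim, arrTime,
        arrFront, arrFrontLen] → M' b = M b) ∧
      (∀ v, (M 3 v = 0 ∧ M' arrTime v = t ∧
          ∃ q < W, M arrCand q = v ∧ M' 3 v = M arrCandLabel q) ∨
        ((M 3 v ≠ 0 ∨ ∀ q < W, M arrCand q ≠ v) ∧ M' 3 v = M 3 v ∧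
          M' arrTime v = M arrTime v)) ∧
      (∃ f', M' arrFrontLen 0 = f' ∧
        (∀ i < f', M 3 (M' arrFront i) = 0 ∧ (∃ q < W, M arrCand q = M' arrFront i) ∧
          M 1 (M' arrFront i) < M 1 (M' arrFront i + 1)) ∧
        (∀ i < f', ∀ j < f', M' arrFront i = M' arrFront j → i = j) ∧
        (∀ q < W, M 3 (M arrCand q) = 0 → M 1 (M arrCand q) < M 1 (M arrCand q + 1) →
          ∃ i < f', M' arrFront i = M arrCand q)) ∧
      d ≤ 200 * (H + 1) + 200 ∧ k ≤ 1500 * (W + 1) := by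
  classical
  set u := M arrCand with hu
  set lab := M 3 with hlab
  set off := M 1 with hoff
  have hone : 1 % 2 ^ w = 1 := Nat.mod_eq_of_lt (by omega)
  unfold claim
  refine .seq (.par W (by simp [hW]) (fun q => lab (u q) = 0) (fun q _ => ?_) u id
    (fun q _ _ => by simp [← hu]) (fun q _ _ => by simp) fun g1 hg1 hg1' => ?_)
  · simp [← hu, ← hlab, Expr.eval_const hw]
  -- the winning occurrences
  set win : ℕ → Prop := fun q => lab (u q) = 0 ∧ g1 (u q) = q with hwin
  have hwin_ex : ∀ q < W, lab (u q) = 0 → ∃ q' < W, win q' ∧ u q' = u q := by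
    intro q hq h
    obtain ⟨q', h1, h2, h3, h4⟩ := hg1' q hq h
    exact ⟨q', h1, ⟨h2, by rw [h3]; exact h4⟩, h3⟩
  have hwin_inj : ∀ q < W, win q → ∀ q' < W, win q' → u q = u q' → q = q' := by
    intro q _ h1 q' _ h2 h3
    rw [← h1.2, ← h2.2, h3]
  refine .seq (.fill hw W (by simp [hW]) (fun q => if win q then 1 else 0) (fun q hq => ?_)
    fun g2 hg2 => ?_)
  · simp only [Expr.eval_mul, Expr.eval_eq, Expr.eval_read, Expr.eval_pid,
      Expr.eval_const hw (show 0 < 2 ^ 20 by norm_num)]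
    simp [← hu, ← hlab, hwin]
    by_cases h1 : lab (u q) = 0 <;> by_cases h2 : g1 (u q) = q <;> simp [h1, h2, hone]
  have hact : ∀ q < W, g2 q ≠ 0 ↔ win q := fun q hq => by rw [hg2 q hq]; split_ifs with h <;> simp [h]
  refine .seq (.par_inj W (by simp [hW]) win (fun q hq => by simpa using hact q hq) u
    (M arrCandLabel) (fun q _ _ => by simp [← hu]) (fun q _ _ => by simp) hwin_inj
    fun g3 hg3 hg3' => ?_)
  refine .seq (.par_inj W (by simp [hW]) win (fun q hq => by simpa using hact q hq) u
    (fun _ => t) (fun q _ _ => by simp [← hu]) (fun q _ _ => by simp [ht]) hwin_inj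
    fun g4 hg4 hg4' => ?_)
  simp at hg3 hg4
  set P : ℕ → Prop := fun q => win q ∧ off (u q) < off (u q + 1) with hP
  refine .seq (.fill hw W (by simp [hW]) (fun q => if P q then 1 else 0) (fun q hq => ?_)
    fun g5 hg5 => ?_)
  · have h1 : (u q + 1) % 2 ^ w = u q + 1 := by
      have := hc q hq
      exact Nat.mod_eq_of_lt (by omega)
    simp only [Expr.eval_mul, Expr.eval_lt, Expr.eval_read, Expr.eval_pid, Expr.eval_add,
      Expr.eval_const hw (show 1 < 2 ^ 20 by norm_num)]
    simp [← hu, ← hoff, hg2 q hq, h1, hP]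
    by_cases h1 : win q <;> by_cases h2 : off (u q) < off (u q + 1) <;> simp [h1, h2, hone]
  refine .seq (.assign hw W (by simp [hW]) fun g6 hg6 => ?_)
  have hcount : ∀ q ≤ W, ∑ x ∈ Finset.range q, g5 x = Nat.count P q := by
    intro q hq
    rw [Nat.count_eq_card_filter_range, Finset.card_filter]
    exact Finset.sum_congr rfl fun x hx => hg5 x (by have := Finset.mem_range.1 hx; omega)
  have hcount_le : ∀ q, Nat.count P q ≤ q := fun q => Nat.count_le P
  refine .seq (.mono (scan_spec hw (len := W) (H := H) (by simp [hg6]) (by omega) ?_ hH) ?_)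
  · simp [hcount W le_rfl]
    have := hcount_le W
    omega
  rintro M1 d1 k1 ⟨hfr1, hpre1, htot1, hd1, hk1⟩
  simp at hpre1 htot1
  have f1 : M1 arrCands 0 = W := by rw [hfr1 _ (by decide)]; simp [hW]
  have f2 : M1 arrIn = g5 := by rw [hfr1 _ (by decide)]; simp
  have f3 : M1 arrCand = u := by rw [hfr1 _ (by decide)]; simp [hu]
  refine .seq (.par_inj W (by simp [f1]) P (fun q hq => ?_) (Nat.count P) u
    (fun q hq _ => by simp [hpre1 q hq, hcount q hq.le]) (fun q _ _ => by simp [f3])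
    (fun q _ h1 q' _ h2 h3 => Nat.count_injective h1 h2 h3) fun g7 hg7 hg7' => ?_)
  · simp [f2, hg5 q hq]
  refine .assign hw (Nat.count P W) (by simp [htot1, hcount W le_rfl]) fun g8 hg8 => ?_
  refine ⟨?_, ?_, ⟨Nat.count P W, by simp [hg8], ?_, ?_, ?_⟩, ?_, ?_⟩
  · intro b hb
    simp at hb
    simp [hb]
    rw [hfr1 b (by simp [hb])]
    simp [hb]
  · intro v
    have h3 : M1 3 = g3 := by rw [hfr1 _ (by decide)]; simp
    have h4 : M1 arrTime = g4 := by rw [hfr1 _ (by decide)]; simp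
    simp [h3, h4]
    by_cases hv : ∃ q < W, win q ∧ u q = v
    · obtain ⟨q, hq, h5, rfl⟩ := hv
      exact .inl ⟨h5.1, hg4' q hq h5, q, hq, rfl, hg3' q hq h5⟩
    · push Not at hv
      refine .inr ⟨?_, hg3 v hv, hg4 v hv⟩
      by_contra h
      push Not at h
      obtain ⟨h5, q, hq, rfl⟩ := h
      obtain ⟨q', h6, h7, h8⟩ := hwin_ex q hq h5
      exact hv q' h6 h7 h8
  · intro i hi
    obtain ⟨q, hq, h5, rfl⟩ := exists_count_eq hi
    have h6 := hg7' q hq h5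
    simp [h6]
    exact ⟨h5.1.1, ⟨q, hq, rfl⟩, h5.2⟩
  · intro i hi j hj h
    obtain ⟨q, hq, h5, rfl⟩ := exists_count_eq hi
    obtain ⟨q', hq', h5', rfl⟩ := exists_count_eq hj
    simp [hg7' q hq h5, hg7' q' hq' h5'] at h
    rw [hwin_inj q hq h5.1 q' hq' h5'.1 h]
  · intro q hq h5 h6
    obtain ⟨q', h7, h8, h9⟩ := hwin_ex q hq h5
    have h10 : P q' := ⟨h8, by rw [h9]; exact h6⟩
    exact ⟨Nat.count P q', Nat.count_strict_mono h10 h7, by simp [hg7' q' h7 h10, h9]⟩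
  · simp at hd1 ⊢
    omega
  · simp at hk1 ⊢
    omega

open PRAM.Expr in
/-- One round of the search. If the frontier is empty, the clock first jumps to the next start. -/
def round : Cmd :=
  .ite (lt (const 0) (var arrFrontLen)) (.assign arrLen (const 0))
    (.assign arrClock (read arrStartAt (var arrPtr))) ;;
  .assign arrCount (lt (var arrPtr) (var 0) *
    (eq (read arrStartAt (var arrPtr)) (var arrClock) *
      (read arrEnd (var arrClock) - var arrPtr))) ;;
  expand ;;
  .par (var arrCount) (const 1) arrCand (var arrEdges + pid) (read arrList (var arrPtr + pid)) ;;
  .par (var arrCount) (const 1) arrCandLabel (var arrEdges + pid)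
    (read arrList (var arrPtr + pid) + const 1) ;;
  .assign arrCands (var arrEdges + var arrCount) ;;
  claim ;;
  .assign arrPtr (var arrPtr + var arrCount) ;;
  .assign arrClock (var arrClock + const 1)

/-- The search state stored in the memory. -/
def InSearch (n : ℕ) (M₀ : Memory) (st : ℕ → ℕ) (f ptr t : ℕ) (M : Memory) : Prop :=
  (∀ b, b ∉ [3, arrIn, arrLen, arrTree, arrDown, arrPow, arrTot, arrPre, arrClaim, arrTime,
    arrFront, arrFrontLen, arrOffset, arrEdges, arrIndex, arrSlot, arrCandLabel, arrCand,
    arrSlotLabel, arrCount, arrCands, arrPtr, arrClock] → M b = M₀ b) ∧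
  M arrFrontLen 0 = f ∧ M arrPtr 0 = ptr ∧ M arrClock 0 = t ∧
  SearchState n (M₀ 1) (M₀ 2) st (M₀ arrList) (M 3) (M arrTime) (M arrFront) (M arrSlotLabel)
    f ptr t

/-- The work of a round is `O(f + e + cnt + 1)`. The jump of the clock guarantees `0 < f + cnt`, so
even the additive constant is covered by the drop of `remaining`; the summand `20` is reserved for
the test of the loop. -/
theorem round_spec (hw : 20 ≤ w) {M₀ M : Memory} {n s B f ptr t : ℕ} {st : ℕ → ℕ}
    (h0 : M₀ 0 0 = n) (hadj : IsListArray n s (M₀ 1) (M₀ 2))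
    (hs : IsSortedList n st (M₀ arrList)) (hend : IsRunEnd n st (M₀ arrList) (M₀ arrEnd))
    (hst : ∀ i < n, M₀ arrStartAt i = st (M₀ arrList i)) (hB : ∀ v < n, st v < B)
    (hb : 32 * (n + s) + 32 ≤ 2 ^ w) (hb2 : B + 2 ≤ 2 ^ w) {H : ℕ} (hH : n + s ≤ 2 ^ H)
    (hM : InSearch n M₀ st f ptr t M) (hgo : 0 < f ∨ ptr < n) :
    Ensures w β ρ round M fun M' d k => ∃ f' ptr' t',
      InSearch n M₀ st f' ptr' t' M' ∧ t < t' ∧ t' ≤ B + 1 ∧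
      d ≤ 600 * (H + 1) + 600 ∧
      k + 20 + 20000 * remaining n (M₀ 1) (M' 3) (M' arrTime) ptr' t' ≤
        20000 * remaining n (M₀ 1) (M 3) (M arrTime) ptr t := by
  obtain ⟨hfr, hf, hptr, ht, hS⟩ := hM
  -- the possible jump of the clock
  have key : Ensures w β ρ (.ite (.lt (.const 0) (.var arrFrontLen)) (.assign arrLen (.const 0))
      (.assign arrClock (.read arrStartAt (.var arrPtr)))) M fun M' d k => ∃ t₁,
      InSearch n M₀ st f ptr t₁ M' ∧ M' 3 = M 3 ∧ M' arrTime = M arrTime ∧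
      t ≤ t₁ ∧ t₁ ≤ B ∧ (f = 0 → t₁ = st (M₀ arrList ptr)) ∧
      remaining n (M₀ 1) (M 3) (M arrTime) ptr t₁ ≤
        remaining n (M₀ 1) (M 3) (M arrTime) ptr t ∧ d ≤ 30 ∧ k ≤ 30 := by
    refine .ite (fun htest => ?_) (fun htest => ?_)
    · simp [Expr.eval_const hw, hf] at htest
      -- This branch needs no action; writing to the scratch cell `arrLen` stands in for an empty
      -- command.
      refine .assign hw 0 (Expr.eval_const hw (by norm_num)) fun g hg => ⟨t, ⟨?_, ?_, ?_, ?_, ?_⟩,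
        by simp, by simp, le_rfl, hS.le_of_front (Nat.pos_of_ne_zero htest) hB, by omega, le_rfl, by simp, by simp⟩
      · intro b hb
        rw [← hfr b hb]
        simp at hb
        simp [hb]
      · simp [hf]
      · simp [hptr]
      · simp [ht]
      · simpa using hS
    · simp [Expr.eval_const hw, hf] at htest
      subst htest
      have hpn : ptr < n := by omega
      have e1 : M arrStartAt ptr = st (M₀ arrList ptr) := by rw [hfr _ (by decide), hst ptr hpn]
      refine .assign hw (st (M₀ arrList ptr)) (by simp [hptr, e1]) fun g hg =>
        ⟨st (M₀ arrList ptr), ⟨?_, ?_, ?_, ?_, ?_⟩,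
        by simp, by simp, hS.pending ptr le_rfl hpn, (hB _ (hs.lt ptr hpn)).le, fun _ => rfl,
        hS.remaining_jump hpn, by simp, by simp⟩
      · intro b hb
        rw [← hfr b hb]
        simp at hb
        simp [hb]
      · simp [hf]
      · simp [hptr]
      · simp [hg]
      · simpa using hS.jump hs hpn
  unfold round
  refine .seq (key.mono ?_)
  rintro M1 d1 k1 ⟨t₁, ⟨hfr1, hf1, hptr1, ht1, hS1⟩, hlab1, htime1, htt, ht1B, hjump, hrem1,
    hd1, hk1⟩
  -- the number of vertices that start now
  obtain ⟨cnt, hcnt, hcntn, hstart, hlate, hpos⟩ : ∃ cnt,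
      (Expr.lt (.var arrPtr) (.var 0) * (Expr.eq (.read arrStartAt (.var arrPtr)) (.var arrClock) *
        (Expr.read arrEnd (.var arrClock) - Expr.var arrPtr))).eval w β M1 0 = cnt ∧
      ptr + cnt ≤ n ∧ (∀ i, ptr ≤ i → i < ptr + cnt → st (M₀ arrList i) = t₁) ∧
      (∀ i, ptr + cnt ≤ i → i < n → t₁ < st (M₀ arrList i)) ∧ 0 < f + cnt := by
    have e0 : M1 0 0 = n := by rw [hfr1 _ (by decide), h0]
    have e1 : M1 arrEnd = M₀ arrEnd := hfr1 _ (by decide)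
    have e2 : M1 arrStartAt = M₀ arrStartAt := hfr1 _ (by decide)
    by_cases h1 : ptr < n
    · by_cases h2 : st (M₀ arrList ptr) = t₁
      · obtain ⟨h3, h4, h5, h6⟩ := hend.spec hs h1
        rw [h2] at h3 h4 h5 h6
        refine ⟨M₀ arrEnd t₁ - ptr, ?_, by omega, fun i h7 h8 => h5 i h7 (by omega),
          fun i h7 h8 => h6 i (by omega) h8, by omega⟩
        simp [hptr1, ht1, e0, e1, e2, h1, hst ptr h1, h2]
        exact Nat.mod_eq_of_lt (by omega)
      · refine ⟨0, ?_, by omega, fun i h7 h8 => by omega, fun i h7 h8 => ?_, ?_⟩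
        · simp [hptr1, ht1, e0, e1, e2, h1, hst ptr h1, h2]
        · have h3 := hS1.pending ptr le_rfl h1
          have h4 := hs.mono ptr i h7 h8
          omega
        -- If the frontier were empty, the jump would have set the clock to the start of entry
        -- `ptr`.
        · by_contra h3
          exact h2 (hjump (by omega)).symm
    · have := hS1.ptr_le
      exact ⟨0, by simp [hptr1, e0, h1], by omega, fun i h7 h8 => by omega,
        fun i h7 h8 => by omega, by omega⟩
  refine .seq (.assign hw cnt hcnt fun g1 hg1 => ?_)
  set M2 := Function.update M1 arrCount g1 with hM2
  have a1 : M2 1 = M₀ 1 := by simp [hM2, hfr1]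
  have a2 : M2 2 = M₀ 2 := by simp [hM2, hfr1]
  have a3 : M2 3 = M1 3 := by simp [hM2]
  have aF : M2 arrFront = M1 arrFront := by simp [hM2]
  have aS : M2 arrSlotLabel = M1 arrSlotLabel := by simp [hM2]
  refine .seq (.mono (expand_spec hw (M := M2) (n := n) (s := s) (f := f) (H := H)
    (by rw [a1, a2]; exact hadj) (by simp [hM2, hf1]) (by rw [aF]; exact hS1.front_lt)
    (by rw [aF]; exact hS1.front_inj) (by rw [aF, a1]; exact fun i hi => (hS1.front_spec i hi).2.2)
    (by omega) hH) ?_)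
  rw [a1, a2, a3, aF, aS]
  rintro M3 d3 k3 ⟨hfr3, e, he, hesum, hcand, hcover, hSL, hSL', hd3, hk3⟩
  have hes : e ≤ s := by
    rw [hesum]; exact hadj.sum_length_le hS1.front_lt hS1.front_inj
  have b0 : M3 arrCount 0 = cnt := by rw [hfr3 _ (by decide)]; simp [hM2, hg1]
  have bP : M3 arrPtr 0 = ptr := by rw [hfr3 _ (by decide)]; simp [hM2, hptr1]
  have bL : M3 arrList = M₀ arrList := by
    rw [hfr3 _ (by decide)]; simp only [hM2]; rw [Function.update_of_ne (by decide)]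
    exact hfr1 _ (by decide)
  have bC : M3 arrClock 0 = t₁ := by rw [hfr3 _ (by decide)]; simp [hM2, ht1]
  have b1 : M3 1 = M₀ 1 := by rw [hfr3 _ (by decide), a1]
  have b3 : M3 3 = M1 3 := by rw [hfr3 _ (by decide), a3]
  have bT : M3 arrTime = M1 arrTime := by rw [hfr3 _ (by decide)]; simp [hM2]
  have hmod1 : ∀ p < cnt, (e + p) % 2 ^ w = e + p := fun p hp => Nat.mod_eq_of_lt (by omega)
  have hmod2 : ∀ p < cnt, (ptr + p) % 2 ^ w = ptr + p := fun p hp => Nat.mod_eq_of_lt (by omega)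
  refine .seq (.par_inj cnt (by simp [b0]) (fun _ => True) (by simp [Expr.eval_const hw])
    (fun p => e + p) (fun p => M₀ arrList (ptr + p)) (fun p hp _ => by simp [he, hmod1 p hp])
    (fun p hp _ => by simp [bP, bL, hmod2 p hp]) (fun p _ _ q _ _ h => by simpa using h)
    fun g2 hg2 hg2' => ?_)
  refine .seq (.par_inj cnt (by simp [b0]) (fun _ => True) (by simp [Expr.eval_const hw])
    (fun p => e + p) (fun p => M₀ arrList (ptr + p) + 1) (fun p hp _ => by simp [he, hmod1 p hp])
    (fun p hp _ => ?_) (fun p _ _ q _ _ h => by simpa using h)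
    fun g3 hg3 hg3' => ?_)
  · have := hs.lt (ptr + p) (by omega)
    simp [bP, bL, hmod2 p hp, Expr.eval_const hw]
    exact Nat.mod_eq_of_lt (by omega)
  simp at hg3
  refine .seq (.assign hw (e + cnt) ?_ fun g4 hg4 => ?_)
  · simp [he, b0]
    exact Nat.mod_eq_of_lt (by omega)
  -- the candidates
  have hg2lo : ∀ q < e, g2 q = M3 arrCand q ∧ g3 q = M3 arrCandLabel q := fun q hq =>
    ⟨hg2 q fun p _ _ => by omega, hg3 q fun p _ => by omega⟩
  have hq : ∀ q < e + cnt, (∃ i < f, ∃ j, M₀ 1 (M1 arrFront i) ≤ j ∧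
        j < M₀ 1 (M1 arrFront i + 1) ∧ M₀ 2 j = g2 q ∧ g3 q = M1 3 (M1 arrFront i)) ∨
      ∃ i, ptr ≤ i ∧ i < ptr + cnt ∧ M₀ arrList i = g2 q ∧ g3 q = g2 q + 1 := by
    intro q hq
    rcases Nat.lt_or_ge q e with h1 | h1
    · obtain ⟨i, hi, j, h2, h3, h4, h5⟩ := hcand q h1
      obtain ⟨h6, h7⟩ := hg2lo q h1
      exact .inl ⟨i, hi, j, h2, h3, by rw [h6, h4], by rw [h7, h5]⟩
    · obtain ⟨p, rfl⟩ := Nat.exists_eq_add_of_le h1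
      have h2 := hg2' p (by omega) trivial
      have h3 := hg3' p (by omega) trivial
      exact .inr ⟨ptr + p, by omega, by omega, h2.symm, by rw [h2, h3]⟩
  have hq' : ∀ v, IsCandidate (M₀ 1) (M₀ 2) (M₀ arrList) (M1 arrFront) f ptr cnt v ↔
      ∃ q < e + cnt, g2 q = v := by
    intro v
    constructor
    · rintro (⟨i, hi, j, h1, h2, rfl⟩ | ⟨i, h1, h2, rfl⟩)
      · obtain ⟨z, hz, h3⟩ := hcover i hi j h1 h2
        exact ⟨z, by omega, by rw [(hg2lo z hz).1, h3]⟩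
      · refine ⟨e + (i - ptr), by omega, ?_⟩
        rw [hg2' (i - ptr) (by omega) trivial]
        congr 1; omega
    · rintro ⟨q, h1, rfl⟩
      rcases hq q h1 with ⟨i, hi, j, h2, h3, h4, -⟩ | ⟨i, h2, h3, h4, -⟩
      · exact .inl ⟨i, hi, j, h2, h3, h4⟩
      · exact .inr ⟨i, h2, h3, h4⟩
  have hqn : ∀ q < e + cnt, g2 q < n := by
    intro q h1
    rcases hq q h1 with ⟨i, hi, j, h2, h3, h4, -⟩ | ⟨i, h2, h3, h4, -⟩
    · rw [← h4]
      exact hadj.tgt_lt j (h3.trans_le (hadj.le_last (hS1.front_lt i hi)))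
    · rw [← h4]
      exact hs.lt i (by omega)
  refine .seq (.mono (claim_spec hw (n := n) (W := e + cnt) (t := t₁) (H := H) (by simp [hg4])
    (by simp [bC]) (by simpa using hqn) (by omega) (by omega)) ?_)
  rintro M4 d4 k4 ⟨hfr4, hlab4, ⟨f', hf', hF', hinj', hsurj'⟩, hd4, hk4⟩
  simp [b1, b3, bT] at hlab4 hF' hsurj'
  have c1 : M4 arrPtr 0 = ptr := by rw [hfr4 _ (by decide)]; simp [bP]
  have c2 : M4 arrCount 0 = cnt := by rw [hfr4 _ (by decide)]; simp [b0]
  have c3 : M4 arrClock 0 = t₁ := by rw [hfr4 _ (by decide)]; simp [bC]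
  have c4 : M4 arrSlotLabel = M3 arrSlotLabel := by rw [hfr4 _ (by decide)]; simp
  have hlab : ∀ v, (M1 3 v = 0 ∧ M4 arrTime v = t₁ ∧
        ((∃ i < f, ∃ j, M₀ 1 (M1 arrFront i) ≤ j ∧ j < M₀ 1 (M1 arrFront i + 1) ∧ M₀ 2 j = v ∧
          M4 3 v = M1 3 (M1 arrFront i)) ∨ (st v = t₁ ∧ M4 3 v = v + 1))) ∨
      ((M1 3 v ≠ 0 ∨ ¬ IsCandidate (M₀ 1) (M₀ 2) (M₀ arrList) (M1 arrFront) f ptr cnt v) ∧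
        M4 3 v = M1 3 v ∧ M4 arrTime v = M1 arrTime v) := by
    intro v
    rcases hlab4 v with ⟨h1, h2, q, h3, rfl, h5⟩ | ⟨h1, h2⟩
    · refine .inl ⟨h1, h2, ?_⟩
      rcases hq q h3 with ⟨i, hi, j, h6, h7, h8, h9⟩ | ⟨i, h6, h7, h8, h9⟩
      · exact .inl ⟨i, hi, j, h6, h7, h8, by rw [h5, h9]⟩
      · exact .inr ⟨by rw [← h8]; exact hstart i h6 h7, by rw [h5, h9]⟩
    · refine .inr ⟨?_, h2⟩
      rcases h1 with h1 | h1
      · exact .inl h1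
      · refine .inr fun h3 => ?_
        obtain ⟨q, h4, h5⟩ := (hq' v).1 h3
        exact h1 q h4 h5
  refine .seq (.assign hw (ptr + cnt) ?_ fun g5 hg5 => ?_)
  · simp [c1, c2]
    exact Nat.mod_eq_of_lt (by omega)
  refine .assign hw (t₁ + 1) ?_ fun g6 hg6 => ?_
  · simp [c3, Expr.eval_const hw]
    exact Nat.mod_eq_of_lt (by omega)
  have hrem := hS1.remaining_next hcntn hlab
  rw [← hesum, hlab1, htime1] at hrem
  refine ⟨f', ptr + cnt, t₁ + 1, ⟨?_, by simp [hf'], by simp [hg5], by simp [hg6], ?_⟩,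
    by omega, by omega, ?_, ?_⟩
  · intro b hb
    rw [← hfr1 b hb]
    simp at hb
    simp [hb]
    rw [hfr4 b (by simp [hb])]
    simp [hb]
    rw [hfr3 b (by simp [hb])]
    simp [hM2, hb]
  · simp [c4]
    refine hS1.next hadj hs hcntn hlate hlab (fun i hi => ?_) hinj' (fun v h1 h2 h3 => ?_) hSL hSL'
    · obtain ⟨h1, h2, h3⟩ := hF' i hi
      exact ⟨h1, (hq' _).2 h2, h3⟩
    · obtain ⟨q, h4, rfl⟩ := (hq' v).1 h2
      exact hsurj' q h4 h1 h3
  · simp at hd1 hd3 hd4 ⊢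
    omega
  · simp at hk1 hk3 hk4 ⊢
    omega

open PRAM.Expr in
/-- The breadth-first search. -/
def search : Cmd :=
  .fill (var 0) 3 (const 0) ;;
  .assign arrFrontLen (const 0) ;;
  .assign arrPtr (const 0) ;;
  .assign arrClock (const 0) ;;
  .loop (lt (const 0) (var arrFrontLen + (var 0 - var arrPtr))) round

/-- The clock strictly increases and stays at most `B + 1`, which bounds the depth; the initial
potential, at most `2 * n + s`, bounds the work. -/
theorem search_spec (hw : 20 ≤ w) {M : Memory} {n s B : ℕ} {st : ℕ → ℕ}
    (h0 : M 0 0 = n) (hadj : IsListArray n s (M 1) (M 2))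
    (hs : IsSortedList n st (M arrList)) (hend : IsRunEnd n st (M arrList) (M arrEnd))
    (hst : ∀ i < n, M arrStartAt i = st (M arrList i)) (hB : ∀ v < n, st v < B)
    (hb : 32 * (n + s) + 32 ≤ 2 ^ w) (hb2 : B + 2 ≤ 2 ^ w) {H : ℕ} (hH : n + s ≤ 2 ^ H) :
    Ensures w β ρ search M fun M' d k =>
      (∀ b, b ∉ [3, arrIn, arrLen, arrTree, arrDown, arrPow, arrTot, arrPre, arrClaim, arrTime,
        arrFront, arrFrontLen, arrOffset, arrEdges, arrIndex, arrSlot, arrCandLabel, arrCand,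
        arrSlotLabel, arrCount, arrCands, arrPtr, arrClock] → M' b = M b) ∧
      IsClustering n (M 1) (M 2) st (M' 3) (M' arrTime) ∧
      (∀ v < n, ∀ j, M 1 v ≤ j → j < M 1 (v + 1) → M' arrSlotLabel j = M' 3 v) ∧
      d ≤ (B + 1) * (600 * (H + 1) + 700) + 100 ∧ k ≤ 60000 * (n + s + 1) := by
  unfold search
  refine .seq (.fill hw n (by simp [h0]) (fun _ => 0) (fun _ _ => by simp [Expr.eval_const hw])
    fun g1 hg1 => ?_)
  refine .seq (.assign hw 0 (by simp [Expr.eval_const hw]) fun g2 hg2 => ?_)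
  refine .seq (.assign hw 0 (by simp [Expr.eval_const hw]) fun g3 hg3 => ?_)
  refine .seq (.assign hw 0 (by simp [Expr.eval_const hw]) fun g4 hg4 => ?_)
  refine .mono (.loop (σ := ℕ × ℕ) (fun a M' => a.1 ≤ B + 1 ∧ ∃ f ptr,
      InSearch n M st f ptr a.1 M' ∧ a.2 = remaining n (M 1) (M' 3) (M' arrTime) ptr a.1)
    (fun a => (B + 1 - a.1) * (600 * (H + 1) + 700)) (fun a => 20000 * a.2)
    ?_ (a := (0, remaining n (M 1) g1 (M arrTime) 0 0)) ?_) ?_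
  · rintro ⟨t, r⟩ M' ⟨ht, f, ptr, hM', hr⟩ htest
    simp only at ht hM' hr
    have e0 : M' 0 0 = n := by rw [hM'.1 _ (by decide), h0]
    have hgo : 0 < f ∨ ptr < n := by
      by_contra h
      push Not at h
      simp [hM'.2.1, hM'.2.2.1, e0, Expr.eval_const hw, show f = 0 by omega,
        Nat.sub_eq_zero_of_le h.2] at htest
    refine (round_spec hw h0 hadj hs hend hst hB hb hb2 hH hM' hgo).mono ?_
    rintro M'' d k ⟨f', ptr', t', h1, h2, h3, h4, h5⟩
    refine ⟨(t', remaining n (M 1) (M'' 3) (M'' arrTime) ptr' t'), ⟨h3, f', ptr', h1, rfl⟩, ?_, ?_⟩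
    · obtain ⟨x, hx⟩ : ∃ x, B + 1 - t = B + 1 - t' + 1 + x := ⟨t' - t - 1, by omega⟩
      simp only [hx, add_mul, one_mul]
      simp
      omega
    · simp only [hr]
      simp
      omega
  · refine ⟨by simp, 0, 0, ⟨?_, by simp [hg2], by simp [hg3], by simp [hg4], ?_⟩, by simp⟩
    · intro b hb
      simp at hb
      simp [hb]
    · simp
      exact SearchState.at_start fun v hv => hg1 v hv
  · rintro M' d k ⟨⟨t, r⟩, ⟨ht, f, ptr, hM', hr⟩, htest, hd, hk⟩
    have e0 : M' 0 0 = n := by rw [hM'.1 _ (by decide), h0]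
    simp only at ht hM' hr
    have hfn : f ≤ n := by
      have := Finset.card_le_card_of_injOn (s := Finset.range f) (t := Finset.range n) (M' arrFront)
        (fun i hi => by simpa using hM'.2.2.2.2.front_lt i (by simpa using hi))
        (fun i hi j hj => hM'.2.2.2.2.front_inj i (by simpa using hi) j (by simpa using hj))
      simpa using this
    have hptr := hM'.2.2.2.2.ptr_le
    simp [hM'.2.1, hM'.2.2.1, e0, Expr.eval_const hw,
      Nat.mod_eq_of_lt (show f + (n - ptr) < 2 ^ w by omega)] at htest
    obtain ⟨rfl, hle⟩ := htest
    obtain rfl : ptr = n := by omega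
    obtain ⟨h1, h2⟩ := hM'.2.2.2.2.isClustering hs
    have hrem : remaining ptr (M 1) g1 (M arrTime) 0 0 ≤ 2 * ptr + s :=
      SearchState.remaining_at_start hadj
    refine ⟨hM'.1, h1, h2, ?_, ?_⟩
    · simp at hd ⊢
      omega
    · simp at hk ⊢
      omega

end

end PRAM

/-! ### The program -/

namespace PRAM

/-- The number of entries of the lists whose label differs from the label of the owner of the
list. -/
def cutSlots (n : ℕ) (off tgt lab : ℕ → ℕ) : ℕ :=
  ∑ v ∈ Finset.range n, ∑ j ∈ Finset.Ico (off v) (off (v + 1)),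
    if lab v = lab (tgt j) then 0 else 1

open Classical in
theorem Expr.eval_leParam {w : ℕ} {β : ℝ} {M : Memory} {p : ℕ} {x y : Expr} :
    (Expr.leParam x y).eval w β M p =
      if (x.eval w β M p : ℝ) ≤ β * (y.eval w β M p : ℝ) then 1 else 0 := by
  simp only [Expr.eval]

section

variable {w : ℕ} {β : ℝ} {ρ : Resolver}

open PRAM.Expr in
/-- Computes the number `arrL` of blocks, a table of binary logarithms, and the length `arrK` of a
block. -/
def setup : Cmd :=
  .assign arrQ (const 1) ;;
  .assign arrL (const 0) ;;
  .loop (lt (var arrQ) (const 16 * var 0))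
    (.par (var arrQ) (const 1) arrLog (var arrQ + pid) (var arrL) ;;
     .assign arrQ (var arrQ + var arrQ) ;;
     .assign arrL (var arrL + const 1)) ;;
  .assign arrK (const 8) ;;
  .loop ((const 1 - leParam (const 8) (var arrK)) *
      lt (var arrK) (const 16 * (read 0 (const 1) + const 1)))
    (.assign arrK (var arrK + var arrK))

/-- `K` doubles from `8` while `β * K < 8`, so it ends with `β * K ≤ 16`; the start value is fine
because `β ≤ 1 / 2`. The cap `16 * (m + 1)` keeps `K` linear in the graph however small `β` is, and
beyond it fewer than one cut slot is expected. The table of logarithms is filled in runs of equal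
values; cell `0` is never written, whence the hypothesis on it. -/
theorem setup_spec (hw : 20 ≤ w) {M : Memory} {n m : ℕ} (hn : M 0 0 = n) (hm : M 0 1 = m)
    (hn0 : 0 < n) (hlog : M arrLog 0 = 0) (hβ : β ≤ 1 / 2) (hb : 64 * (n + m + 1) ≤ 2 ^ w)
    {H : ℕ} (hH : 32 * (n + m + 1) ≤ 2 ^ H) :
    Ensures w β ρ setup M fun M' d k =>
      (∀ b, b ∉ [arrQ, arrL, arrLog, arrK] → M' b = M b) ∧
      ∃ L K, M' arrQ 0 = 2 ^ L ∧ M' arrL 0 = L ∧ M' arrK 0 = K ∧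
        (∀ x < 2 ^ L, M' arrLog x = Nat.log 2 x) ∧ 16 * n ≤ 2 ^ L ∧ 2 ^ L ≤ 32 * n ∧
        8 ≤ K ∧ K ≤ 32 * (m + 1) ∧ β * K ≤ 16 ∧ (8 ≤ β * K ∨ 16 * (m + 1) ≤ K) ∧
        d ≤ 100 * (H + 1) ∧ k ≤ 10000 * (n + m + 1) := by
  unfold setup
  refine .seq (.assign hw 1 (Expr.eval_const hw (by norm_num)) fun g1 hg1 => ?_)
  refine .seq (.assign hw 0 (Expr.eval_const hw (by norm_num)) fun g2 hg2 => ?_)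
  refine .seq (.mono (.loop (fun (j : ℕ) M' =>
      (∀ b, b ∉ [arrQ, arrL, arrLog] → M' b = M b) ∧ M' arrQ 0 = 2 ^ j ∧ M' arrL 0 = j ∧
      (∀ x < 2 ^ j, M' arrLog x = Nat.log 2 x) ∧ 2 ^ j ≤ 32 * n)
    (fun j => 50 * (H - j)) (fun j => 50 * (64 * n - 2 * 2 ^ j)) ?_ (a := 0) ?_) ?_)
  · rintro j M' ⟨hfr, hQ, hL, hlg, hle⟩ htest
    have e0 : M' 0 0 = n := by rw [hfr _ (by decide), hn]
    have h16 : 16 * n % 2 ^ w = 16 * n := Nat.mod_eq_of_lt (by omega)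
    simp [Expr.eval_const hw, hQ, e0, h16] at htest
    have hp : 2 ^ (j + 1) = 2 * 2 ^ j := by ring
    have hp1 : 1 ≤ 2 ^ j := Nat.one_le_two_pow
    have hjH : j < H := (Nat.pow_lt_pow_iff_right (by norm_num : 1 < 2)).1
      (show 2 ^ j < 2 ^ H by omega)
    have hj2 : j < 2 ^ j := Nat.lt_two_pow_self
    refine .seq (.par_inj (2 ^ j) (by simp [hQ]) (fun _ => True) (by simp [Expr.eval_const hw])
      (fun p => 2 ^ j + p) (fun _ => j) (fun p hp' _ => ?_) (fun p _ _ => by simp [hL])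
      (fun p _ _ q _ _ h => by simpa using h) fun g3 hg3 hg3' => ?_)
    · simp [hQ]
      exact Nat.mod_eq_of_lt (by omega)
    refine .seq (.assign hw (2 ^ (j + 1)) ?_ fun g4 hg4 => ?_)
    · simp [hQ]
      rw [Nat.mod_eq_of_lt (by omega)]; omega
    refine .assign hw (j + 1) ?_ fun g5 hg5 => ?_
    · simp [hL, Expr.eval_const hw]
      exact Nat.mod_eq_of_lt (by omega)
    refine ⟨j + 1, ⟨?_, by simp [hg4], by simp [hg5], ?_, by omega⟩, ?_, ?_⟩
    · intro b hb
      rw [← hfr b hb]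
      simp at hb
      simp [hb]
    · intro x hx
      simp
      rcases Nat.lt_or_ge x (2 ^ j) with h | h
      · rw [hg3 x fun p _ _ => by omega]
        exact hlg x h
      · obtain ⟨p, rfl⟩ := Nat.exists_eq_add_of_le h
        rw [hg3' p (by omega) trivial]
        exact (Nat.log_eq_of_pow_le_of_lt_pow h hx).symm
    · simp; omega
    · simp; omega
  · refine ⟨?_, by simp [hg1], by simp [hg2], ?_, ?_⟩
    · intro b hb
      simp at hb
      simp [hb]
    · intro x hx
      obtain rfl : x = 0 := by simpa using hx
      simp [hlog]
    · simp; omega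
  rintro M1 d1 k1 ⟨L, ⟨hfr, hQ, hL, hlg, hle⟩, htest, hd1, hk1⟩
  have e0 : M1 0 = M 0 := hfr _ (by decide)
  have h16 : 16 * n % 2 ^ w = 16 * n := Nat.mod_eq_of_lt (by omega)
  simp [Expr.eval_const hw, hQ, e0, hn, h16] at htest
  refine .seq (.assign hw 8 (Expr.eval_const hw (by norm_num)) fun g3 hg3 => ?_)
  have hm1 : (m + 1) % 2 ^ w = m + 1 := Nat.mod_eq_of_lt (by omega)
  have hm16 : 16 * (m + 1) % 2 ^ w = 16 * (m + 1) := Nat.mod_eq_of_lt (by omega)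
  have hone : 1 % 2 ^ w = 1 := Nat.mod_eq_of_lt (by omega)
  have heval : ∀ (M' : Memory) (K : ℕ), M' 0 = M 0 → M' arrK 0 = K →
      (((Expr.const 1 - .leParam (.const 8) (.var arrK)) *
        .lt (.var arrK) (.const 16 * (.read 0 (.const 1) + .const 1))).eval w β M' 0 ≠ 0 ↔
      β * K < 8 ∧ K < 16 * (m + 1)) := by
    intro M' K h0 hK
    simp only [Expr.eval_mul, Expr.eval_sub, Expr.eval_lt, Expr.eval_var, Expr.eval_read,
      Expr.eval_add, Expr.eval_leParam, Expr.eval_const hw (show 1 < 2 ^ 20 by norm_num),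
      Expr.eval_const hw (show 8 < 2 ^ 20 by norm_num),
      Expr.eval_const hw (show 16 < 2 ^ 20 by norm_num), h0, hK, hm, hm1, hm16]
    by_cases h1 : (8 : ℝ) ≤ β * K
    · simp [h1]
    · by_cases h2 : K < 16 * (m + 1) <;> simp [h1, h2, hone, not_le.1 h1]
  refine .mono (.loop (fun (j : ℕ) M' =>
      (∀ b, b ≠ arrK → M' b = M1 b) ∧ M' arrK 0 = 8 * 2 ^ j ∧ 8 * 2 ^ j ≤ 32 * (m + 1) ∧
      β * (8 * 2 ^ j : ℕ) ≤ 16)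
    (fun j => 30 * (H - j)) (fun j => 60 * (32 * (m + 1) - 8 * 2 ^ j)) ?_ (a := 0) ?_) ?_
  · rintro j M' ⟨hfr', hK, hK32, hKβ⟩ ht
    rw [heval M' _ (by rw [hfr' _ (by decide), e0]) hK] at ht
    have hp : 2 ^ (j + 1) = 2 * 2 ^ j := by ring
    have hp1 : 1 ≤ 2 ^ j := Nat.one_le_two_pow
    have hjH : j < H := (Nat.pow_lt_pow_iff_right (by norm_num : 1 < 2)).1
      (show 2 ^ j < 2 ^ H by omega)
    refine .assign hw (8 * 2 ^ (j + 1)) ?_ fun g4 hg4 => ⟨j + 1, ⟨?_, by simp [hg4], by omega, ?_⟩,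
      ?_, ?_⟩
    · simp [hK]
      rw [Nat.mod_eq_of_lt (by omega)]; omega
    · intro b hb
      rw [← hfr' b hb]
      simp [hb]
    · have := ht.1
      rw [hp]
      push_cast at this ⊢
      linarith
    · simp; omega
    · simp; omega
  · refine ⟨fun b hb => by simp [hb], by simp [hg3], by omega, ?_⟩
    norm_num
    linarith
  rintro M2 d2 k2 ⟨j, ⟨hfr', hK, hK32, hKβ⟩, ht, hd2, hk2⟩
  have ht' := (heval M2 _ (by rw [hfr' _ (by decide), e0]) hK).not.1 (not_not.2 ht)
  refine ⟨?_, L, 8 * 2 ^ j, ?_, ?_, hK, ?_, htest, hle, ?_, hK32, hKβ, ?_, ?_, ?_⟩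
  · intro b hb
    simp at hb
    rw [hfr' b (by simp [hb]), hfr b (by simp [hb])]
  · rw [hfr' _ (by decide), hQ]
  · rw [hfr' _ (by decide), hL]
  · rw [hfr' _ (by decide)]; exact hlg
  · have : 1 ≤ 2 ^ j := Nat.one_le_two_pow
    omega
  · by_contra h
    push Not at h
    exact ht' h
  · simp at hd1 hd2 ⊢
    omega
  · simp at hk1 hk2 ⊢
    omega

open PRAM.Expr in
/-- Counts the slots that connect different pieces, and accepts if there are few of them. -/
def check : Cmd :=
  .fill (read 1 (var 0)) arrIn
    (const 1 - eq (read arrSlotLabel pid) (read 3 (read 2 pid))) ;;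
  .assign arrLen (read 1 (var 0)) ;;
  scan ;;
  .assign arrDone (leParam (var arrTot) (read 1 (var 0)))

/-- Every slot knows the label of its owner, so one comparison per slot and a sum suffice. Cut slots
and slots both count edges twice, so comparing their ratio with `β` is the criterion for edges. -/
theorem check_spec (hw : 20 ≤ w) {M : Memory} {n s : ℕ} (hn : M 0 0 = n)
    (hadj : IsListArray n s (M 1) (M 2))
    (hSL : ∀ v < n, ∀ j, M 1 v ≤ j → j < M 1 (v + 1) → M arrSlotLabel j = M 3 v)
    (hb : 16 * s + 16 ≤ 2 ^ w) {H : ℕ} (hH : s ≤ 2 ^ H) :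
    Ensures w β ρ check M fun M' d k =>
      (∀ b, b ∉ [arrIn, arrLen, arrTree, arrDown, arrPow, arrTot, arrPre, arrDone] →
        M' b = M b) ∧
      (M' arrDone 0 = 1 ∧ (cutSlots n (M 1) (M 2) (M 3) : ℝ) ≤ β * s ∨
        M' arrDone 0 = 0 ∧ β * s < (cutSlots n (M 1) (M 2) (M 3) : ℝ)) ∧
      d ≤ 200 * (H + 1) + 100 ∧ k ≤ 1500 * (s + 1) := by
  have hs : M 1 n = s := hadj.last
  unfold check
  refine .seq (.fill hw s (by simp [hn, hs])
    (fun j => if M arrSlotLabel j = M 3 (M 2 j) then 0 else 1) (fun j _ => ?_) fun g1 hg1 => ?_)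
  · by_cases h : M arrSlotLabel j = M 3 (M 2 j) <;> simp [Expr.eval_const hw, h]
  have hsum : ∑ j ∈ Finset.range s, g1 j = cutSlots n (M 1) (M 2) (M 3) := by
    rw [← hs, ← hadj.sum_range le_rfl, cutSlots]
    refine Finset.sum_congr rfl fun v hv => Finset.sum_congr rfl fun j hj => ?_
    have hv := Finset.mem_range.1 hv
    obtain ⟨h1, h2⟩ := Finset.mem_Ico.1 hj
    rw [hg1 j (h2.trans_le (hadj.le_last hv)), hSL v hv j h1 h2]
  have hle : ∑ j ∈ Finset.range s, g1 j ≤ s := by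
    refine (Finset.sum_le_card_nsmul _ _ 1 fun z hz => ?_).trans (by simp)
    rw [hg1 z (by simpa using hz)]
    split_ifs <;> simp
  refine .seq (.assign hw s (by simp [hn, hs]) fun g2 hg2 => ?_)
  refine .seq (.mono (scan_spec hw (len := s) (H := H) (by simp [hg2]) (by omega) ?_ hH) ?_)
  · simp
    omega
  rintro M1 d1 k1 ⟨hfr1, -, htot1, hd1, hk1⟩
  simp [hsum] at htot1
  have e0 : M1 0 0 = n := by rw [hfr1 _ (by decide)]; simp [hn]
  have e1 : M1 1 n = s := by rw [hfr1 _ (by decide)]; simp [hs]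
  refine .assign hw _ rfl fun g3 hg3 => ⟨?_, ?_, ?_, ?_⟩
  · intro b hb
    simp at hb
    simp [hb]
    rw [hfr1 b (by simp [hb])]
    simp [hb]
  · simp only [Function.update_self, hg3, Expr.eval_leParam, Expr.eval_var, Expr.eval_read, e0, e1,
      htot1]
    by_cases h : (cutSlots n (M 1) (M 2) (M 3) : ℝ) ≤ β * s
    · simp [h]
    · exact .inr ⟨by simp [h], not_le.1 h⟩
  · simp at hd1 ⊢
    omega
  · simp at hk1 ⊢
    omega

/-- The deterministic part of an attempt. -/
def attempt : Cmd := sortByStart ;; search ;; check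

/-- The memory after the setup: `O` and `A` are the adjacency array. -/
structure IsReady (n s L K : ℕ) (O A : ℕ → ℕ) (M : Memory) : Prop where
  size : M 0 0 = n
  off : M 1 = O
  tgt : M 2 = A
  pow : M arrQ 0 = 2 ^ L
  blocks : M arrL 0 = L
  len : M arrK 0 = K
  log : ∀ x < 2 ^ L, M arrLog x = Nat.log 2 x

theorem IsReady.congr {n s L K : ℕ} {O A : ℕ → ℕ} {M M' : Memory} (h : IsReady n s L K O A M)
    (hM : ∀ b ∈ [0, 1, 2, arrQ, arrL, arrK, arrLog], M' b = M b) : IsReady n s L K O A M' where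
  size := by rw [hM _ (by decide), h.size]
  off := by rw [hM _ (by decide), h.off]
  tgt := by rw [hM _ (by decide), h.tgt]
  pow := by rw [hM _ (by decide), h.pow]
  blocks := by rw [hM _ (by decide), h.blocks]
  len := by rw [hM _ (by decide), h.len]
  log := by rw [hM _ (by decide)]; exact h.log

theorem attempt_spec (hw : 20 ≤ w) {M : Memory} {n s L K : ℕ} {O A : ℕ → ℕ}
    (hM : IsReady n s L K O A M) (hadj : IsListArray n s O A) (hK0 : 0 < K) (hL0 : 0 < L)
    (hU : ∀ v < n, M arrU v < 2 ^ L * K) (hb : 32 * (n + s + K + L) + 32 ≤ 2 ^ w)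
    (hb3 : L * K + 2 ≤ 2 ^ w) {H : ℕ} (hH : n + s + K + L ≤ 2 ^ H) :
    Ensures w β ρ attempt M fun M' d k => IsReady n s L K O A M' ∧
      (∃ T, IsClustering n O A (fun v => startTime K (M arrU v)) (M' 3) T) ∧
      (M' arrDone 0 = 1 ∧ (cutSlots n O A (M' 3) : ℝ) ≤ β * s ∨
        M' arrDone 0 = 0 ∧ β * s < (cutSlots n O A (M' 3) : ℝ)) ∧
      d ≤ 5000 * (L * K) * (H + 1) ∧ k ≤ 100000 * (n + s + K + L + 1) := by
  unfold attempt
  refine .seq (.mono (sortByStart_spec hw hM.size hM.len hM.blocks hK0 hL0 hM.log hU (by omega)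
    (by omega) (by omega) (H := H) (by omega) (by omega)) ?_)
  rintro M1 d1 k1 ⟨hfr1, hs, hend, hst, hd1, hk1⟩
  have hM1 : IsReady n s L K O A M1 := hM.congr fun b hb => hfr1 b (by
    simp at hb; rcases hb with rfl | rfl | rfl | rfl | rfl | rfl | rfl <;> decide)
  refine .seq (.mono (search_spec hw (B := L * K) (s := s) (H := H) hM1.size
    (by rw [hM1.off, hM1.tgt]; exact hadj) hs hend hst
    (fun v hv => startTime_lt hK0 hL0 (hU v hv)) (by omega) hb3 (by omega)) ?_)
  rw [hM1.off, hM1.tgt]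
  rintro M2 d2 k2 ⟨hfr2, hcl, hSL, hd2, hk2⟩
  have hM2 : IsReady n s L K O A M2 := hM1.congr fun b hb => hfr2 b (by
    simp at hb; rcases hb with rfl | rfl | rfl | rfl | rfl | rfl | rfl <;> decide)
  refine .mono (check_spec hw (s := s) (H := H) hM2.size (by rw [hM2.off, hM2.tgt]; exact hadj)
    (by rw [hM2.off]; exact hSL) (by omega) (by omega)) ?_
  rw [hM2.off, hM2.tgt]
  rintro M3 d3 k3 ⟨hfr3, hdone, hd3, hk3⟩
  have hM3 : IsReady n s L K O A M3 := hM2.congr fun b hb => hfr3 b (by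
    simp at hb; rcases hb with rfl | rfl | rfl | rfl | rfl | rfl | rfl <;> decide)
  have e3 : M3 3 = M2 3 := hfr3 _ (by decide)
  refine ⟨hM3, ⟨M2 arrTime, by rw [e3]; exact hcl⟩, by rw [e3]; exact hdone, ?_, by omega⟩
  -- The cost of the search dominates: all lower-order terms are absorbed into `L * K * (H + 1)`.
  have h1 : K ≤ L * K := Nat.le_mul_of_pos_left K hL0
  have h2 : L ≤ L * K := Nat.le_mul_of_pos_right L hK0
  have h3 : 1 ≤ L * K := Nat.mul_pos hL0 hK0
  have h4 : (L * K) ≤ (L * K) * (H + 1) := Nat.le_mul_of_pos_right _ (by omega)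
  have h5 : (H + 1) ≤ (L * K) * (H + 1) := Nat.le_mul_of_pos_left _ h3
  have h6 : (L * K + 1) * (600 * (H + 1) + 700) =
    600 * ((L * K) * (H + 1)) + 700 * (L * K) + 600 * (H + 1) + 700 := by ring
  have h7 : 5000 * (L * K) * (H + 1) = 5000 * ((L * K) * (H + 1)) := by ring
  rw [h6] at hd2
  rw [h7]
  omega

open PRAM.Expr in
/-- The decomposition algorithm: attempts with fresh random start times are made until few edges are
cut. -/
def partition : Cmd :=
  setup ;;
  .loop (const 1 - var arrDone)
    (.draw (var 0) (const 1) arrU pid (var arrQ * var arrK - const 1) ;; attempt)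

end

end PRAM

/-! ### Clusterings of graphs -/

namespace PRAM

section

variable {n : ℕ} {G : SimpleGraph (Fin n)} {off tgt : ℕ → ℕ}

/-! ### Slots of the adjacency array and edges of the graph. -/

namespace IsAdjacencyArray

theorem off_mono (h : IsAdjacencyArray G off tgt) {a b : ℕ} (hab : a ≤ b) (hb : b ≤ n) :
    off a ≤ off b := by
  induction b, hab using Nat.le_induction with
  | base => exact le_rfl
  | succ b hab ih => exact (ih (by omega)).trans (h.off_le ⟨b, by omega⟩)

theorem congr (h : IsAdjacencyArray G off tgt) {off' tgt' : ℕ → ℕ} (ho : ∀ i ≤ n, off' i = off i)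
    (ht : ∀ j < off n, tgt' j = tgt j) : IsAdjacencyArray G off' tgt' := by
  have key : ∀ v : Fin n, ∀ j, off' v ≤ j ∧ j < off' (v + 1) ↔ off v ≤ j ∧ j < off (v + 1) :=
    fun v j => by rw [ho _ v.2.le, ho _ v.2]
  have hlt : ∀ v : Fin n, ∀ j, j < off (v + 1) → j < off n := fun v j hj =>
    hj.trans_le (h.off_mono v.2 le_rfl)
  refine ⟨by rw [ho 0 (Nat.zero_le _), h.off_zero], fun v => ?_, fun v j h1 h2 => ?_,
    fun v u hvu => ?_⟩
  · rw [ho _ v.2.le, ho _ v.2]; exact h.off_le v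
  · obtain ⟨h3, h4⟩ := (key v j).1 ⟨h1, h2⟩
    rw [ht j (hlt v j h4)]
    exact h.adj_of_slot v j h3 h4
  · obtain ⟨j, ⟨h1, h2, h3⟩, h4⟩ := h.slot_of_adj v u hvu
    refine ⟨j, ⟨((key v j).2 ⟨h1, h2⟩).1, ((key v j).2 ⟨h1, h2⟩).2, ?_⟩, ?_⟩
    · rw [ht j (hlt v j h2), h3]
    · rintro i ⟨h5, h6, h7⟩
      obtain ⟨h8, h9⟩ := (key v i).1 ⟨h5, h6⟩
      exact h4 i ⟨h8, h9, by rw [← h7, ht i (hlt v i h9)]⟩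

open Classical in
/-- Counting slots is counting neighbours. -/
theorem card_slots (h : IsAdjacencyArray G off tgt) (v : Fin n) (φ : ℕ → Prop) :
    ((Finset.Ico (off v) (off (v + 1))).filter fun j => φ (tgt j)).card =
      (Finset.univ.filter fun u : Fin n => G.Adj v u ∧ φ u).card := by
  refine Finset.card_bij' (fun j hj => (h.adj_of_slot v j
      (Finset.mem_Ico.1 (Finset.mem_filter.1 hj).1).1
      (Finset.mem_Ico.1 (Finset.mem_filter.1 hj).1).2).choose)
    (fun u hu => (h.slot_of_adj v u (Finset.mem_filter.1 hu).2.1).choose) ?_ ?_ ?_ ?_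
  · intro j hj
    have hj' := Finset.mem_filter.1 hj
    have hs := (h.adj_of_slot v j (Finset.mem_Ico.1 hj'.1).1
      (Finset.mem_Ico.1 hj'.1).2).choose_spec
    simp only [Finset.mem_filter, Finset.mem_univ, true_and]
    exact ⟨hs.2, hs.1 ▸ hj'.2⟩
  · intro u hu
    have hu' := (Finset.mem_filter.1 hu).2
    have hs := (h.slot_of_adj v u hu'.1).choose_spec.1
    simp only [Finset.mem_filter, Finset.mem_Ico]
    exact ⟨⟨hs.1, hs.2.1⟩, by rw [hs.2.2]; exact hu'.2⟩
  · intro j hj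
    have hj' := Finset.mem_filter.1 hj
    have h1 := Finset.mem_Ico.1 hj'.1
    have hs := (h.adj_of_slot v j h1.1 h1.2).choose_spec
    exact ((h.slot_of_adj v _ hs.2).choose_spec.2 j ⟨h1.1, h1.2, hs.1⟩).symm
  · intro u hu
    have hu' := (Finset.mem_filter.1 hu).2
    have hs := (h.slot_of_adj v u hu'.1).choose_spec.1
    have hs' := (h.adj_of_slot v _ hs.1 hs.2.1).choose_spec
    exact Fin.ext (hs'.1.symm.trans hs.2.2)

theorem sum_slots (h : IsAdjacencyArray G off tgt) :
    ∑ v : Fin n, (off (v + 1) - off v) = off n := by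
  have h1 : ∀ b ≤ n, ∑ v ∈ Finset.range b, (off (v + 1) - off v) = off b := by
    intro b
    induction b with
    | zero => simp [h.off_zero]
    | succ b ih =>
      intro hb
      rw [Finset.sum_range_succ, ih (by omega)]
      have := h.off_le ⟨b, by omega⟩
      simp only at this
      omega
  rw [← h1 n le_rfl, ← Fin.sum_univ_eq_sum_range (fun v => off (v + 1) - off v) n]

theorem off_last (h : IsAdjacencyArray G off tgt) : off n = 2 * G.edgeSet.ncard := by
  classical
  rw [← h.sum_slots, Set.ncard_eq_toFinset_card', ← SimpleGraph.edgeFinset, ← G.sum_degrees_eq_twice_card_edges]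
  refine Finset.sum_congr rfl fun v _ => ?_
  have := h.card_slots v (fun _ => True)
  simp only [Finset.filter_true, Nat.card_Ico, and_true] at this
  rw [this, ← SimpleGraph.card_neighborFinset_eq_degree]
  congr 1
  ext u
  simp

theorem isListArray (h : IsAdjacencyArray G off tgt) :
    IsListArray n (2 * G.edgeSet.ncard) off tgt := by
  have h1 : ∀ j < off n, tgt j < n := by
    have key : ∀ b ≤ n, ∀ j < off b, tgt j < n := by
      intro b
      induction b with
      | zero => intro _ j hj; rw [h.off_zero] at hj; omega
      | succ b ih =>
        intro hb j hj
        rcases Nat.lt_or_ge j (off b) with h2 | h2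
        · exact ih (by omega) j h2
        · obtain ⟨u, hu, -⟩ := h.adj_of_slot ⟨b, by omega⟩ j h2 hj
          rw [hu]; exact u.2
    exact key n le_rfl
  exact ⟨h.off_zero, fun v hv => h.off_le ⟨v, hv⟩, h.off_last, h.off_last ▸ h1⟩

/-- The number of slots that are cut is twice the number of edges that are cut. -/
theorem cutSlots_eq (h : IsAdjacencyArray G off tgt) (lab : ℕ → ℕ) :
    cutSlots n off tgt lab = 2 * ({e ∈ G.edgeSet |
      ¬ ∃ S ∈ (Setoid.ker fun v : Fin n => lab v).classes, ∀ v ∈ e, v ∈ S} :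
        Set (Sym2 (Fin n))).ncard := by
  classical
  -- The cut edges form a graph of their own, to which the degree-sum formula is applied.
  let H : SimpleGraph (Fin n) :=
    { Adj := fun u v => G.Adj u v ∧ lab u ≠ lab v
      symm := ⟨fun u v h => ⟨h.1.symm, h.2.symm⟩⟩
      loopless := ⟨fun u h => h.2 rfl⟩ }
  have hH : {e ∈ G.edgeSet | ¬ ∃ S ∈ (Setoid.ker fun v : Fin n => lab v).classes,
      ∀ v ∈ e, v ∈ S} = H.edgeSet := by
    ext e
    induction e using Sym2.ind with
    | _ u v =>
      simp only [Set.mem_ofPred_eq, SimpleGraph.mem_edgeSet, Sym2.mem_iff, forall_eq_or_imp,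
        forall_eq]
      refine and_congr_right fun _ => not_congr ?_
      constructor
      · rintro ⟨S, ⟨y, rfl⟩, h1, h2⟩
        exact Eq.trans h1 h2.symm
      · intro huv
        exact ⟨_, ⟨v, rfl⟩, huv, rfl⟩
  rw [hH, Set.ncard_eq_toFinset_card', ← SimpleGraph.edgeFinset,
    ← H.sum_degrees_eq_twice_card_edges, cutSlots,
    ← Fin.sum_univ_eq_sum_range (fun v => ∑ j ∈ Finset.Ico (off v) (off (v + 1)),
      if lab v = lab (tgt j) then 0 else 1) n]
  refine Finset.sum_congr rfl fun v _ => ?_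
  have := h.card_slots v (fun u => lab v ≠ lab u)
  rw [Finset.card_filter] at this
  rw [← SimpleGraph.card_neighborFinset_eq_degree]
  refine (Finset.sum_congr rfl fun j _ => ?_).trans (this.trans ?_)
  · split_ifs <;> simp_all
  congr 1
  ext u
  simp [H]

end IsAdjacencyArray

/-- `IsClustering` in terms of the graph. -/
structure IsGraphClustering (G : SimpleGraph (Fin n)) (st lab T : ℕ → ℕ) : Prop where
  time_le : ∀ v : Fin n, T v ≤ st v
  time_step : ∀ v u : Fin n, G.Adj v u → T u ≤ T v + 1
  origin : ∀ v : Fin n, (lab v = v + 1 ∧ T v = st v) ∨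
    ∃ u : Fin n, G.Adj u v ∧ lab u = lab v ∧ T v = T u + 1

theorem IsClustering.graph {st lab T : ℕ → ℕ} (h : IsClustering n off tgt st lab T)
    (hadj : IsAdjacencyArray G off tgt) : IsGraphClustering G st lab T where
  time_le v := h.time_le v v.2
  time_step v u hvu := by
    obtain ⟨j, ⟨h1, h2, h3⟩, -⟩ := hadj.slot_of_adj v u hvu
    have := h.time_step v v.2 j h1 h2
    rwa [h3] at this
  origin v := by
    rcases h.origin v v.2 with h1 | ⟨u, hu, j, h1, h2, h3, h4, h5⟩
    · exact .inl h1
    · obtain ⟨v', hv', hadj'⟩ := hadj.adj_of_slot ⟨u, hu⟩ j h1 h2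
      obtain rfl : v' = v := Fin.ext (hv'.symm.trans h3)
      exact .inr ⟨⟨u, hu⟩, hadj', h4, h5⟩

/-! ### Arrival times, centers and the diameter of pieces. -/

namespace IsGraphClustering

variable {st lab T : ℕ → ℕ}

theorem time_le_walk (h : IsGraphClustering G st lab T) {u v : Fin n} (p : G.Walk u v) :
    T v ≤ T u + p.length := by
  induction p with
  | nil => simp
  | cons hadj p ih =>
    have := h.time_step _ _ hadj
    simp only [SimpleGraph.Walk.length_cons]
    omega

/-- One half of `T v = min (st x + dist x v)`; the other half is `exists_center`. Extended distances
make the inequality vacuous across components. -/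
theorem time_le_edist (h : IsGraphClustering G st lab T) (u v : Fin n) :
    (T v : ℕ∞) ≤ st u + G.edist u v := by
  by_cases huv : G.edist u v = ⊤
  · simp [huv]
  · obtain ⟨p, hp⟩ := SimpleGraph.exists_walk_of_edist_ne_top huv
    rw [← hp]
    have h1 := h.time_le_walk p
    have h2 := h.time_le u
    exact_mod_cast h1.trans (by omega)

/-- Follow the origins backwards: the time drops by one at each step, so the walk ends at a vertex
that started by itself, and the label is constant along it, so the walk stays inside the piece. -/
theorem exists_walk (h : IsGraphClustering G st lab T) (l : ℕ) (k : ℕ)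
    (v : {v : Fin n | lab v = l}) (hv : T v.1 = k) :
    ∃ x : {v : Fin n | lab v = l}, l = x.1 + 1 ∧
      ∃ p : (G.induce {v : Fin n | lab v = l}).Walk x v, st x.1 + p.length = T v.1 := by
  induction k using Nat.strong_induction_on generalizing v with
  | _ k ih =>
    rcases h.origin v.1 with ⟨h1, h2⟩ | ⟨u, h1, h2, h3⟩
    · exact ⟨v, by rw [← h1]; exact v.2.symm, .nil, by simp [h2]⟩
    · obtain ⟨x, hx, p, hp⟩ := ih (T u) (by omega) ⟨u, h2.trans v.2⟩ rfl
      refine ⟨x, hx, p.concat (SimpleGraph.induce_adj.2 h1), ?_⟩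
      rw [SimpleGraph.Walk.length_concat]
      simp only at hp
      omega

theorem exists_center (h : IsGraphClustering G st lab T) (v : Fin n) :
    ∃ x : Fin n, lab v = x + 1 ∧ st x + G.edist x v ≤ T v := by
  obtain ⟨x, hx, p, hp⟩ := h.exists_walk (lab v) (T v) ⟨v, rfl⟩ rfl
  refine ⟨x, hx, ?_⟩
  have h1 := (p.map (SimpleGraph.Embedding.induce _).toHom).edist_le
  rw [SimpleGraph.Walk.length_map] at h1
  simp only at hp
  rw [← hp]
  push_cast
  gcongr
  exact h1

/-- The pieces have small strong diameter. -/
theorem strongDiam (h : IsGraphClustering G st lab T) {B : ℕ} (hB : ∀ v : Fin n, st v ≤ B) (l : ℕ)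
    (u v : {v : Fin n | lab v = l}) :
    (G.induce {v : Fin n | lab v = l}).Reachable u v ∧
      (G.induce {v : Fin n | lab v = l}).dist u v ≤ 2 * B := by
  obtain ⟨x, hx, p, hp⟩ := h.exists_walk l _ u rfl
  obtain ⟨y, hy, q, hq⟩ := h.exists_walk l _ v rfl
  -- The common label is the index of the center plus one, so both walks begin at the same center.
  obtain rfl : x = y := Subtype.ext (Fin.ext (by omega))
  have h1 := h.time_le u.1
  have h2 := h.time_le v.1
  have h3 := hB u.1
  have h4 := hB v.1
  refine ⟨(p.reverse.append q).reachable, (SimpleGraph.dist_le (p.reverse.append q)).trans ?_⟩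
  rw [SimpleGraph.Walk.length_append, SimpleGraph.Walk.length_reverse]
  omega

end IsGraphClustering

/-- Two arrivals compete for a place with distances `e`: some arrival is the first one, and another one
comes at most two units of time later. -/
def IsNearTie (e : Fin n → ℕ∞) (a : Fin n → ℕ) : Prop :=
  ∃ x y, x ≠ y ∧ e x ≠ ⊤ ∧ (∀ z, a x + e x ≤ a z + e z) ∧ a y + e y ≤ a x + e x + 2

/-- The center `y` of `u` differs from the center `x` of `v` because the labels differ. Its wave
could cross the edge and arrive at `v` by time `T u + 1 ≤ T v + 2`, while `x` arrives first, at time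
`T v`. -/
theorem IsGraphClustering.isNearTie {st lab T : ℕ → ℕ} (h : IsGraphClustering G st lab T)
    {v u : Fin n} (hvu : G.Adj v u) (hlab : lab v ≠ lab u) :
    IsNearTie (fun x => G.edist x v) (fun x => st x) := by
  obtain ⟨x, hx, hx'⟩ := h.exists_center v
  obtain ⟨y, hy, hy'⟩ := h.exists_center u
  refine ⟨x, y, ?_, ?_, fun z => hx'.trans (h.time_le_edist z v), ?_⟩
  · rintro rfl; exact hlab (hx.trans hy.symm)
  · intro htop
    simp [htop] at hx'
  · have h1 : G.edist y v ≤ G.edist y u + 1 :=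
      (SimpleGraph.edist_triangle (v := u)).trans (by
        gcongr
        exact (SimpleGraph.edist_eq_one_iff_adj.2 hvu.symm).le)
    have h2 : (T u : ℕ∞) ≤ T v + 1 := by exact_mod_cast h.time_step v u hvu
    calc (st y : ℕ∞) + G.edist y v ≤ st y + G.edist y u + 1 := by
          rw [add_assoc]; gcongr
      _ ≤ T v + 1 + 1 := add_le_add_left (hy'.trans h2) 1
      _ = T v + 2 := by rw [add_assoc]; norm_num
      _ ≤ _ := by gcongr; exact h.time_le_edist x v

open Classical in
/-- Only the neighbourhoods of near ties are cut. -/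
theorem IsClustering.cutSlots_le {st lab T : ℕ → ℕ} (h : IsClustering n off tgt st lab T)
    (hadj : IsAdjacencyArray G off tgt) :
    cutSlots n off tgt lab ≤ ∑ v : Fin n,
      if IsNearTie (fun x => G.edist x v) (fun x => st x) then off (v + 1) - off v else 0 := by
  rw [cutSlots, ← Fin.sum_univ_eq_sum_range (fun v => ∑ j ∈ Finset.Ico (off v) (off (v + 1)),
      if lab v = lab (tgt j) then 0 else 1) n]
  refine Finset.sum_le_sum fun v _ => ?_
  split_ifs with hv
  · refine (Finset.sum_le_card_nsmul _ _ 1 fun j _ => ?_).trans (by simp)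
    split_ifs <;> simp
  · refine (Finset.sum_eq_zero fun j hj => if_pos ?_).le
    by_contra hne
    obtain ⟨h1, h2⟩ := Finset.mem_Ico.1 hj
    obtain ⟨u, hu, hvu⟩ := hadj.adj_of_slot v j h1 h2
    rw [hu] at hne
    exact hv ((h.graph hadj).isNearTie hvu hne)

end

end PRAM

/-! ### Near ties are rare -/

namespace PRAM

section

variable {n : ℕ} {α : Type*}

/-- Fubini in counting form: it allows all coordinates but that of `x` to be fixed, and so expresses
the independence of the draws. -/
theorem card_filter_splitAt [Fintype α] [DecidableEq α] (x : Fin n) (P : (Fin n → α) → Prop)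
    [DecidablePred P] :
    (Finset.univ.filter P).card = ∑ g : {z : Fin n // z ≠ x} → α,
      (Finset.univ.filter fun c => P ((Equiv.funSplitAt x α).symm (c, g))).card := by
  simp only [Finset.card_filter]
  rw [← Equiv.sum_comp (Equiv.funSplitAt x α).symm, Fintype.sum_prod_type_right]

theorem funSplitAt_symm_self (x : Fin n) (c : α) (g : {z : Fin n // z ≠ x} → α) :
    (Equiv.funSplitAt x α).symm (c, g) x = c := by
  simp

theorem funSplitAt_symm_of_ne {x z : Fin n} (hz : z ≠ x) (c : α)
    (g : {z : Fin n // z ≠ x} → α) : (Equiv.funSplitAt x α).symm (c, g) z = g ⟨z, hz⟩ := by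
  simp [hz]

/-- `x` is the first arrival; ties are broken by the index. -/
def IsWinner (e : Fin n → ℕ∞) (a : Fin n → ℕ) (x : Fin n) : Prop :=
  e x ≠ ⊤ ∧ ∀ z, z ≠ x → a x + e x < a z + e z ∨ a x + e x = a z + e z ∧ x < z

theorem IsWinner.unique {e : Fin n → ℕ∞} {a : Fin n → ℕ} {x y : Fin n} (hx : IsWinner e a x)
    (hy : IsWinner e a y) : x = y := by
  by_contra hne
  rcases hx.2 y (Ne.symm hne) with h1 | ⟨h1, h1'⟩ <;> rcases hy.2 x hne with h2 | ⟨h2, h2'⟩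
  · exact absurd h1 h2.not_gt
  · exact h1.ne h2.symm
  · exact h2.ne h1.symm
  · exact absurd h1' h2'.not_gt

/-- Breaking ties by index makes the winner unique. If this turns the given second arrival into the
winner, the given first arrival takes over the role of the second. -/
theorem IsNearTie.exists_winner {e : Fin n → ℕ∞} {a : Fin n → ℕ} (h : IsNearTie e a) :
    ∃ x, IsWinner e a x ∧ ∃ y, y ≠ x ∧ a y + e y ≤ a x + e x + 2 := by
  classical
  obtain ⟨x, y, hxy, hx, hmin, hy⟩ := h
  have hne : (Finset.univ.filter fun u => ∀ z, a u + e u ≤ a z + e z).Nonempty :=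
    ⟨x, by simpa using hmin⟩
  set u := Finset.min' _ hne with hu
  have hu1 : ∀ z, a u + e u ≤ a z + e z := (Finset.mem_filter.1 (Finset.min'_mem _ hne)).2
  have hux : a u + e u = a x + e x := (hu1 x).antisymm (hmin u)
  refine ⟨u, ⟨?_, fun z hz => ?_⟩, ?_⟩
  · intro htop
    rw [htop, add_top] at hux
    exact WithTop.add_ne_top.2 ⟨WithTop.natCast_ne_top _, hx⟩ hux.symm
  · rcases (hu1 z).lt_or_eq with h1 | h1
    · exact .inl h1
    · refine .inr ⟨h1, lt_of_le_of_ne (Finset.min'_le _ _ ?_) (Ne.symm hz)⟩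
      simpa [← h1] using hu1
  · by_cases hyu : y = u
    · refine ⟨x, fun h => hxy (h.trans hyu.symm), ?_⟩
      rw [hux]; exact le_self_add
    · exact ⟨y, hyu, by rw [hux]; exact hy⟩

-- Fix all draws except that of `x`, and let `a` be a winning draw of `x` with the latest start
-- time. Draws with start time at most `st a` also win, as they only make `x` earlier. A win by at
-- most two units needs a start time of at least `st a - 2`, because the other arrivals are fixed
-- and none precedes that of `x` under `a`. The distance `e x` cancels, and `hst` compares the two
-- counts.
open Classical in
theorem card_winner_near_le [Fintype α] {K : ℕ} {st : α → ℕ}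
    (hst : ∀ c₀, K * (Finset.univ.filter fun c => st c₀ ≤ st c + 2 ∧ st c ≤ st c₀ ∧ K ≤ st c).card ≤
      3 * (Finset.univ.filter fun c => st c ≤ st c₀).card) (e : Fin n → ℕ∞) (x : Fin n) :
    K * (Finset.univ.filter fun r : Fin n → α => IsWinner e (fun v => st (r v)) x ∧ K ≤ st (r x) ∧
        ∃ y, y ≠ x ∧ st (r y) + e y ≤ st (r x) + e x + 2).card ≤
      3 * (Finset.univ.filter fun r : Fin n → α => IsWinner e (fun v => st (r v)) x).card := by
  rw [card_filter_splitAt x, card_filter_splitAt x, Finset.mul_sum, Finset.mul_sum]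
  refine Finset.sum_le_sum fun g _ => ?_
  set r := fun c => (Equiv.funSplitAt x α).symm (c, g) with hr
  have hx : ∀ c, r c x = c := fun c => funSplitAt_symm_self x c g
  have hz : ∀ c c' z, z ≠ x → r c z = r c' z := fun c c' z h => by
    simp only [hr, funSplitAt_symm_of_ne h]
  change K * (Finset.univ.filter fun c => IsWinner e (fun v => st (r c v)) x ∧ K ≤ st (r c x) ∧
      ∃ y, y ≠ x ∧ st (r c y) + e y ≤ st (r c x) + e x + 2).card ≤
    3 * (Finset.univ.filter fun c => IsWinner e (fun v => st (r c v)) x).card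
  rcases (Finset.univ.filter fun c => IsWinner e (fun v => st (r c v)) x).eq_empty_or_nonempty
    with hW | hW
  · rw [Finset.card_eq_zero.2, mul_zero]
    · exact Nat.zero_le _
    · refine Finset.filter_eq_empty_iff.2 fun c _ h => ?_
      exact Finset.filter_eq_empty_iff.1 hW (Finset.mem_univ c) h.1
  obtain ⟨a, ha, hmax⟩ := Finset.exists_max_image _ st hW
  have haW := (Finset.mem_filter.1 ha).2
  refine ((Nat.mul_le_mul_left K (Finset.card_le_card ?_)).trans (hst a)).trans
    (Nat.mul_le_mul_left 3 (Finset.card_le_card ?_))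
  · refine Finset.monotone_filter_right _ fun c _ hc => ?_
    obtain ⟨hcW, hcK, y, hy, hy'⟩ := hc
    rw [hx] at hcK hy'
    refine ⟨?_, hmax c (by simpa using hcW), hcK⟩
    have h1 : (st a : ℕ∞) + e x ≤ st (r c y) + e y := by
      rw [hz c a y hy]
      have := haW.2 y hy
      simp only [hx] at this
      rcases this with h | h
      · exact h.le
      · exact h.1.le
    have h2 := h1.trans hy'
    rw [add_right_comm] at h2
    have h3 := (ENat.add_le_add_iff_right haW.1).1 h2
    exact_mod_cast h3
  · refine Finset.monotone_filter_right _ fun c _ hc => ⟨haW.1, fun z hzx => ?_⟩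
    have h1 := haW.2 z hzx
    simp only [hx] at h1 ⊢
    rw [hz c a z hzx]
    have h2 : (st c : ℕ∞) + e x ≤ st a + e x := by gcongr
    rcases h1 with h | h
    · exact .inl (h2.trans_lt h)
    · rcases h2.lt_or_eq with h3 | h3
      · exact .inl (h3.trans_eq h.1)
      · exact .inr ⟨h3.trans h.1, h.2⟩

-- Sum over the winner. The events "`x` wins" are disjoint, so their sizes add up to at most the
-- whole space.
open Classical in
theorem card_nearTie_le [Fintype α] {K : ℕ} {st : α → ℕ}
    (hst : ∀ c₀, K * (Finset.univ.filter fun c => st c₀ ≤ st c + 2 ∧ st c ≤ st c₀ ∧ K ≤ st c).card ≤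
      3 * (Finset.univ.filter fun c => st c ≤ st c₀).card) (e : Fin n → ℕ∞) :
    K * (Finset.univ.filter fun r : Fin n → α => (∀ v, K ≤ st (r v)) ∧
      IsNearTie e (fun v => st (r v))).card ≤ 3 * Fintype.card (Fin n → α) := by
  calc _ ≤ K * ∑ x, (Finset.univ.filter fun r : Fin n → α => IsWinner e (fun v => st (r v)) x ∧
        K ≤ st (r x) ∧ ∃ y, y ≠ x ∧ st (r y) + e y ≤ st (r x) + e x + 2).card := by
        refine Nat.mul_le_mul_left K ((Finset.card_le_card ?_).trans Finset.card_biUnion_le)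
        intro r hr
        obtain ⟨h1, h2⟩ := (Finset.mem_filter.1 hr).2
        obtain ⟨x, hx, hy⟩ := h2.exists_winner
        exact Finset.mem_biUnion.2 ⟨x, Finset.mem_univ x,
          Finset.mem_filter.2 ⟨Finset.mem_univ r, hx, h1 x, hy⟩⟩
    _ ≤ ∑ x, 3 * (Finset.univ.filter fun r : Fin n → α =>
          IsWinner e (fun v => st (r v)) x).card := by
        rw [Finset.mul_sum]
        exact Finset.sum_le_sum fun x _ => card_winner_near_le hst e x
    _ ≤ _ := by
        rw [← Finset.mul_sum, ← Finset.card_biUnion]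
        · exact Nat.mul_le_mul_left 3 (Finset.card_le_univ _)
        · intro x _ y _ hxy
          refine Finset.disjoint_left.2 fun r h1 h2 => hxy ?_
          exact (Finset.mem_filter.1 h1).2.unique (Finset.mem_filter.1 h2).2

end

/-! ### The distribution of the start times and the probability of failure. -/

section

variable {K L N : ℕ}

-- The time `s` fixes the remainder of the word modulo `K` and leaves `2 ^ (s / K)` possible
-- quotients, those with binary logarithm `s / K`. Block `0` is excluded because the quotients `0`
-- and `1` both have logarithm `0`.
open Classical in
theorem card_startTime_eq_le (hK : 0 < K) {s : ℕ} (hs : K ≤ s) :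
    (Finset.univ.filter fun c : Fin N => startTime K c = s).card ≤ 2 ^ (s / K) := by
  have key : ∀ c : Fin N, startTime K c = s → c % K = s % K ∧ Nat.log 2 (c / K) = s / K := by
    intro c hc
    have h1 : (c : ℕ) % K < K := Nat.mod_lt _ hK
    rw [← hc, startTime, mul_comm]
    constructor
    · rw [Nat.mul_add_mod, Nat.mod_mod]
    · rw [Nat.mul_add_div hK, Nat.div_eq_of_lt h1, add_zero]
  have hpos : 1 ≤ s / K := (Nat.one_le_div_iff hK).2 hs
  calc _ ≤ (Finset.Ico (2 ^ (s / K)) (2 ^ (s / K + 1))).card := by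
        refine Finset.card_le_card_of_injOn (fun c => c / K) ?_ ?_
        · intro c hc
          obtain ⟨-, h2⟩ := key c (Finset.mem_filter.1 hc).2
          have h3 : (c : ℕ) / K ≠ 0 := by
            intro h0
            rw [h0, Nat.log_zero_right] at h2
            omega
          simp only [Finset.coe_Ico, Set.mem_Ico]
          exact ⟨h2 ▸ Nat.pow_log_le_self 2 h3, h2 ▸ Nat.lt_pow_succ_log_self (by norm_num) _⟩
        · intro c hc d hd hcd
          have h1 := (key c (Finset.mem_filter.1 hc).2).1
          have h2 := (key d (Finset.mem_filter.1 hd).2).1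
          simp only at hcd
          refine Fin.ext ?_
          rw [← Nat.div_add_mod c K, ← Nat.div_add_mod d K, hcd, h1, h2]
    _ = 2 ^ (s / K) := by rw [Nat.card_Ico, pow_succ]; omega

theorem startTime_lt_of_div_lt (hK : 0 < K) {b c : ℕ} (hb : 1 ≤ b) (hc : c / K < 2 ^ b) :
    startTime K c < b * K := by
  have h1 : Nat.log 2 (c / K) < b := Nat.log_lt_of_lt_pow' (by omega) hc
  have h2 : c % K < K := Nat.mod_lt _ hK
  calc startTime K c < Nat.log 2 (c / K) * K + K := by rw [startTime]; omega
    _ = (Nat.log 2 (c / K) + 1) * K := by ring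
    _ ≤ b * K := Nat.mul_le_mul_right K h1

open Classical in
/-- The start times are memoryless enough: the hazard rate is at most `1 / K`. -/
theorem card_startTime_near_le (hK : 0 < K) (hL : 0 < L) (hN : N = 2 ^ L * K) (c₀ : Fin N) :
    K * (Finset.univ.filter fun c : Fin N => startTime K c₀ ≤ startTime K c + 2 ∧
        startTime K c ≤ startTime K c₀ ∧ K ≤ startTime K c).card ≤
      3 * (Finset.univ.filter fun c : Fin N => startTime K c ≤ startTime K c₀).card := by
  set a := startTime K c₀ with ha
  have haL : a < L * K := startTime_lt hK hL (hN ▸ c₀.2)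
  rcases Nat.lt_or_ge a K with h | h
  · rw [Finset.card_eq_zero.2, mul_zero]
    · exact Nat.zero_le _
    · refine Finset.filter_eq_empty_iff.2 fun c _ h1 => ?_
      omega
  have hb : 1 ≤ a / K := (Nat.one_le_div_iff hK).2 h
  have hbL : a / K < L := Nat.div_lt_of_lt_mul (by rwa [mul_comm])
  -- At most three times qualify, each hit by at most `2 ^ (a / K)` words.
  have h1 : (Finset.univ.filter fun c : Fin N => a ≤ startTime K c + 2 ∧
      startTime K c ≤ a ∧ K ≤ startTime K c).card ≤ 3 * 2 ^ (a / K) := by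
    calc _ ≤ (((Finset.Icc (a - 2) a).filter fun s => K ≤ s).biUnion fun s =>
          Finset.univ.filter fun c : Fin N => startTime K c = s).card := by
          refine Finset.card_le_card fun c hc => ?_
          have := (Finset.mem_filter.1 hc).2
          refine Finset.mem_biUnion.2 ⟨startTime K c, ?_, by simp⟩
          simp only [Finset.mem_filter, Finset.mem_Icc]
          omega
      _ ≤ ((Finset.Icc (a - 2) a).filter fun s => K ≤ s).card * 2 ^ (a / K) := by
          refine Finset.card_biUnion_le_card_mul _ _ _ fun s hs => ?_
          simp only [Finset.mem_filter, Finset.mem_Icc] at hs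
          exact (card_startTime_eq_le hK hs.2).trans
            (Nat.pow_le_pow_right two_pos (Nat.div_le_div_right hs.1.2))
      _ ≤ _ := by
          refine Nat.mul_le_mul_right _ ((Finset.card_filter_le _ _).trans ?_)
          rw [Nat.card_Icc]; omega
  have h2 : 2 ^ (a / K) * K ≤ N := by
    rw [hN]
    exact Nat.mul_le_mul_right K (Nat.pow_le_pow_right two_pos hbL.le)
  -- All words with quotient below `2 ^ (a / K)` belong to earlier blocks, and there are `2 ^ (a /
  -- K) * K` of them.
  have h3 : 2 ^ (a / K) * K ≤
      (Finset.univ.filter fun c : Fin N => startTime K c ≤ a).card := by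
    calc 2 ^ (a / K) * K = (Finset.univ : Finset (Fin (2 ^ (a / K) * K))).card := by simp
      _ ≤ _ := by
        refine Finset.card_le_card_of_injOn (Fin.castLE h2) ?_ ((Fin.castLE_injective h2).injOn)
        intro c _
        have := startTime_lt_of_div_lt hK hb (c := c) ((Nat.div_lt_iff_lt_mul hK).2 c.2)
        have h4 := Nat.div_mul_le_self a K
        simp only [Finset.coe_filter, Finset.mem_univ, true_and, Set.mem_ofPred_eq,
          Fin.val_castLE]
        omega
  calc _ ≤ K * (3 * 2 ^ (a / K)) := Nat.mul_le_mul_left K h1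
    _ = 3 * (2 ^ (a / K) * K) := by ring
    _ ≤ _ := Nat.mul_le_mul_left 3 h3

-- Block `0`, where the hazard bound is not available, holds only words below `2 * K` out of `2 ^ L
-- * K`; a union bound over the vertices does the rest.
open Classical in
theorem card_exists_startTime_lt_le {n : ℕ} (hK : 0 < K) (hN : N = 2 ^ L * K) :
    2 ^ L * (Finset.univ.filter fun r : Fin n → Fin N => ∃ v, startTime K (r v) < K).card ≤
      2 * n * Fintype.card (Fin n → Fin N) := by
  have h1 : (Finset.univ.filter fun c : Fin N => startTime K c < K).card ≤ 2 * K := by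
    calc _ ≤ (Finset.range (2 * K)).card := by
          refine Finset.card_le_card_of_injOn (fun c => c) ?_ Fin.val_injective.injOn
          intro c hc
          have h2 := (Finset.mem_filter.1 hc).2
          have h3 : Nat.log 2 (c / K) = 0 := by
            by_contra h0
            have : K ≤ Nat.log 2 (c / K) * K := Nat.le_mul_of_pos_left K (Nat.pos_of_ne_zero h0)
            rw [startTime] at h2
            omega
          have h4 : (c : ℕ) / K < 2 := by
            rcases Nat.log_eq_zero_iff.1 h3 with h | h <;> omega
          simp only [Finset.coe_range, Set.mem_Iio]
          exact (Nat.div_lt_iff_lt_mul hK).1 h4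
      _ = 2 * K := Finset.card_range _
  have h2 : ∀ v, 2 ^ L * (Finset.univ.filter fun r : Fin n → Fin N =>
      startTime K (r v) < K).card ≤ 2 * Fintype.card (Fin n → Fin N) := by
    intro v
    have hT := card_filter_splitAt (α := Fin N) v (fun _ => True)
    simp only [Finset.filter_true, Finset.card_univ] at hT
    rw [card_filter_splitAt v, hT, Finset.mul_sum, Finset.mul_sum]
    refine Finset.sum_le_sum fun g _ => ?_
    simp only [funSplitAt_symm_self, Fintype.card_fin]
    calc _ ≤ 2 ^ L * (2 * K) := Nat.mul_le_mul_left _ h1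
      _ = 2 * N := by rw [hN]; ring
  calc _ ≤ 2 ^ L * ∑ v, (Finset.univ.filter fun r : Fin n → Fin N =>
        startTime K (r v) < K).card := by
        refine Nat.mul_le_mul_left _ ((Finset.card_le_card ?_).trans Finset.card_biUnion_le)
        intro r hr
        obtain ⟨v, hv⟩ := (Finset.mem_filter.1 hr).2
        exact Finset.mem_biUnion.2 ⟨v, Finset.mem_univ v,
          Finset.mem_filter.2 ⟨Finset.mem_univ r, hv⟩⟩
    _ ≤ ∑ _v : Fin n, 2 * Fintype.card (Fin n → Fin N) := by
        rw [Finset.mul_sum]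
        exact Finset.sum_le_sum fun v _ => h2 v
    _ = _ := by
        rw [Finset.sum_const, Finset.card_univ, Fintype.card_fin, smul_eq_mul]; ring

open Classical in
/-- With probability at least one half, few of the places see a near tie. -/
theorem card_bad_le {n : ℕ} (hn : 0 < n) (hK : 0 < K) (hL : 0 < L) (hnL : 16 * n ≤ 2 ^ L)
    (hN : N = 2 ^ L * K) (e : Fin n → Fin n → ℕ∞) (d : Fin n → ℕ) {s : ℕ} (hs : ∑ v, d v = s)
    {β : ℝ} (hβ : 0 < β) (hβK : 8 ≤ β * K ∨ 8 * (s + 2) ≤ K) :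
    2 * (Finset.univ.filter fun r : Fin n → Fin N => (∃ v, startTime K (r v) < K) ∨
      β * s < ((∑ v, if IsNearTie (e v) (fun x => startTime K (r x)) then d v else 0 : ℕ) :
        ℝ)).card ≤ Fintype.card (Fin n → Fin N) := by
  set N' := Fintype.card (Fin n → Fin N) with hN'
  set cut : (Fin n → Fin N) → ℕ := fun r =>
    ∑ v, if IsNearTie (e v) (fun x => startTime K (r x)) then d v else 0 with hcut
  set B₀ := Finset.univ.filter fun r : Fin n → Fin N => ∃ v, startTime K (r v) < K with hB₀
  set B₁ := Finset.univ.filter fun r : Fin n → Fin N =>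
    (∀ v, K ≤ startTime K (r v)) ∧ β * s < (cut r : ℝ) with hB₁
  -- The choice `16 * n ≤ 2 ^ L` makes an early start have probability at most `1 / 8`.
  have h0 : 8 * B₀.card ≤ N' := by
    have h1 := card_exists_startTime_lt_le (n := n) hK hN
    rw [← hB₀, ← hN'] at h1
    have h2 : 2 * n * (8 * B₀.card) ≤ 2 * n * N' := by
      calc _ = 16 * n * B₀.card := by ring
        _ ≤ 2 ^ L * B₀.card := Nat.mul_le_mul_right _ hnL
        _ ≤ _ := h1
    exact Nat.le_of_mul_le_mul_left h2 (by omega)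
  -- Linearity of expectation: each vertex contributes its degree times the probability of a near
  -- tie.
  have hsum : K * ∑ r ∈ B₁, cut r ≤ 3 * s * N' := by
    calc K * ∑ r ∈ B₁, cut r
        ≤ K * ∑ r ∈ Finset.univ.filter fun r : Fin n → Fin N => ∀ v, K ≤ startTime K (r v),
            cut r := by
          refine Nat.mul_le_mul_left K (Finset.sum_le_sum_of_subset ?_)
          exact Finset.monotone_filter_right _ fun r _ h => h.1
      _ = ∑ v, d v * (K * (Finset.univ.filter fun r : Fin n → Fin N =>
            (∀ v, K ≤ startTime K (r v)) ∧
              IsNearTie (e v) (fun x => startTime K (r x))).card) := by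
          rw [hcut, Finset.sum_comm, Finset.mul_sum]
          refine Finset.sum_congr rfl fun v _ => ?_
          rw [← Finset.sum_filter, Finset.filter_filter, Finset.sum_const, smul_eq_mul]
          ring
      _ ≤ ∑ v, d v * (3 * N') := by
          refine Finset.sum_le_sum fun v _ => Nat.mul_le_mul_left _ ?_
          exact card_nearTie_le (st := fun c : Fin N => startTime K c)
            (card_startTime_near_le hK hL hN) (e v)
      _ = _ := by rw [← Finset.sum_mul, hs]; ring
  have hsumR : (K : ℝ) * ∑ r ∈ B₁, (cut r : ℝ) ≤ 3 * s * N' := by exact_mod_cast hsum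
  have hK' : (0 : ℝ) < K := by exact_mod_cast hK
  -- Markov's inequality, at the threshold `β * s` if `8 ≤ β * K`. If `K` is capped, the threshold
  -- is `1`: on `B₁` the cut is a positive integer, while its mean is at most `3 * s / K < 3 / 8`.
  have h1 : 8 * B₁.card ≤ 3 * N' := by
    rcases hβK with h | h
    · rcases Nat.eq_zero_or_pos s with h2 | h2
      · have : B₁ = ∅ := by
          refine Finset.filter_eq_empty_iff.2 fun r _ h3 => ?_
          have h4 : cut r ≤ s := by
            rw [← hs]
            exact Finset.sum_le_sum fun v _ => by split_ifs <;> simp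
          have h5 := h3.2
          rw [h2] at h4 h5
          have : cut r = 0 := by omega
          simp [this] at h5
        simp [this]
      · have h3 : (B₁.card : ℝ) * (β * s) ≤ ∑ r ∈ B₁, (cut r : ℝ) := by
          rw [← nsmul_eq_mul]
          exact Finset.card_nsmul_le_sum _ _ _ fun r hr => (Finset.mem_filter.1 hr).2.2.le
        have h4 : (s : ℝ) * (8 * B₁.card) ≤ s * (3 * N') := by
          calc (s : ℝ) * (8 * B₁.card) ≤ s * (β * K * B₁.card) := by gcongr
            _ = K * (B₁.card * (β * s)) := by ring
            _ ≤ K * ∑ r ∈ B₁, (cut r : ℝ) := by gcongr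
            _ ≤ 3 * s * N' := hsumR
            _ = _ := by ring
        have h5 := le_of_mul_le_mul_left h4 (by exact_mod_cast h2)
        exact_mod_cast h5
    · have h3 : B₁.card ≤ ∑ r ∈ B₁, cut r := by
        rw [Finset.card_eq_sum_ones]
        refine Finset.sum_le_sum fun r hr => ?_
        have h4 : (0 : ℝ) < cut r :=
          lt_of_le_of_lt (by positivity) (Finset.mem_filter.1 hr).2.2
        exact_mod_cast h4
      have h5 : (s + 2) * (8 * B₁.card) ≤ (s + 2) * (3 * N') := by
        calc (s + 2) * (8 * B₁.card) = 8 * (s + 2) * B₁.card := by ring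
          _ ≤ K * ∑ r ∈ B₁, cut r := Nat.mul_le_mul h h3
          _ ≤ 3 * s * N' := hsum
          _ ≤ _ := by nlinarith
      exact Nat.le_of_mul_le_mul_left h5 (by omega)
  have h2 : (Finset.univ.filter fun r : Fin n → Fin N => (∃ v, startTime K (r v) < K) ∨
      β * s < (cut r : ℝ)) ⊆ B₀ ∪ B₁ := by
    intro r hr
    have h3 := (Finset.mem_filter.1 hr).2
    by_cases h4 : ∃ v, startTime K (r v) < K
    · exact Finset.mem_union_left _ (Finset.mem_filter.2 ⟨Finset.mem_univ r, h4⟩)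
    · refine Finset.mem_union_right _ (Finset.mem_filter.2 ⟨Finset.mem_univ r, ?_, ?_⟩)
      · push Not at h4; exact h4
      · exact h3.resolve_left h4
  have h3 := (Finset.card_le_card h2).trans (Finset.card_union_le _ _)
  change 2 * (Finset.univ.filter fun r : Fin n → Fin N => (∃ v, startTime K (r v) < K) ∨
      β * s < (cut r : ℝ)).card ≤ N'
  omega

end

end PRAM

/-! ### The decomposition algorithm -/

namespace PRAM

section

variable {w : ℕ} {β : ℝ} {ρ : Resolver}

/-- `draw` samples from a dependent product whose ranges are given by evaluated expressions; when
all ranges agree, it becomes a plain function space. -/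
theorem map_uniform_const {ι γ : Type} [Fintype ι] [DecidableEq ι] (f : ι → ℕ) (N : ℕ)
    (hf : ∀ i, f i = N) (F : ((i : ι) → Fin (f i + 1)) → γ) :
    (PMF.uniformOfFintype ((i : ι) → Fin (f i + 1))).map F =
      (PMF.uniformOfFintype (ι → Fin (N + 1))).map
        fun r => F fun i => Fin.cast (by rw [hf]) (r i) := by
  obtain rfl : f = fun _ => N := funext hf
  rfl

theorem step_draw {width guard addr top : Expr} {a : ℕ} {K : List Cmd} {c : Config}
    (hc : c.todo = .draw width guard a addr top :: K) (n N : ℕ)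
    (hn : width.eval w β c.mem 0 = n) (hN : ∀ p < n, top.eval w β c.mem p = N)
    (hguard : ∀ p < n, guard.eval w β c.mem p ≠ 0) (haddr : ∀ p < n, addr.eval w β c.mem p = p) :
    ∃ X : (Fin n → Fin (N + 1)) → Config,
      step w β ρ c = (PMF.uniformOfFintype (Fin n → Fin (N + 1))).map X ∧
      ∀ r, (X r).todo = K ∧ (∀ b ≠ a, (X r).mem b = c.mem b) ∧
        (∀ v : Fin n, (X r).mem a v = r v) ∧
        (X r).depth = c.depth + (width.size + guard.size + addr.size + top.size) ∧
        (X r).work = c.work + (width.size + guard.size + addr.size + top.size) * (n + 1) := by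
  subst hn
  have h := map_uniform_const (fun p : Fin (width.eval w β c.mem 0) => top.eval w β c.mem p) N
    (fun p => hN p p.2) (γ := Config)
  refine ⟨fun r =>
    { todo := K
      mem := write ρ c a (width.eval w β c.mem 0) (guard.eval w β c.mem ·)
        (addr.eval w β c.mem ·)
        (fun p => if h : p < width.eval w β c.mem 0 then (r ⟨p, h⟩ : ℕ) else 0)
      depth := c.depth + (width.size + guard.size + addr.size + top.size)
      work := c.work + (width.size + guard.size + addr.size + top.size) *
        (width.eval w β c.mem 0 + 1) }, ?_, ?_⟩
  · unfold step
    rw [hc]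
    exact h _
  · intro r
    refine ⟨rfl, ?_, ?_, rfl, rfl⟩
    · intro b hb
      funext x
      simp [write, hb]
    · intro v
      have hw' : writers (width.eval w β c.mem 0) (guard.eval w β c.mem ·)
          (addr.eval w β c.mem ·) v = {(v : ℕ)} := by
        ext p
        simp only [writers, Finset.mem_filter, Finset.mem_range, Finset.mem_singleton]
        constructor
        · rintro ⟨h1, -, h2⟩
          rwa [haddr p h1] at h2
        · rintro rfl
          exact ⟨v.2, hguard v v.2, haddr v v.2⟩
      have hp : ρ.pick c v {(v : ℕ)} = v := by
        simpa using ρ.pick_mem c v {(v : ℕ)} (Finset.singleton_nonempty _)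
      simp only [write, hw', hp, Finset.singleton_nonempty, and_self, if_true]
      simp

open PRAM.Expr in
/-- The loop of `partition`. -/
def attempts : Cmd :=
  .loop (const 1 - var arrDone)
    (.draw (var 0) (const 1) arrU pid (var arrQ * var arrK - const 1) ;; attempt)

variable {n : ℕ} {G : SimpleGraph (Fin n)} {O A : ℕ → ℕ} {L K : ℕ}

/-- A clustering that cuts few edges is a decomposition. -/
theorem IsClustering.isLowDiameterDecomposition {st T : ℕ → ℕ} {c : Config}
    (h : IsClustering n O A st (c.mem 3) T) (hadj : IsAdjacencyArray G O A) {B : ℕ} {D : ℝ}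
    (hst : ∀ v < n, st v ≤ B) (hD : 2 * (B : ℝ) ≤ D)
    (hcut : (cutSlots n O A (c.mem 3) : ℝ) ≤ β * (2 * G.edgeSet.ncard : ℕ)) :
    IsLowDiameterDecomposition G β D (output n c) where
  isPartition := Setoid.isPartition_classes _
  strongDiam := by
    rintro S ⟨y, rfl⟩ u v
    obtain ⟨h1, h2⟩ := (h.graph hadj).strongDiam (fun v => hst v v.2) (c.mem 3 y) u v
    refine ⟨h1, le_trans ?_ hD⟩
    exact_mod_cast h2
  cut := by
    rw [hadj.cutSlots_eq] at hcut
    push_cast at hcut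
    unfold output
    linarith

/-- The machine is about to make a new attempt. -/
structure IsHead (n s L K : ℕ) (O A : ℕ → ℕ) (c : Config) : Prop where
  todo : c.todo = [attempts]
  ready : IsReady n s L K O A c.mem
  done : c.mem arrDone 0 = 0

/-- The labels may depend on the resolver, which sees the random draws, so the bad set is defined by
the start times alone. `IsClustering.cutSlots_le` shows that a rejected result can occur only inside
it, whatever the labels are. -/
theorem IsHead.isAttempt (hw : 20 ≤ w) (hadj : IsAdjacencyArray G O A) (hn : 0 < n)
    (hK : 0 < K) (hL : 0 < L) (hnL : 16 * n ≤ 2 ^ L) (hβ : 0 < β)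
    (hβK : 8 ≤ β * K ∨ 16 * (G.edgeSet.ncard + 1) ≤ K)
    (hb : 32 * (n + 2 * G.edgeSet.ncard + K + L) + 32 ≤ 2 ^ w) (hb3 : 2 ^ L * K + 2 ≤ 2 ^ w)
    {H : ℕ} (hH : n + 2 * G.edgeSet.ncard + K + L ≤ 2 ^ H) {D : ℝ}
    (hD : 2 * ((L * K : ℕ) : ℝ) ≤ D) {f : Config → ℕ} {F : ℕ}
    (hf : ∀ c c' d k, c'.depth = c.depth + d → c'.work = c.work + k →
      d ≤ 5000 * (L * K) * (H + 1) + 20 →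
      k ≤ 100100 * (n + 2 * G.edgeSet.ncard + K + L + 1) → f c' ≤ f c + F)
    {c : Config} (hc : IsHead n (2 * G.edgeSet.ncard) L K O A c) :
    IsAttempt w β ρ f (IsHead n (2 * G.edgeSet.ncard) L K O A)
      (fun c' => IsLowDiameterDecomposition G β D (output n c')) F c := by
  classical
  obtain ⟨htodo, hr, hdone⟩ := hc
  set s := 2 * G.edgeSet.ncard with hs
  have hp : 0 < 2 ^ L * K := Nat.mul_pos (Nat.two_pow_pos L) hK
  obtain ⟨N, hN⟩ : ∃ N, N + 1 = 2 ^ L * K := ⟨2 ^ L * K - 1, by omega⟩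
  have hLK : L * K ≤ 2 ^ L * K := Nat.mul_le_mul_right K Nat.lt_two_pow_self.le
  set c₂ : Config :=
    { todo := [.draw (.var 0) (.const 1) arrU .pid (.var arrQ * .var arrK - .const 1), attempt,
        attempts]
      mem := c.mem, depth := c.depth + 5, work := c.work + 5 } with hc₂
  have hrun₂ : runFor w β ρ 2 c = PMF.pure c₂ := by
    have h1 : step w β ρ c = PMF.pure
        { todo := [(.draw (.var 0) (.const 1) arrU .pid (.var arrQ * .var arrK - .const 1)) ;;
            attempt, attempts]
          mem := c.mem, depth := c.depth + 4, work := c.work + 4 } := by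
      unfold step
      rw [htodo]
      simp [attempts, hdone, Expr.eval_const hw]
    have h2 : step w β ρ
        { todo := [(.draw (.var 0) (.const 1) arrU .pid (.var arrQ * .var arrK - .const 1)) ;;
            attempt, attempts]
          mem := c.mem, depth := c.depth + 4, work := c.work + 4 } = PMF.pure c₂ := rfl
    simp only [runFor, h1, PMF.pure_bind, h2]
  obtain ⟨X, hX, hX'⟩ := step_draw (w := w) (β := β) (ρ := ρ) (c := c₂) rfl n N
    (by simp [hc₂, hr.size]) (fun p _ => by
      simp [hc₂, hr.pow, hr.len, Expr.eval_const hw]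
      rw [Nat.mod_eq_of_lt (by omega)]; omega)
    (fun p _ => by simp [Expr.eval_const hw]) (fun p _ => by simp)
  have hY : ∀ r, ∃ y : Config, Reaches w β ρ (X r) y ∧ f y ≤ f c + F ∧
      (IsHead n s L K O A y ∧ ((∃ v, startTime K (r v) < K) ∨
        β * s < ((∑ v : Fin n, if IsNearTie (fun x => G.edist x v) (fun x => startTime K (r x))
          then O (v + 1) - O v else 0 : ℕ) : ℝ)) ∨
        y.todo = [] ∧ IsLowDiameterDecomposition G β D (output n y)) := by
    intro r
    obtain ⟨h1, h2, h3, h4, h5⟩ := hX' r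
    have hr' : IsReady n s L K O A (X r).mem := hr.congr fun b hb => h2 b (by
      simp at hb; rcases hb with rfl | rfl | rfl | rfl | rfl | rfl | rfl <;> decide)
    have hU : ∀ v < n, (X r).mem arrU v < 2 ^ L * K := fun v hv => by
      rw [h3 ⟨v, hv⟩, ← hN]; exact (r ⟨v, hv⟩).2
    obtain ⟨c', d, k, g1, g2, g3, g4, g5, ⟨T, g6⟩, g7, g8, g9⟩ :=
      attempt_spec (ρ := ρ) (β := β) hw hr' hadj.isListArray hK hL hU hb (by omega) hH
        (X r) [attempts] h1 rfl
    simp only [hc₂, Expr.size_var, Expr.size_const, Expr.size_pid, Expr.size_sub,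
      Expr.size_mul] at h4 h5
    rcases g7 with ⟨g7, g10⟩ | ⟨g7, g10⟩
    · refine ⟨{ todo := [], mem := c'.mem, depth := c'.depth + 4, work := c'.work + 4 },
        g1.trans (.of_step ?_), hf c _ (d + 20) (k + (11 * n + 20)) ?_ ?_ (by omega) (by omega),
        .inr ⟨rfl, ?_⟩⟩
      · unfold step
        rw [g2]
        simp [attempts, g7, Expr.eval_const hw]
      · simp only; omega
      · simp only; omega
      · exact IsClustering.isLowDiameterDecomposition (c := ⟨[], c'.mem, _, _⟩) g6 hadj
          (fun v hv => (startTime_lt hK hL (hU v hv)).le) hD g10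
    · refine ⟨c', g1, hf c _ (d + 16) (k + (11 * n + 16)) (by omega) (by omega) (by omega)
        (by omega), .inl ⟨⟨g2, g5, g7⟩, .inr (g10.trans_le ?_)⟩⟩
      have h6 := g6.cutSlots_le hadj
      simp only [h3] at h6
      exact_mod_cast h6
  choose Y hY1 hY2 hY3 using hY
  refine ⟨Fin n → Fin (N + 1), inferInstance, inferInstance, 2, X, Y,
    Finset.univ.filter fun r => (∃ v, startTime K (r v) < K) ∨
      β * s < ((∑ v : Fin n, if IsNearTie (fun x => G.edist x v) (fun x => startTime K (r x))
        then O (v + 1) - O v else 0 : ℕ) : ℝ), ?_, hY1, hY2, fun r => ?_, ?_⟩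
  · rw [runFor_add, hrun₂, PMF.pure_bind]
    simp [runFor, hX]
  · rcases hY3 r with ⟨h1, h2⟩ | h1
    · exact .inl ⟨by simpa using h2, h1⟩
    · exact .inr h1
  · convert card_bad_le hn hK hL hnL hN (fun v x => G.edist x v) (fun v => O (v + 1) - O v)
      (hadj.sum_slots.trans hadj.off_last) hβ (hβK.imp_right fun h => by omega) using 3

/-- The setup leads to the first attempt. -/
theorem exists_isHead (hw : 20 ≤ w) (hn : 0 < n) {off tgt : ℕ → ℕ}
    (hadj : IsAdjacencyArray G off tgt) (hβ : β ≤ 1 / 2)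
    (hb : 64 * (n + 2 * G.edgeSet.ncard + 1) ≤ 2 ^ w)
    {H : ℕ} (hH : 32 * (n + G.edgeSet.ncard + 1) ≤ 2 ^ H) :
    ∃ O A L K c d k, IsAdjacencyArray G O A ∧
      Reaches w β ρ (initial w partition n G.edgeSet.ncard off tgt) c ∧
      IsHead n (2 * G.edgeSet.ncard) L K O A c ∧ 16 * n ≤ 2 ^ L ∧ 2 ^ L ≤ 32 * n ∧
      8 ≤ K ∧ K ≤ 32 * (G.edgeSet.ncard + 1) ∧ β * K ≤ 16 ∧
      (8 ≤ β * K ∨ 16 * (G.edgeSet.ncard + 1) ≤ K) ∧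
      c.depth = d ∧ c.work = k ∧ d ≤ 100 * (H + 1) + 1 ∧ k ≤ 10000 * (n + G.edgeSet.ncard + 1) + 1 := by
  set m := G.edgeSet.ncard with hm
  set c₀ := initial w partition n m off tgt with hc₀
  have hoff : off n = 2 * m := hadj.off_last
  have h1 : IsAdjacencyArray G (c₀.mem 1) (c₀.mem 2) := by
    refine hadj.congr (fun i hi => ?_) fun j hj => ?_
    · have := hadj.off_mono hi le_rfl
      simp [hc₀, initial, hi]
      exact Nat.mod_eq_of_lt (by omega)
    · have := hadj.isListArray.tgt_lt j (by omega)
      simp [hc₀, initial, hj]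
      exact Nat.mod_eq_of_lt (by omega)
  have hstep : Reaches w β ρ c₀
      { todo := [setup, attempts], mem := c₀.mem, depth := 1, work := 1 } :=
    .of_step (by simp [step, hc₀, initial, partition, attempts])
  obtain ⟨c, d, k, g1, g2, g3, g4, g5, L, K, g6, g7, g8, g9, g10, g11, g12, g13, g14, g15, g16,
    g17⟩ := setup_spec (ρ := ρ) hw (M := c₀.mem) (n := n) (m := m)
      (by simp [hc₀, initial]; exact Nat.mod_eq_of_lt (by omega)) (by simp [hc₀, initial]; exact Nat.mod_eq_of_lt (by omega)) hn
      (by simp [hc₀, initial]) hβ (by omega) hH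
      { todo := [setup, attempts], mem := c₀.mem, depth := 1, work := 1 } [attempts] rfl rfl
  refine ⟨c₀.mem 1, c₀.mem 2, L, K, c, _, _, h1, hstep.trans g1,
    ⟨g2, ⟨?_, g5 _ (by decide), g5 _ (by decide), g6, g7, g8, g9⟩, ?_⟩, g10, g11, g12, g13, g14,
    g15, g3, g4, by simp only; omega, by simp only; omega⟩
  · rw [g5 _ (by decide)]
    simp [hc₀, initial]; exact Nat.mod_eq_of_lt (by omega)
  · rw [g5 _ (by decide)]
    simp [hc₀, initial]

end

/-! ### Elementary size estimates. -/

theorem _root_.SimpleGraph.two_mul_ncard_edgeSet_le {n : ℕ} (G : SimpleGraph (Fin n)) :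
    2 * G.edgeSet.ncard ≤ n ^ 2 := by
  classical
  rw [Set.ncard_eq_toFinset_card', ← SimpleGraph.edgeFinset, ← G.sum_degrees_eq_twice_card_edges]
  calc ∑ v, G.degree v ≤ ∑ _v : Fin n, n := Finset.sum_le_sum fun v _ => by
        simpa using (G.degree_lt_card_verts v).le
    _ = n ^ 2 := by simp [sq]

theorem IsAdjacencyArray.le_two_mul_ncard {n : ℕ} {G : SimpleGraph (Fin n)} {off tgt : ℕ → ℕ}
    (h : IsAdjacencyArray G off tgt) (hG : ∀ v, ∃ u, G.Adj v u) : n ≤ 2 * G.edgeSet.ncard := by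
  rw [← h.off_last, ← h.sum_slots]
  calc n = ∑ _v : Fin n, 1 := by simp
    _ ≤ _ := Finset.sum_le_sum fun v _ => by
        obtain ⟨u, hu⟩ := hG v
        obtain ⟨j, ⟨h1, h2, -⟩, -⟩ := h.slot_of_adj v u hu
        omega

/-- Since `n ≥ 2`, the additive `j * log 2` is absorbed into a multiple of `log n`; the factor `3 /
2` comes from `log 2 > 2 / 3`. -/
theorem natCast_le_log {n j k : ℕ} (hn : 2 ≤ n) (h : 2 ^ k ≤ 2 ^ j * n) :
    (k : ℝ) ≤ 3 / 2 * (j + 1) * Real.log n := by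
  have h2 := Real.log_two_gt_d9
  have hn' : (2 : ℝ) ≤ n := by exact_mod_cast hn
  have hlog : Real.log 2 ≤ Real.log n := Real.log_le_log (by norm_num) hn'
  have h1 : (k : ℝ) * Real.log 2 ≤ j * Real.log 2 + Real.log n := by
    rw [← Real.log_pow, ← Real.log_pow, ← Real.log_mul (by positivity) (by positivity)]
    exact Real.log_le_log (by positivity) (by exact_mod_cast h)
  have h3 : (j : ℝ) * Real.log 2 ≤ j * Real.log n := by gcongr
  have h4 : (k : ℝ) * (2 / 3) ≤ k * Real.log 2 := by gcongr; linarith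
  linarith

end PRAM

/-! ### Assembly of the bounds. -/

namespace PRAM

theorem isCost_depth {w : ℕ} {β : ℝ} {ρ : Resolver} : IsCost w β ρ Config.depth :=
  fun _ _ h => depth_le_of_step h

theorem isCost_work {w : ℕ} {β : ℝ} {ρ : Resolver} : IsCost w β ρ Config.work :=
  fun _ _ h => work_le_of_step h

/-- The bounds in terms of integers. -/
theorem partition_spec {n : ℕ} (hn : 2 ≤ n) {G : SimpleGraph (Fin n)} {off tgt : ℕ → ℕ}
    (hadj : IsAdjacencyArray G off tgt) {β : ℝ} (hβ : 0 < β) (hβ' : β ≤ 1 / 2) {w : ℕ}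
    (hw : n ^ 24 ≤ 2 ^ w) (ρ : Resolver) :
    ∃ L K : ℕ, 2 ^ L ≤ 2 ^ 5 * n ∧ β * K ≤ 16 ∧
      (∀ t, ∀ c ∈ (runFor w β ρ t (initial w partition n G.edgeSet.ncard off tgt)).support,
        c.todo = [] →
        IsLowDiameterDecomposition G β ((2 * (L * K) : ℕ) : ℝ) (output n c)) ∧
      expectedDepth w β ρ (initial w partition n G.edgeSet.ncard off tgt) ≤
        ((10200 * (L * K) * (2 * Nat.log 2 n + 9) : ℕ) : ℝ≥0∞) ∧
      expectedWork w β ρ (initial w partition n G.edgeSet.ncard off tgt) ≤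
        ((10 ^ 7 * (n + G.edgeSet.ncard + 1) : ℕ) : ℝ≥0∞) := by
  set m := G.edgeSet.ncard with hm
  have hm2 : 2 * m ≤ n ^ 2 := G.two_mul_ncard_edgeSet_le
  have hw20 : 20 ≤ w := by
    have h1 : 2 ^ 24 ≤ 2 ^ w := (Nat.pow_le_pow_left hn 24).trans hw
    have := (Nat.pow_le_pow_iff_right (by norm_num : 1 < 2)).1 h1
    omega
  have hn2 : 2 * n ≤ n ^ 2 := by nlinarith
  -- The exponent `24` splits into `20`, which pays for numerical constants because `n ≥ 2`, and
  -- `4`, which pays for the range `2 ^ L * K` of the random words.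
  have hw3 : 2 ^ 20 * n ^ 4 ≤ 2 ^ w :=
    calc 2 ^ 20 * n ^ 4 ≤ n ^ 20 * n ^ 4 := Nat.mul_le_mul_right _ (Nat.pow_le_pow_left hn 20)
      _ = n ^ 24 := by ring
      _ ≤ _ := hw
  have hn4 : 4 * n ^ 2 ≤ n ^ 4 :=
    calc 4 * n ^ 2 = 2 ^ 2 * n ^ 2 := by norm_num
      _ ≤ n ^ 2 * n ^ 2 := Nat.mul_le_mul_right _ (Nat.pow_le_pow_left hn 2)
      _ = n ^ 4 := by ring
  -- Chosen so that `2 ^ H ≥ 64 * n ^ 2`, which exceeds the size of every array that is scanned.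
  set H := 2 * (Nat.log 2 n + 4) with hH
  have hH2 : 64 * n ^ 2 ≤ 2 ^ H := by
    have h1 : n < 2 ^ (Nat.log 2 n + 1) := Nat.lt_pow_succ_log_self (by norm_num) n
    calc 64 * n ^ 2 = (8 * n) ^ 2 := by ring
      _ ≤ (8 * 2 ^ (Nat.log 2 n + 1)) ^ 2 := Nat.pow_le_pow_left (by omega) 2
      _ = 2 ^ H := by rw [hH]; ring
  obtain ⟨O, A, L, K, c, d, k, hOA, hc, hhead, hnL, hLn, hK8, hKm, hβK, hβK', hcd, hck, hd, hk⟩ :=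
    exists_isHead (β := β) (ρ := ρ) hw20 (by omega) hadj hβ' (by omega) (H := H) (by omega)
  rw [← hm] at hhead hKm hβK' hk hc
  have hL : 0 < L := by
    rcases Nat.eq_zero_or_pos L with rfl | h
    · omega
    · exact h
  have hL2 : L < 2 ^ L := Nat.lt_two_pow_self
  have hLK : 2 ^ L * K ≤ 1024 * n ^ 4 := by
    calc 2 ^ L * K ≤ (32 * n) * (32 * n ^ 2) := Nat.mul_le_mul hLn (by omega)
      _ = 1024 * (n * n ^ 2) := by ring
      _ ≤ 1024 * (n ^ 2 * n ^ 2) := by gcongr; omega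
      _ = 1024 * n ^ 4 := by ring
  have hatt : ∀ (f : Config → ℕ) (F : ℕ), (∀ c c' d k, c'.depth = c.depth + d →
      c'.work = c.work + k → d ≤ 5000 * (L * K) * (H + 1) + 20 →
      k ≤ 100100 * (n + 2 * m + K + L + 1) → f c' ≤ f c + F) →
      ∀ c, IsHead n (2 * m) L K O A c → IsAttempt w β ρ f (IsHead n (2 * m) L K O A)
        (fun c' => IsLowDiameterDecomposition G β ((2 * (L * K) : ℕ) : ℝ) (output n c')) F c :=
    fun f F hf c hc => hc.isAttempt hw20 hOA (by omega) (by omega) hL hnL hβ hβK' (by omega)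
      (by omega) (by omega) (by push_cast; exact le_rfl) hf
  have hdepth := hatt Config.depth (5000 * (L * K) * (H + 1) + 20)
    fun c c' d k h1 h2 h3 h4 => by omega
  have hwork := hatt Config.work (100100 * (n + 2 * m + K + L + 1))
    fun c c' d k h1 h2 h3 h4 => by omega
  refine ⟨L, K, hLn, hβK, fun t c' hc' hc'' => ?_, iSup_le fun t => ?_, iSup_le fun t => ?_⟩
  · exact valid_of_attempts hdepth (fun c h => by simp [h.todo]) t hhead
      (hc.mem_support hc' hc'') hc''
  · refine (isCost_depth.mean_le_of_reaches hc t).trans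
      ((mean_le_of_attempts isCost_depth hdepth t hhead).trans ?_)
    have h1 : 1 ≤ L * K := Nat.mul_pos hL (by omega)
    have h2 : H + 1 ≤ L * K * (H + 1) := Nat.le_mul_of_pos_left _ h1
    have h3 : 10200 * (L * K) * (2 * Nat.log 2 n + 9) = 10200 * (L * K * (H + 1)) := by
      rw [hH]; ring
    have h4 : 5000 * (L * K) * (H + 1) = 5000 * (L * K * (H + 1)) := by ring
    rw [h3, h4]
    exact_mod_cast (by omega)
  · refine (isCost_work.mean_le_of_reaches hc t).trans
      ((mean_le_of_attempts isCost_work hwork t hhead).trans ?_)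
    exact_mod_cast (by omega)

end PRAM

/-- There is one PRAM program that, on words of `O(log n)` bits and whatever the resolution of
concurrent writes, turns every graph and every real `0 < β ≤ 1/2` into a `(β, O(log n / β))`
decomposition, in expected depth `O(log² n / β)` and expected work `O(n + m)`, which is `O(m)` when
there are no isolated vertices. -/
theorem theorem1 :
    ∃ (partition : PRAM.Cmd) (b : ℕ) (C : ℝ),
      ∀ (n : ℕ) (_ : 2 ≤ n) (G : SimpleGraph (Fin n)) (off tgt : ℕ → ℕ)
        (_ : PRAM.IsAdjacencyArray G off tgt) (β : ℝ) (_ : 0 < β) (_ : β ≤ 1 / 2)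
        (w : ℕ) (_ : n ^ b ≤ 2 ^ w) (ρ : PRAM.Resolver),
        (∀ (t : ℕ) (c : PRAM.Config),
          c ∈ (PRAM.runFor w β ρ t
            (PRAM.initial w partition n G.edgeSet.ncard off tgt)).support →
          c.todo = [] →
          IsLowDiameterDecomposition G β (C * (Real.log n / β)) (PRAM.output n c)) ∧
        PRAM.expectedDepth w β ρ (PRAM.initial w partition n G.edgeSet.ncard off tgt)
          ≤ ENNReal.ofReal (C * (Real.log n ^ 2 / β)) ∧
        PRAM.expectedWork w β ρ (PRAM.initial w partition n G.edgeSet.ncard off tgt)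
          ≤ ENNReal.ofReal (C * ((n : ℝ) + (G.edgeSet.ncard : ℝ))) ∧
        ((∀ v : Fin n, ∃ u : Fin n, G.Adj v u) →
          PRAM.expectedWork w β ρ (PRAM.initial w partition n G.edgeSet.ncard off tgt)
            ≤ ENNReal.ofReal (C * (G.edgeSet.ncard : ℝ))) := by
  -- The constants needed are `288` for the diameter, `10200 * 144 * 17 = 24969600` for the depth,
  -- and at most `4 * 10 ^ 7` for the work, the last because `n + m + 1 ≤ 4 * m` without isolated
  -- vertices; `10 ^ 8` covers all of them.
  refine ⟨PRAM.partition, 24, 10 ^ 8, fun n hn G off tgt hadj β hβ hβ' w hw ρ => ?_⟩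
  obtain ⟨L, K, hLn, hβK, hvalid, hdepth, hwork⟩ := PRAM.partition_spec hn hadj hβ hβ' hw ρ
  set m := G.edgeSet.ncard with hm
  have hlog : 0 < Real.log n := Real.log_pos (by exact_mod_cast hn)
  have hL : (L : ℝ) ≤ 9 * Real.log n := by
    have := PRAM.natCast_le_log hn hLn
    norm_num at this
    exact this
  have hK : (K : ℝ) ≤ 16 / β := by
    rw [le_div_iff₀ hβ]; linarith
  have hLK : (L : ℝ) * K ≤ 144 * (Real.log n / β) := by
    calc (L : ℝ) * K ≤ (9 * Real.log n) * (16 / β) := by gcongr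
      _ = _ := by ring
  have hpos : 0 < Real.log n / β := div_pos hlog hβ
  have hH : ((2 * Nat.log 2 n + 9 : ℕ) : ℝ) ≤ 17 * Real.log n := by
    have h1 := PRAM.natCast_le_log (j := 0) (k := Nat.log 2 n) hn (by
      rw [pow_zero, one_mul]; exact Nat.pow_log_le_self 2 (by omega))
    have h2 := PRAM.natCast_le_log (j := 0) (k := 1) hn (by omega)
    push_cast at h1 h2 ⊢
    linarith
  refine ⟨fun t c hc hc' => ?_, hdepth.trans ?_, hwork.trans ?_, fun hG => hwork.trans ?_⟩
  · obtain ⟨h1, h2, h3⟩ := hvalid t c hc hc'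
    refine ⟨h1, fun S hS u v => ⟨(h2 S hS u v).1, (h2 S hS u v).2.trans ?_⟩, h3⟩
    push_cast
    linarith
  · rw [← ENNReal.ofReal_natCast]
    refine ENNReal.ofReal_le_ofReal ?_
    rw [Nat.cast_mul, Nat.cast_mul, Nat.cast_mul, Nat.cast_ofNat]
    calc (10200 : ℝ) * (L * K) * ((2 * Nat.log 2 n + 9 : ℕ) : ℝ)
        ≤ 10200 * (144 * (Real.log n / β)) * (17 * Real.log n) := by gcongr
      _ = 24969600 * (Real.log n ^ 2 / β) := by ring
      _ ≤ _ := by gcongr; norm_num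
  · rw [← ENNReal.ofReal_natCast]
    refine ENNReal.ofReal_le_ofReal ?_
    have : (2 : ℝ) ≤ n := by exact_mod_cast hn
    have : (0 : ℝ) ≤ m := by positivity
    push_cast
    linarith
  · rw [← ENNReal.ofReal_natCast]
    refine ENNReal.ofReal_le_ofReal ?_
    have h1 : (n : ℝ) ≤ 2 * m := by exact_mod_cast hadj.le_two_mul_ncard hG
    have : (2 : ℝ) ≤ n := by exact_mod_cast hn
    push_cast
    linarith
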